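/- Let $G$ be a finite simple graph on the vertex set $\{x_1,\dots,x_n\}$ that is co-chordal, i.e. its complement $G^c$ is chordal: the vertices can be ordered $z_1,\dots,z_n$ so that for each $i$ the neighbours of $z_i$ in $G^c$ among $z_{i+1},\dots,z_n$ are pairwise adjacent in $G^c$. Let $\Bbbk$ be a field, $S=\Bbbk[x_1,\dots,x_n]$, and let $I(G)\subseteq S$ be the edge ideal of $G$, generated by the monomials $x_ix_j$ with $x_i,x_j$ adjacent in $G$. Let $\cdots\to F_1\to F_0\to I(G)\to 0$ be the minimal $\mathbb N^n$-graded free resolution of $I(G)$, with $F_k=\bigoplus_j S(-\mathbf a_{kj})$, and let $\operatorname{pd} I(G)$ be its length. For $k\ge 0$ let $\mathrm{HS}_k(I(G))$ be the $k$-th homological shift ideal, generated by the monomials $\mathbf x^{\mathbf a_{kj}}$ for all $j$. A monomial ideal has linear quotients if its minimal monomial generators can be ordered $m_1,\dots,m_q$ so that for each $1\le i<q$ the ideal $(m_1,\dots,m_i):m_{i+1}$ is generated by variables. For $1\le k\le \operatorname{pd} I(G)$ put $LQ_k(G)=T$ if the (nonzero) ideal $\mathrm{HS}_k(I(G))$ has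 linear quotients, and $LQ_k(G)=F$ if it does not. Then the sequence $(LQ_k(G))_{1\le k\le \operatorname{pd} I(G)}$ is not equal to $TFTF$. That is, it is impossible that $\operatorname{pd} I(G)=4$, that $\mathrm{HS}_1(I(G))$ and $\mathrm{HS}_3(I(G))$ have linear quotients, and that $\mathrm{HS}_2(I(G))$ and $\mathrm{HS}_4(I(G))$ do not. -/

import Mathlib

open MvPolynomial

noncomputable section

section Graphs

variable {V : Type*}

/-- An enumeration `z 0, z 1, …, z (n - 1)` of all the vertices of `H` is a perfect elimination
ordering if, for each `i`, the neighbours of `z i` among `z i, z (i + 1), …, z (n - 1)` are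
pairwise adjacent. -/
def IsPerfectEliminationOrdering (H : SimpleGraph V) {n : ℕ} (z : Fin n ≃ V) : Prop :=
  ∀ i : Fin n, H.IsClique {v | H.Adj (z i) v ∧ ∃ j, i ≤ j ∧ z j = v}

/-- A (finite) graph is chordal if it has a perfect elimination ordering. -/
def IsChordal (H : SimpleGraph V) : Prop :=
  ∃ (n : ℕ) (z : Fin n ≃ V), IsPerfectEliminationOrdering H z

/-- A graph is co-chordal if its complement is chordal. -/
def IsCoChordal (G : SimpleGraph V) : Prop :=
  IsChordal Gᶜ

/-- The edge ideal `I(G)`, in the polynomial ring whose variables are the vertices of `G`. -/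
def edgeIdeal (K : Type*) [Field K] (G : SimpleGraph V) : Ideal (MvPolynomial V K) :=
  Ideal.span {f | ∃ u v, G.Adj u v ∧ f = X u * X v}

end Graphs

section MonomialIdeals

variable {σ K : Type*} [Field K]

/-- The exponents of the minimal monomial generators of a monomial ideal `I`: the exponents of
the monomials in `I` no proper divisor of which lies in `I`. -/
def minGens (I : Ideal (MvPolynomial σ K)) : Set (σ →₀ ℕ) :=
  {a | monomial a (1 : K) ∈ I ∧ ∀ b, b < a → monomial b (1 : K) ∉ I}

/-- A monomial ideal `I` has linear quotients if its minimal monomial generators can be listed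
without repetition as `m 0, …, m (q - 1)` such that each colon ideal
`(m 0, …, m (i - 1)) : m i` with `0 < i < q` is generated by variables. -/
def HasLinearQuotients (I : Ideal (MvPolynomial σ K)) : Prop :=
  ∃ (q : ℕ) (m : Fin q → (σ →₀ ℕ)), Function.Injective m ∧ Set.range m = minGens I ∧
    ∀ i : Fin q, 0 < i.val → ∃ T : Set σ,
      (Ideal.span {f | ∃ j, j < i ∧ f = monomial (m j) (1 : K)}).colon
          {monomial (m i) (1 : K)} =
        Ideal.span {f | ∃ v ∈ T, f = X v}

/-- A minimal `ℕ^σ`-graded free resolution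
`⋯ → F₂ → F₁ → F₀ → I → 0` of a monomial ideal `I` of the polynomial ring `S`. The module `F k` is
`S ^ rank k`, its `j`-th basis element having degree `shift k j`, so that
`F k = ⨁ j, S(-shift k j)`. -/
structure MinimalFreeResolution (I : Ideal (MvPolynomial σ K)) where
  rank : ℕ → ℕ
  shift : (k : ℕ) → Fin (rank k) → (σ →₀ ℕ)
  /-- the augmentation `F 0 → I` -/
  aug : (Fin (rank 0) → MvPolynomial σ K) →ₗ[MvPolynomial σ K] MvPolynomial σ K
  /-- the differential `F (k + 1) → F k` -/
  d : (k : ℕ) → (Fin (rank (k + 1)) → MvPolynomial σ K) →ₗ[MvPolynomial σ K]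
    (Fin (rank k) → MvPolynomial σ K)
  /-- the augmentation preserves the grading -/
  aug_graded : ∀ j, ∃ c : K, aug (Pi.single j 1) = monomial (shift 0 j) c
  /-- the differentials preserve the grading: the entry of the matrix of `d k` in row `i` and
  column `j` is a scalar times `x ^ (shift (k + 1) j - shift k i)`, and is zero if this
  quotient of monomials is not a monomial -/
  d_graded : ∀ k j i, ∃ c : K,
    monomial (shift k i) (1 : K) * d k (Pi.single j 1) i = monomial (shift (k + 1) j) c
  range_aug : LinearMap.range aug = I
  exact_zero : Function.Exact (d 0) aug
  exact_succ : ∀ k, Function.Exact (d (k + 1)) (d k)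
  /-- minimality: the image of `d k` lies in `(x₁, …, xₙ) F k` -/
  minimal : ∀ k y i, d k y i ∈ Ideal.span (Set.range (X : σ → MvPolynomial σ K))

/-- `a` is one of the shifts in homological degree `k` of the minimal free resolution of `I`
(which is unique up to isomorphism). -/
def IsShift (I : Ideal (MvPolynomial σ K)) (k : ℕ) (a : σ →₀ ℕ) : Prop :=
  ∃ (F : MinimalFreeResolution I) (j : Fin (F.rank k)), F.shift k j = a

/-- The `k`-th homological shift ideal `HS_k(I)`. -/
def homologicalShiftIdeal (k : ℕ) (I : Ideal (MvPolynomial σ K)) : Ideal (MvPolynomial σ K) :=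
  Ideal.span {f | ∃ a, IsShift I k a ∧ f = monomial a (1 : K)}

/-- The projective dimension of `I`, as the length of its minimal free resolution: the largest
`k` for which the `k`-th free module is not zero (and `⊥` for the zero ideal). -/
def pd (I : Ideal (MvPolynomial σ K)) : WithBot ℕ∞ :=
  ⨆ (k : ℕ) (_ : ∃ a, IsShift I k a), (k : WithBot ℕ∞)

end MonomialIdeals

/-- The sequence `LQ_k(G)`, `1 ≤ k ≤ pd I(G)`, is equal to the word `w`, where `true` stands for
the letter T (`HS_k(I(G))` is nonzero and has linear quotients) and `false` for the letter F
(`HS_k(I(G))` is nonzero and does not have linear quotients). -/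
def LQSequenceEq (K : Type*) [Field K] {V : Type*} (G : SimpleGraph V) (w : List Bool) : Prop :=
  pd (edgeIdeal K G) = (w.length : WithBot ℕ∞) ∧
    ∀ i : Fin w.length,
      homologicalShiftIdeal (i.val + 1) (edgeIdeal K G) ≠ ⊥ ∧
        (w.get i = true ↔ HasLinearQuotients (homologicalShiftIdeal (i.val + 1) (edgeIdeal K G)))

end

/-! ### Chordal graphs: simplicial vertices, clique cuts, and linear quotient orders on families of
sets. -/

section Combinatorics

variable {V : Type*} [DecidableEq V]

/-! Let `H` be the complement of `G`, a chordal graph. The resolution of the edge ideal is linear,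
and its shifts in homological degree `k` are the squarefree monomials on the `(k + 2)`-sets of
vertices that induce a disconnected subgraph of `H` (`isShift_edgeIdeal_iff`). Linear quotients for
a squarefree ideal generated in one degree amount to an exchange order on the supports
(`hasLinearQuotients_squarefreeIdeal_iff`). Projective dimension 4 means that no disconnected set
has more than six vertices, so the theorem reduces to `hasLinearQuotientOrder_four`: if the
disconnected 5-sets have such an order and the 6-sets do not, then the 4-sets have one, against the
second letter F.

The combinatorial half determines `H` almost completely. A simplicial vertex `v` lies in every
disconnected 6-set, and deleting it transports an order of the 5-sets to all 6-sets except possibly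
the set of non-neighbours of `v`. Failure for the 6-sets therefore makes every simplicial vertex
exceptional. This leaves exactly two simplicial vertices `a`, `b` and exactly two 6-sets `W_a`,
`W_b` (`exists_isTwoEnded`). An order of the 5-sets must pass from subsets of `W_a` to subsets of
`W_b` through middle sets lying in neither. A middle set splits off a pair at `a` or at `b`, and
each end admits at most one (`isPairPart_unique`). Counting gives two elements in `W_b \ W_a` and
two possible shapes for the middle sets (`exists_configuration`). All but eight vertices are then
universal in `H`, hence irrelevant, and the remaining eight induce `chainGraph` or `wideChainGraph`.
For the first graph an explicit order of the 4-sets exists; for the second the 5-sets have no order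
(`not_hasLinearQuotientOrder_wideChain`), so it does not occur.

The algebraic half replaces a minimal multigraded resolution by its matrices of scalars
(`ScalarComplex`), whose strands below an exponent of a monomial of the ideal are exact. A
Mayer–Vietoris induction along simplicial vertices gives linearity (`acyclic_facets_self`).
Linearity puts each squarefree degree in a single homological degree, so Euler characteristics of
strands and inversion over subsets determine the Betti numbers. They equal the number of vertices
without a later neighbour in an elimination ordering, minus one (`bettiNumber_eq`), which is
positive exactly on the disconnected sets. -/

/-- The induced subgraph of `H` on `W` is disconnected: `W` splits into two nonempty parts with no
edge of `H` between them. -/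
def InducesDisconnected (H : SimpleGraph V) (W : Finset V) : Prop :=
  ∃ A B : Finset V, A.Nonempty ∧ B.Nonempty ∧ Disjoint A B ∧ A ∪ B = W ∧
    ∀ x ∈ A, ∀ y ∈ B, ¬ H.Adj x y

/-- The neighbours of `z` in `X` are pairwise adjacent. -/
def IsSimplicialIn (H : SimpleGraph V) (X : Finset V) (z : V) : Prop :=
  z ∈ X ∧ ∀ x ∈ X, ∀ y ∈ X, H.Adj z x → H.Adj z y → x ≠ y → H.Adj x y

/-- Every nonempty induced subgraph has a simplicial vertex. -/
def HasSimplicialVertices (H : SimpleGraph V) : Prop :=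
  ∀ X : Finset V, X.Nonempty → ∃ z, IsSimplicialIn H X z

/-- `X` is a clique of `H`, as a statement about a finset. -/
def IsCliqueOn (H : SimpleGraph V) (X : Finset V) : Prop :=
  ∀ x ∈ X, ∀ y ∈ X, x ≠ y → H.Adj x y

variable {H : SimpleGraph V}

theorem InducesDisconnected.symm_parts {A B W : Finset V} (hA : A.Nonempty) (hB : B.Nonempty)
    (hd : Disjoint A B) (hW : A ∪ B = W) (h : ∀ x ∈ A, ∀ y ∈ B, ¬ H.Adj x y) :
    B.Nonempty ∧ A.Nonempty ∧ Disjoint B A ∧ B ∪ A = W ∧ ∀ x ∈ B, ∀ y ∈ A, ¬ H.Adj x y :=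
  ⟨hB, hA, hd.symm, by rw [Finset.union_comm, hW], fun x hx y hy hxy => h y hy x hx hxy.symm⟩

theorem inducesDisconnected_of_isolated {W : Finset V} {z w : V} (hz : z ∈ W) (hw : w ∈ W)
    (hne : w ≠ z) (h : ∀ y ∈ W, ¬ H.Adj z y) : InducesDisconnected H W := by
  refine ⟨{z}, W.erase z, ⟨z, by simp⟩, ⟨w, by simp [hw, hne]⟩, by simp, ?_, ?_⟩
  · ext x; by_cases hx : x = z <;> simp [hx, hz]
  · intro x hx y hy
    simp only [Finset.mem_singleton] at hx
    subst hx
    exact h y (Finset.mem_of_mem_erase hy)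

/-- The neighbours of a simplicial vertex form a clique, so they meet only one of the two parts; the
vertex can join that part. -/
theorem InducesDisconnected.of_erase {X : Finset V} {z : V} (hz : IsSimplicialIn H X z)
    (h : InducesDisconnected H (X.erase z)) : InducesDisconnected H X := by
  obtain ⟨A, B, hA, hB, hd, hU, hn⟩ := h
  wlog hBz : ∀ y ∈ B, ¬ H.Adj z y generalizing A B
  · obtain ⟨hB', hA', hd', hU', hn'⟩ := InducesDisconnected.symm_parts hA hB hd hU hn
    refine this B A hB' hA' hd' hU' hn' ?_
    push Not at hBz
    obtain ⟨y, hy, hzy⟩ := hBz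
    intro x hx hzx
    have hxX : x ∈ X.erase z := hU ▸ Finset.mem_union_left _ hx
    have hyX : y ∈ X.erase z := hU ▸ Finset.mem_union_right _ hy
    have hne : x ≠ y := fun e => (Finset.disjoint_left.mp hd hx) (e ▸ hy)
    exact hn x hx y hy (hz.2 x (Finset.mem_of_mem_erase hxX) y (Finset.mem_of_mem_erase hyX)
      hzx hzy hne)
  refine ⟨insert z A, B, by simp, hB, ?_, ?_, ?_⟩
  · rw [Finset.disjoint_insert_left]
    refine ⟨fun hzB => ?_, hd⟩
    have : z ∈ X.erase z := hU ▸ Finset.mem_union_right _ hzB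
    simp at this
  · rw [Finset.insert_union, hU, Finset.insert_erase hz.1]
  · intro x hx y hy
    rcases Finset.mem_insert.mp hx with rfl | hx
    · exact hBz y hy
    · exact hn x hx y hy

theorem InducesDisconnected.erase_or_isolated {X : Finset V} (z : V) (hzX : z ∈ X)
    (h : InducesDisconnected H X) :
    InducesDisconnected H (X.erase z) ∨ ∀ y ∈ X, ¬ H.Adj z y := by
  obtain ⟨A, B, hA, hB, hd, hU, hn⟩ := h
  wlog hzA : z ∈ A generalizing A B
  · obtain ⟨hB', hA', hd', hU', hn'⟩ := InducesDisconnected.symm_parts hA hB hd hU hn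
    refine this B A hB' hA' hd' hU' hn' ?_
    rw [← hU] at hzX
    exact (Finset.mem_union.mp hzX).resolve_left hzA
  by_cases hAz : (A.erase z).Nonempty
  · left
    have hzB : z ∉ B := Finset.disjoint_left.mp hd hzA
    refine ⟨A.erase z, B, hAz, hB, hd.mono_left (Finset.erase_subset _ _), ?_,
      fun x hx => hn x (Finset.mem_of_mem_erase hx)⟩
    rw [← hU, Finset.erase_union_distrib, Finset.erase_eq_of_notMem hzB]
  · right
    intro y hy hzy
    rw [← hU] at hy
    rcases Finset.mem_union.mp hy with hy | hy
    · exact hAz ⟨y, Finset.mem_erase.mpr ⟨hzy.ne', hy⟩⟩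
    · exact hn z hzA y hy hzy

/-- Dirac: a chordal graph that is not complete has two nonadjacent simplicial vertices. -/
theorem exists_two_simplicial (hH : HasSimplicialVertices H) (U : Finset V)
    (hU : ¬ IsCliqueOn H U) :
    ∃ x y, x ≠ y ∧ ¬ H.Adj x y ∧ IsSimplicialIn H U x ∧ IsSimplicialIn H U y := by
  induction U using Finset.strongInduction with
  | H U ih =>
    have hne : U.Nonempty := by
      by_contra h
      rw [Finset.not_nonempty_iff_eq_empty] at h
      subst h
      exact hU (by intro x hx; simp at hx)
    obtain ⟨z, hz⟩ := hH U hne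
    by_cases hc : IsCliqueOn H (U.erase z)
    · have : ∃ y ∈ U, y ≠ z ∧ ¬ H.Adj z y := by
        by_contra hall
        push Not at hall
        apply hU
        intro x hx y hy hxy
        by_cases hxz : x = z
        · subst hxz; exact hall y hy hxy.symm
        · by_cases hyz : y = z
          · subst hyz; exact (hall x hx hxy).symm
          · exact hc x (by simp [hx, hxz]) y (by simp [hy, hyz]) hxy
      obtain ⟨y, hy, hyz, hzy⟩ := this
      refine ⟨z, y, hyz.symm, hzy, hz, hy, ?_⟩
      intro u hu v hv hyu hyv huv
      refine hc u ?_ v ?_ huv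
      · simp only [Finset.mem_erase]; exact ⟨fun e => hzy (e ▸ hyu.symm), hu⟩
      · simp only [Finset.mem_erase]; exact ⟨fun e => hzy (e ▸ hyv.symm), hv⟩
    · obtain ⟨x, y, hxy, hnxy, hx, hy⟩ := ih _ (Finset.erase_ssubset hz.1) hc
      -- A simplicial vertex of `U.erase z` not adjacent to `z` stays simplicial in `U` and pairs
      -- with `z`. Of the two vertices given by induction one qualifies, because they are
      -- nonadjacent and `z` is simplicial.
      have key : ∀ w, IsSimplicialIn H (U.erase z) w → ¬ H.Adj z w →
          ∃ x y, x ≠ y ∧ ¬ H.Adj x y ∧ IsSimplicialIn H U x ∧ IsSimplicialIn H U y := by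
        intro w hw hzw
        have hwU := Finset.mem_erase.mp hw.1
        refine ⟨z, w, hwU.1.symm, hzw, hz, hwU.2, ?_⟩
        intro u hu v hv hwu hwv huv
        refine hw.2 u ?_ v ?_ hwu hwv huv
        · simp only [Finset.mem_erase]; exact ⟨fun e => hzw (e ▸ hwu.symm), hu⟩
        · simp only [Finset.mem_erase]; exact ⟨fun e => hzw (e ▸ hwv.symm), hv⟩
      by_cases hzx : H.Adj z x
      · by_cases hzy : H.Adj z y
        · exact absurd (hz.2 x (Finset.mem_of_mem_erase hx.1) y (Finset.mem_of_mem_erase hy.1)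
            hzx hzy hxy) hnxy
        · exact key y hy hzy
      · exact key x hx hzx

/-- A side of a clique cut contains a simplicial vertex of the whole graph. -/
theorem exists_simplicial_in_part [Fintype V] (hH : HasSimplicialVertices H) {A B : Finset V}
    (hA : A.Nonempty) (hn : ∀ x ∈ A, ∀ y ∈ B, ¬ H.Adj x y) (hT : IsCliqueOn H (A ∪ B)ᶜ) :
    ∃ v ∈ A, IsSimplicialIn H Finset.univ v := by
  -- No vertex of `A` has a neighbour in `B`, so simpliciality may be tested without `B`. Among two
  -- nonadjacent simplicial vertices there, at most one lies in the clique cut, so the other lies in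
  -- `A`.
  have key : ∀ v ∈ A, IsSimplicialIn H (Bᶜ ∪ A) v → IsSimplicialIn H Finset.univ v := by
    intro v hv h
    refine ⟨Finset.mem_univ _, fun x _ y _ hx hy hxy => h.2 x ?_ y ?_ hx hy hxy⟩
    · rw [Finset.mem_union, Finset.mem_compl]; exact Or.inl fun hxB => hn v hv x hxB hx
    · rw [Finset.mem_union, Finset.mem_compl]; exact Or.inl fun hyB => hn v hv y hyB hy
  by_cases hc : IsCliqueOn H (Bᶜ ∪ A)
  · obtain ⟨v, hv⟩ := hA
    exact ⟨v, hv, key v hv ⟨by simp [hv], fun x hx y hy _ _ hxy => hc x hx y hy hxy⟩⟩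
  · obtain ⟨x, y, hxy, hnxy, hx, hy⟩ := exists_two_simplicial hH _ hc
    by_cases hxA : x ∈ A
    · exact ⟨x, hxA, key x hxA hx⟩
    · by_cases hyA : y ∈ A
      · exact ⟨y, hyA, key y hyA hy⟩
      · exfalso
        have h1 := hx.1
        have h2 := hy.1
        simp only [Finset.mem_union, Finset.mem_compl, hxA, hyA, or_false] at h1 h2
        exact hnxy (hT x (by simp [hxA, h1]) y (by simp [hyA, h2]) hxy)

/-- An inclusion-minimal vertex cut of a chordal graph is a clique. -/
theorem isCliqueOn_of_minimal_cut (hH : HasSimplicialVertices H) (T W : Finset V)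
    (hTW : Disjoint T W) (hW : InducesDisconnected H W)
    (hT : ∀ t ∈ T, ¬ InducesDisconnected H (insert t W)) : IsCliqueOn H T := by
  induction hn : W.card generalizing W with
  | zero =>
    obtain ⟨A, B, ⟨a, ha⟩, _, _, rfl, _⟩ := hW
    rw [Finset.card_eq_zero] at hn
    simp [Finset.union_eq_empty] at hn
    simp [hn.1] at ha
  | succ n ih =>
    have hne : (T ∪ W).Nonempty := by
      obtain ⟨A, B, ⟨a, ha⟩, _, _, rfl, _⟩ := hW
      exact ⟨a, by simp [ha]⟩
    obtain ⟨z, hz⟩ := hH _ hne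
    by_cases hzT : z ∈ T
    · exfalso
      apply hT z hzT
      have hzW : z ∉ W := Finset.disjoint_left.mp hTW hzT
      apply InducesDisconnected.of_erase (z := z)
      · refine ⟨by simp, fun x hx y hy => hz.2 x ?_ y ?_⟩
        · rcases Finset.mem_insert.mp hx with rfl | h <;> simp [*]
        · rcases Finset.mem_insert.mp hy with rfl | h <;> simp [*]
      · rwa [Finset.erase_insert hzW]
    · have hzW : z ∈ W := (Finset.mem_union.mp hz.1).resolve_left hzT
      -- A simplicial vertex of `W` is discarded, keeping `T` minimal, unless it is isolated in `W`.
      -- In that case minimality makes it adjacent to all of `T`, which is then a clique.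
      rcases hW.erase_or_isolated z hzW with h | h
      · refine ih (W.erase z) (hTW.mono_right (Finset.erase_subset _ _)) h ?_ ?_
        · intro t ht hD
          apply hT t ht
          have hzt : z ≠ t := fun e => hzT (e ▸ ht)
          apply InducesDisconnected.of_erase (z := z)
          · refine ⟨by simp [hzW], fun x hx y hy => hz.2 x ?_ y ?_⟩
            · rcases Finset.mem_insert.mp hx with rfl | h <;> simp [*]
            · rcases Finset.mem_insert.mp hy with rfl | h <;> simp [*]
          · rwa [Finset.erase_insert_of_ne hzt.symm]
        · rw [Finset.card_erase_of_mem hzW, hn]; rfl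
      · have hadj : ∀ t ∈ T, H.Adj z t := by
          intro t ht
          by_contra hzt
          refine hT t ht (inducesDisconnected_of_isolated (z := z) (w := t) (by simp [hzW])
            (by simp) (fun e => hzT (e ▸ ht)) ?_)
          intro y hy
          rcases Finset.mem_insert.mp hy with rfl | hy
          · exact hzt
          · exact h y hy
        intro x hx y hy hxy
        exact hz.2 x (by simp [hx]) y (by simp [hy]) (hadj x hx) (hadj y hy) hxy

/-- The family `F` of finsets can be ordered with linear quotients: some injective rank function
`r` satisfies the exchange condition. -/
def HasLinearQuotientOrder (F : Set (Finset V)) : Prop :=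
  ∃ r : Finset V → ℕ, Set.InjOn r F ∧ ∀ A ∈ F, ∀ B ∈ F, r B < r A →
    ∃ C ∈ F, r C < r A ∧ ∃ u ∈ B, C \ A = {u}

/-- This removes the order from the exchange condition. When `B` comes after `A`, exchanging `B`
towards `A` gives an earlier set `C` inside `A ∪ B`, and induction on the rank replaces `B` by `C`;
the new element lies outside `A`, hence in `B`. -/
theorem HasLinearQuotientOrder.first_step {F : Set (Finset V)} {m : ℕ}
    (hm : ∀ A ∈ F, A.card = m) (h : HasLinearQuotientOrder F) {A B : Finset V} (hA : A ∈ F)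
    (hB : B ∈ F) (hAB : A ≠ B) : ∃ C ∈ F, ∃ u ∈ B, C \ A = {u} := by
  obtain ⟨r, hinj, hr⟩ := h
  induction hn : r B using Nat.strong_induction_on generalizing B with
  | _ n ih =>
    subst hn
    rcases lt_trichotomy (r B) (r A) with hlt | heq | hgt
    · obtain ⟨C, hC, -, u, hu, hCA⟩ := hr A hA B hB hlt
      exact ⟨C, hC, u, hu, hCA⟩
    · exact absurd (hinj hB hA heq).symm hAB
    · obtain ⟨C, hC, hCB, w, hw, hCw⟩ := hr B hB A hA hgt
      have hsub : C ⊆ A ∪ B := by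
        intro x hx
        by_cases hxB : x ∈ B
        · simp [hxB]
        · have : x ∈ C \ B := by simp [hx, hxB]
          rw [hCw, Finset.mem_singleton] at this
          simp [this, hw]
      by_cases hCA : A = C
      · subst hCA
        have hcard : (B \ A).card = 1 := by
          have h1 := Finset.card_sdiff_add_card_inter A B
          have h2 := Finset.card_sdiff_add_card_inter B A
          rw [hCw, Finset.card_singleton, Finset.inter_comm, hm A hA] at h1
          rw [hm B hB] at h2
          omega
        obtain ⟨u, hu⟩ := Finset.card_eq_one.mp hcard
        exact ⟨B, hB, u, by
          have : u ∈ B \ A := by simp [hu]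
          exact (Finset.mem_sdiff.mp this).1, hu⟩
      · obtain ⟨E, hE, u, hu, hEA⟩ := ih (r C) hCB hC hCA rfl
        refine ⟨E, hE, u, ?_, hEA⟩
        have huA : u ∉ A := by
          have : u ∈ E \ A := by simp [hEA]
          exact (Finset.mem_sdiff.mp this).2
        exact (Finset.mem_union.mp (hsub hu)).resolve_left huA

end Combinatorics

/-! ### The disconnected 6-sets: reduction to graphs with two ends. -/

section Combinatorics

set_option linter.unusedSectionVars false

variable {V : Type*} [DecidableEq V]

/-- The `m`-element sets of vertices that induce a disconnected subgraph. -/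
def disconnectedSets (H : SimpleGraph V) (m : ℕ) : Set (Finset V) :=
  {W | InducesDisconnected H W ∧ W.card = m}

open Classical in
/-- The vertices not adjacent to `v`, including `v` itself. -/
noncomputable def nonNeighbors [Fintype V] (H : SimpleGraph V) (v : V) : Finset V :=
  Finset.univ.filter fun w => ¬ H.Adj v w

variable [Fintype V] {H : SimpleGraph V}

@[simp] theorem mem_nonNeighbors {v w : V} : w ∈ nonNeighbors H v ↔ ¬ H.Adj v w := by
  simp [nonNeighbors]

theorem IsSimplicialIn.mono {v : V} (hv : IsSimplicialIn H Finset.univ v) {X : Finset V}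
    (hX : v ∈ X) : IsSimplicialIn H X v :=
  ⟨hX, fun x _ y _ => hv.2 x (Finset.mem_univ _) y (Finset.mem_univ _)⟩

theorem InducesDisconnected.insert_simplicial {v : V} (hv : IsSimplicialIn H Finset.univ v)
    {X : Finset V} (hvX : v ∉ X) (h : InducesDisconnected H X) :
    InducesDisconnected H (insert v X) := by
  apply InducesDisconnected.of_erase (hv.mono (Finset.mem_insert_self v X))
  rwa [Finset.erase_insert hvX]

/-- Adding a missing simplicial vertex would produce a disconnected 7-set. -/
theorem mem_of_isSimplicialIn_of_mem_six (h7 : ∀ W, InducesDisconnected H W → W.card ≤ 6) {v : V}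
    (hv : IsSimplicialIn H Finset.univ v) {W : Finset V} (hW : W ∈ disconnectedSets H 6) :
    v ∈ W := by
  by_contra hvW
  have := h7 _ (hW.1.insert_simplicial hv hvW)
  rw [Finset.card_insert_of_notMem hvW, hW.2] at this
  omega

/-- Here `v` is isolated in `W`, so `W` consists of non-neighbours of `v`. The set of all of them is
itself disconnected, hence has at most six elements. -/
theorem eq_nonNeighbors_of_not_disconnected_erase
    (h7 : ∀ W, InducesDisconnected H W → W.card ≤ 6) {v : V}
    (hv : IsSimplicialIn H Finset.univ v) {W : Finset V} (hW : W ∈ disconnectedSets H 6)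
    (h : ¬ InducesDisconnected H (W.erase v)) : W = nonNeighbors H v := by
  have hvW := mem_of_isSimplicialIn_of_mem_six h7 hv hW
  have hiso := (hW.1.erase_or_isolated v hvW).resolve_left h
  have hsub : W ⊆ nonNeighbors H v := fun y hy => by simpa using hiso y hy
  apply Finset.eq_of_subset_of_card_le hsub
  have hex : ∃ w ∈ W, w ≠ v := by
    have : 1 < W.card := by rw [hW.2]; norm_num
    exact Finset.exists_mem_ne this v
  obtain ⟨w, hw, hwv⟩ := hex
  rw [hW.2]
  exact h7 _ (inducesDisconnected_of_isolated (hsub hvW) (hsub hw) hwv (by simp))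

/-- If the disconnected `5`-sets have linear quotients but the disconnected `6`-sets (the largest
ones) do not, each simplicial vertex `v` is an isolated point of the `6`-set of its
non-neighbours, and appending that set last to an order of the other `6`-sets must fail. -/
theorem exists_bad_of_isSimplicialIn (h7 : ∀ W, InducesDisconnected H W → W.card ≤ 6)
    (h5 : HasLinearQuotientOrder (disconnectedSets H 5))
    (h6 : ¬ HasLinearQuotientOrder (disconnectedSets H 6)) {v : V}
    (hv : IsSimplicialIn H Finset.univ v) :
    nonNeighbors H v ∈ disconnectedSets H 6 ∧
      ¬ InducesDisconnected H ((nonNeighbors H v).erase v) ∧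
      ∃ W' ∈ disconnectedSets H 6, W' ≠ nonNeighbors H v ∧
        ∀ Q ∈ disconnectedSets H 6, ∀ u ∈ W', Q \ nonNeighbors H v ≠ {u} := by
  classical
  by_contra hnot
  apply h6
  obtain ⟨r, hinj, hr⟩ := h5
  set N := Finset.univ.sup r + 1 with hN
  have hlt : ∀ W, r W < N := fun W =>
    Nat.lt_succ_of_le (Finset.le_sup (f := r) (Finset.mem_univ W))
  have herase : ∀ W ∈ disconnectedSets H 6, InducesDisconnected H (W.erase v) →
      W.erase v ∈ disconnectedSets H 5 := fun W hW h =>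
    ⟨h, by rw [Finset.card_erase_of_mem (mem_of_isSimplicialIn_of_mem_six h7 hv hW), hW.2]⟩
  -- A 6-set inherits the rank of the 5-set obtained by deleting `v`. The only possible exception,
  -- `nonNeighbors H v`, receives the value `N`, which exceeds every rank, and so comes last.
  refine ⟨fun W => if InducesDisconnected H (W.erase v) then r (W.erase v) else N, ?_, ?_⟩
  · intro W₁ h₁ W₂ h₂ he
    simp only at he
    split_ifs at he with g₁ g₂ g₂
    · have := hinj (herase _ h₁ g₁) (herase _ h₂ g₂) he
      rw [← Finset.insert_erase (mem_of_isSimplicialIn_of_mem_six h7 hv h₁), this,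
        Finset.insert_erase (mem_of_isSimplicialIn_of_mem_six h7 hv h₂)]
    · exact absurd he (hlt _).ne
    · exact absurd he (hlt _).ne'
    · rw [eq_nonNeighbors_of_not_disconnected_erase h7 hv h₁ g₁,
        eq_nonNeighbors_of_not_disconnected_erase h7 hv h₂ g₂]
  · intro A hA B hB hBA
    have hvA := mem_of_isSimplicialIn_of_mem_six h7 hv hA
    simp only at hBA ⊢
    by_cases gA : InducesDisconnected H (A.erase v)
    · rw [if_pos gA] at hBA ⊢
      have gB : InducesDisconnected H (B.erase v) := by
        by_contra gB
        rw [if_neg gB] at hBA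
        exact absurd hBA (hlt _).not_gt
      rw [if_pos gB] at hBA
      obtain ⟨C, hC, hCA, u, hu, hCu⟩ := hr _ (herase _ hA gA) _ (herase _ hB gB) hBA
      have hvC : v ∉ C := by
        intro hvC
        have : v ∈ C \ A.erase v := by simp [hvC]
        rw [hCu, Finset.mem_singleton] at this
        subst this
        simp at hu
      -- The exchange partner among the 5-sets avoids `v`; restoring `v` to both sets leaves their
      -- difference unchanged.
      refine ⟨insert v C, ⟨hC.1.insert_simplicial hv hvC, ?_⟩, ?_, u, Finset.mem_of_mem_erase hu, ?_⟩
      · rw [Finset.card_insert_of_notMem hvC, hC.2]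
      · rw [Finset.erase_insert hvC, if_pos hC.1]; exact hCA
      · rw [← hCu]
        ext x
        by_cases hx : x = v
        · subst hx; simp [hvA, hvC]
        · simp [hx]
    · have hAv := eq_nonNeighbors_of_not_disconnected_erase h7 hv hA gA
      have hBA' : B ≠ A := by rintro rfl; exact lt_irrefl _ hBA
      rw [if_neg gA]
      have : ∃ Q ∈ disconnectedSets H 6, ∃ u ∈ B, Q \ A = {u} := by
        by_contra hno
        push Not at hno
        refine hnot ⟨hAv ▸ hA, hAv ▸ gA, B, hB, hAv ▸ hBA', ?_⟩
        rw [← hAv]; exact hno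
      obtain ⟨Q, hQ, u, hu, hQu⟩ := this
      refine ⟨Q, hQ, ?_, u, hu, hQu⟩
      have gQ : InducesDisconnected H (Q.erase v) := by
        by_contra gQ
        have := eq_nonNeighbors_of_not_disconnected_erase h7 hv hQ gQ
        rw [this, ← hAv, Finset.sdiff_self] at hQu
        exact absurd hQu (Finset.singleton_ne_empty u).symm
      rw [if_pos gQ]; exact hlt _

theorem isCliqueOn_compl_of_mem_six (hH : HasSimplicialVertices H)
    (h7 : ∀ W, InducesDisconnected H W → W.card ≤ 6) {W : Finset V}
    (hW : W ∈ disconnectedSets H 6) : IsCliqueOn H Wᶜ := by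
  refine isCliqueOn_of_minimal_cut hH _ W disjoint_compl_left hW.1 fun t ht hD => ?_
  have := h7 _ hD
  rw [Finset.card_insert_of_notMem (Finset.mem_compl.mp ht), hW.2] at this
  omega

theorem nonNeighbors_erase_mem {v y : V} (h : nonNeighbors H v ∈ disconnectedSets H 6)
    (hy : y ∈ nonNeighbors H v) (hyv : y ≠ v) :
    (nonNeighbors H v).erase y ∈ disconnectedSets H 5 := by
  have hc : ((nonNeighbors H v).erase y).card = 5 := by rw [Finset.card_erase_of_mem hy, h.2]
  refine ⟨?_, hc⟩
  obtain ⟨w, hw, hwv⟩ := Finset.exists_mem_ne (s := (nonNeighbors H v).erase y) (by omega) v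
  exact inducesDisconnected_of_isolated (z := v) (by simp [hyv.symm]) hw hwv
    fun x hx => by simpa using Finset.mem_of_mem_erase hx

/-- Let `v ≠ a` be simplicial. If `W'` stayed disconnected without `v`, a step between the 5-sets
obtained by deleting `v` would become, on restoring `v`, a step from `W_a` forbidden by `hbad`. So
each such `v` is isolated in `W'`, which is then its set of non-neighbours. There is only one such
vertex: deleting one isolated vertex of `W'` would leave another still isolated. -/
theorem exists_other_end (hH : HasSimplicialVertices H)
    (h7 : ∀ W, InducesDisconnected H W → W.card ≤ 6)
    (h5 : HasLinearQuotientOrder (disconnectedSets H 5)) {a : V}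
    (ha : IsSimplicialIn H Finset.univ a) (hWa : nonNeighbors H a ∈ disconnectedSets H 6)
    {W' : Finset V} (hW' : W' ∈ disconnectedSets H 6) (hne : W' ≠ nonNeighbors H a)
    (hbad : ∀ Q ∈ disconnectedSets H 6, ∀ u ∈ W', Q \ nonNeighbors H a ≠ {u}) :
    ∃ b, IsSimplicialIn H Finset.univ b ∧ b ≠ a ∧ ¬ H.Adj a b ∧ W' = nonNeighbors H b ∧
      ¬ InducesDisconnected H (W'.erase b) ∧
      ∀ v, IsSimplicialIn H Finset.univ v → v = a ∨ v = b := by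
  have key : ∀ v, IsSimplicialIn H Finset.univ v → v ≠ a →
      ¬ InducesDisconnected H (W'.erase v) := by
    intro v hv hva hD
    have hvW := mem_of_isSimplicialIn_of_mem_six h7 hv hWa
    have hvW' := mem_of_isSimplicialIn_of_mem_six h7 hv hW'
    have h1 := nonNeighbors_erase_mem hWa hvW hva
    have h2 : W'.erase v ∈ disconnectedSets H 5 :=
      ⟨hD, by rw [Finset.card_erase_of_mem hvW', hW'.2]⟩
    have h12 : (nonNeighbors H a).erase v ≠ W'.erase v := by
      intro e
      apply hne
      rw [← Finset.insert_erase hvW', ← e, Finset.insert_erase hvW]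
    obtain ⟨C, hC, u, hu, hCu⟩ := h5.first_step (fun A hA => hA.2) h1 h2 h12
    have hvC : v ∉ C := by
      intro hvC
      have : v ∈ C \ (nonNeighbors H a).erase v := by simp [hvC]
      rw [hCu, Finset.mem_singleton] at this
      subst this
      simp at hu
    refine hbad (insert v C) ⟨hC.1.insert_simplicial hv hvC, ?_⟩ u (Finset.mem_of_mem_erase hu) ?_
    · rw [Finset.card_insert_of_notMem hvC, hC.2]
    · rw [← hCu]
      ext x
      by_cases hx : x = v
      · subst hx; simp [hvC] at hvW ⊢; exact hvW
      · simp [hx]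
  have hclique := isCliqueOn_compl_of_mem_six hH h7 hW'
  have haW' := mem_of_isSimplicialIn_of_mem_six h7 ha hW'
  -- The complement of `W'` is a clique cut, so the part of `W'` not containing `a` has a vertex
  -- that is simplicial in `H`.
  have hex : ∃ b, IsSimplicialIn H Finset.univ b ∧ b ≠ a ∧ ¬ H.Adj a b := by
    obtain ⟨A, B, hA, hB, hd, hU, hn⟩ := hW'.1
    wlog haA : a ∈ A generalizing A B
    · obtain ⟨hB', hA', hd', hU', hn'⟩ := InducesDisconnected.symm_parts hA hB hd hU hn
      refine this B A hB' hA' hd' hU' hn' ?_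
      rw [← hU] at haW'
      exact (Finset.mem_union.mp haW').resolve_left haA
    obtain ⟨hB', hA', hd', hU', hn'⟩ := InducesDisconnected.symm_parts hA hB hd hU hn
    obtain ⟨b, hbB, hb⟩ := exists_simplicial_in_part hH hB hn' (by rw [hU']; exact hclique)
    exact ⟨b, hb, fun e => Finset.disjoint_left.mp hd haA (e ▸ hbB), hn a haA b hbB⟩
  obtain ⟨b, hb, hba, hab⟩ := hex
  have hW'b := eq_nonNeighbors_of_not_disconnected_erase h7 hb hW' (key b hb hba)
  refine ⟨b, hb, hba, hab, hW'b, key b hb hba, fun v hv => ?_⟩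
  by_contra hvv
  push Not at hvv
  have hW'v := eq_nonNeighbors_of_not_disconnected_erase h7 hv hW' (key v hv hvv.1)
  have hbv : ¬ H.Adj b v := by
    have : v ∈ W' := mem_of_isSimplicialIn_of_mem_six h7 hv hW'
    rw [hW'b] at this; simpa using this
  -- both `b` and `v` are isolated in `W'`, so deleting `b` leaves it disconnected
  have hvW' := mem_of_isSimplicialIn_of_mem_six h7 hv hW'
  have hbW' := mem_of_isSimplicialIn_of_mem_six h7 hb hW'
  apply key b hb hba
  have hc : (W'.erase b).card = 5 := by rw [Finset.card_erase_of_mem hbW', hW'.2]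
  obtain ⟨w, hw, hwv⟩ := Finset.exists_mem_ne (s := W'.erase b) (by omega) v
  refine inducesDisconnected_of_isolated (z := v) (by simp [hvv.2, hvW']) hw hwv fun y hy => ?_
  have := Finset.mem_of_mem_erase hy
  rw [hW'v] at this; simpa using this

/-- `H` has exactly two simplicial vertices `a` and `b`, and the only disconnected `6`-sets are
their sets of non-neighbours, which differ in at least two elements. -/
structure IsTwoEnded (H : SimpleGraph V) (a b : V) : Prop where
  simplicial_left : IsSimplicialIn H Finset.univ a
  simplicial_right : IsSimplicialIn H Finset.univ b
  ne : a ≠ b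
  not_adj : ¬ H.Adj a b
  eq_or_eq : ∀ v, IsSimplicialIn H Finset.univ v → v = a ∨ v = b
  six : ∀ W ∈ disconnectedSets H 6, W = nonNeighbors H a ∨ W = nonNeighbors H b
  mem_left : nonNeighbors H a ∈ disconnectedSets H 6
  mem_right : nonNeighbors H b ∈ disconnectedSets H 6
  not_left : ¬ InducesDisconnected H ((nonNeighbors H a).erase a)
  not_right : ¬ InducesDisconnected H ((nonNeighbors H b).erase b)
  two_le : 2 ≤ (nonNeighbors H a \ nonNeighbors H b).card

theorem card_sdiff_comm_of_card_eq {A B : Finset V} (h : A.card = B.card) :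
    (A \ B).card = (B \ A).card := by
  have h1 := Finset.card_sdiff_add_card_inter A B
  have h2 := Finset.card_sdiff_add_card_inter B A
  rw [Finset.inter_comm] at h2
  omega

theorem IsTwoEnded.symm {a b : V} (h : IsTwoEnded H a b) : IsTwoEnded H b a where
  simplicial_left := h.simplicial_right
  simplicial_right := h.simplicial_left
  ne := h.ne.symm
  not_adj := fun e => h.not_adj e.symm
  eq_or_eq v hv := (h.eq_or_eq v hv).symm
  six W hW := (h.six W hW).symm
  mem_left := h.mem_right
  mem_right := h.mem_left
  not_left := h.not_right
  not_right := h.not_left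
  two_le := by
    rw [← card_sdiff_comm_of_card_eq (h.mem_left.2.trans h.mem_right.2.symm)]; exact h.two_le

/-- The set unreachable from `W_a` is `W_b` by `exists_other_end`. A third 6-set that is also
unreachable would give another simplicial vertex. A reachable one contains a vertex `u` adjacent to
both `a` and `b`; since each of its parts contains one of `a`, `b`, the vertex `u` would join the
parts. -/
theorem exists_isTwoEnded (hH : HasSimplicialVertices H)
    (h7 : ∀ W, InducesDisconnected H W → W.card ≤ 6)
    (h5 : HasLinearQuotientOrder (disconnectedSets H 5))
    (h6 : ¬ HasLinearQuotientOrder (disconnectedSets H 6)) : ∃ a b, IsTwoEnded H a b := by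
  have hne : (Finset.univ : Finset V).Nonempty := by
    by_contra h
    apply h6
    refine ⟨fun _ => 0, ?_, fun A _ B _ h => absurd h (lt_irrefl _)⟩
    intro A hA
    have hA0 : A = ∅ :=
      Finset.subset_empty.mp ((Finset.not_nonempty_iff_eq_empty.mp h) ▸ Finset.subset_univ A)
    have := hA.2
    rw [hA0] at this
    simp at this
  obtain ⟨a, ha⟩ := hH _ hne
  obtain ⟨hWa, hna, W', hW', hne', hbad⟩ := exists_bad_of_isSimplicialIn h7 h5 h6 ha
  obtain ⟨b, hb, hba, hab, rfl, hnb, honly⟩ := exists_other_end hH h7 h5 ha hWa hW' hne' hbad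
  -- If the two sets differed in a single element, `W_b` would itself be the forbidden step.
  have hcard : 2 ≤ (nonNeighbors H b \ nonNeighbors H a).card := by
    by_contra hlt
    have h0 : (nonNeighbors H b \ nonNeighbors H a).card ≠ 0 := by
      rw [Finset.card_ne_zero, Finset.sdiff_nonempty]
      intro hsub
      exact hne' (Finset.eq_of_subset_of_card_le hsub (by rw [hWa.2, hW'.2]))
    have h1 : (nonNeighbors H b \ nonNeighbors H a).card = 1 := by omega
    obtain ⟨u, hu⟩ := Finset.card_eq_one.mp h1
    refine hbad _ hW' u ?_ hu
    have : u ∈ nonNeighbors H b \ nonNeighbors H a := by simp [hu]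
    exact (Finset.mem_sdiff.mp this).1
  refine ⟨a, b, ha, hb, hba.symm, hab, honly, ?_, hWa, hW', hna, hnb, ?_⟩
  · intro Q hQ
    by_contra hQQ
    push Not at hQQ
    by_cases hQbad : ∀ E ∈ disconnectedSets H 6, ∀ u ∈ Q, E \ nonNeighbors H a ≠ {u}
    · obtain ⟨b', hb', hb'a, -, hQb', -, -⟩ :=
        exists_other_end hH h7 h5 ha hWa hQ hQQ.1 hQbad
      rcases honly b' hb' with rfl | rfl
      · exact hb'a rfl
      · exact hQQ.2 hQb'
    · push Not at hQbad
      obtain ⟨E, hE, u, hu, hEu⟩ := hQbad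
      refine hbad E hE u ?_ hEu
      rw [mem_nonNeighbors]
      intro hbu
      have hua : H.Adj a u := by
        have : u ∈ E \ nonNeighbors H a := by simp [hEu]
        simpa using (Finset.mem_sdiff.mp this).2
      -- the parts of `Q` are separated by `a` and `b`
      obtain ⟨A, B, hA, hB, hd, hU, hn⟩ := hQ.1
      have hcl := isCliqueOn_compl_of_mem_six hH h7 hQ
      obtain ⟨hB', hA', hd', hU', hn'⟩ := InducesDisconnected.symm_parts hA hB hd hU hn
      obtain ⟨x, hxA, hx⟩ := exists_simplicial_in_part hH hA hn (by rw [hU]; exact hcl)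
      obtain ⟨y, hyB, hy⟩ := exists_simplicial_in_part hH hB hn' (by rw [hU']; exact hcl)
      have hxy : x ≠ y := fun e => Finset.disjoint_left.mp hd hxA (e ▸ hyB)
      have hxu : H.Adj x u := by rcases honly x hx with rfl | rfl <;> assumption
      have hyu : H.Adj y u := by rcases honly y hy with rfl | rfl <;> assumption
      rw [← hU] at hu
      rcases Finset.mem_union.mp hu with h | h
      · exact hn u h y hyB hyu.symm
      · exact hn x hxA u h hxu
  · rw [← card_sdiff_comm_of_card_eq (hW'.2.trans hWa.2.symm)]; exact hcard

end Combinatorics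

/-! ### Middle sets: disconnected 5-sets through which an order must pass between the two ends. -/

section Combinatorics

set_option linter.unusedSectionVars false

variable {V : Type*} [DecidableEq V] [Fintype V] {H : SimpleGraph V}

/-- `X` is a middle set: a disconnected `5`-set contained in none of the two disconnected
`6`-sets. -/
structure IsMiddle (H : SimpleGraph V) (a b : V) (X : Finset V) : Prop where
  mem : X ∈ disconnectedSets H 5
  not_subset_left : ¬ X ⊆ nonNeighbors H a
  not_subset_right : ¬ X ⊆ nonNeighbors H b

theorem IsMiddle.symm {a b : V} {X : Finset V} (h : IsMiddle H a b X) : IsMiddle H b a X :=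
  ⟨h.mem, h.not_subset_right, h.not_subset_left⟩

/-- `{a, s}` is a connected part of the disconnected set `X`. -/
structure IsPairPart (H : SimpleGraph V) (a s : V) (X : Finset V) : Prop where
  mem : s ∈ X
  adj : H.Adj a s
  adj_iff : ∀ w, H.Adj s w ↔ w ∉ X ∨ w = a
  not_adj : ∀ x ∈ X, x ≠ s → ¬ H.Adj a x

namespace IsTwoEnded

variable {a b : V}

theorem left_mem_right (h : IsTwoEnded H a b) : a ∈ nonNeighbors H b := by
  simpa using fun e => h.not_adj (SimpleGraph.Adj.symm e)

theorem mem_middle_left (h : IsTwoEnded H a b) {X : Finset V} (hX : IsMiddle H a b X) :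
    a ∈ X := by
  by_contra haX
  have h6 : insert a X ∈ disconnectedSets H 6 :=
    ⟨hX.mem.1.insert_simplicial h.simplicial_left haX,
      by rw [Finset.card_insert_of_notMem haX, hX.mem.2]⟩
  rcases h.six _ h6 with e | e
  · apply hX.not_subset_left
    rw [← e]; exact Finset.subset_insert _ _
  · apply hX.not_subset_right
    rw [← e]; exact Finset.subset_insert _ _

theorem not_disconnected_insert_middle (h : IsTwoEnded H a b) {X : Finset V}
    (hX : IsMiddle H a b X) {t : V} (ht : t ∉ X) : ¬ InducesDisconnected H (insert t X) := by
  intro hD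
  have h6 : insert t X ∈ disconnectedSets H 6 :=
    ⟨hD, by rw [Finset.card_insert_of_notMem ht, hX.mem.2]⟩
  rcases h.six _ h6 with e | e
  · exact hX.not_subset_left (e ▸ Finset.subset_insert _ _)
  · exact hX.not_subset_right (e ▸ Finset.subset_insert _ _)

theorem isCliqueOn_compl_middle (hH : HasSimplicialVertices H) (h : IsTwoEnded H a b)
    {X : Finset V} (hX : IsMiddle H a b X) : IsCliqueOn H Xᶜ :=
  isCliqueOn_of_minimal_cut hH _ X disjoint_compl_left hX.mem.1 fun _ ht =>
    h.not_disconnected_insert_middle hX (Finset.mem_compl.mp ht)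

/-- Since `X` is not contained in `W_a`, it contains a neighbour `s` of `a`, so the small part is
`{a, s}`. A vertex outside `X` not adjacent to `s` would also miss `a`, which is simplicial, and
could be added to the other part. But no disconnected 6-set contains a middle set. -/
theorem isPairPart_of_card_le (h : IsTwoEnded H a b) {X : Finset V} (hX : IsMiddle H a b X)
    {A B : Finset V} (haA : a ∈ A) (hA : A.card ≤ 2) (hd : Disjoint A B)
    (hU : A ∪ B = X) (hn : ∀ x ∈ A, ∀ y ∈ B, ¬ H.Adj x y) : ∃ s, IsPairPart H a s X := by
  obtain ⟨s, hsX, hs⟩ := Finset.not_subset.mp hX.not_subset_left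
  rw [mem_nonNeighbors, not_not] at hs
  have hsA : s ∈ A := by
    rw [← hU] at hsX
    exact (Finset.mem_union.mp hsX).resolve_right fun hsB => hn a haA s hsB hs
  have hAe : A = {a, s} := by
    symm
    apply Finset.eq_of_subset_of_card_le
    · intro x hx
      simp only [Finset.mem_insert, Finset.mem_singleton] at hx
      rcases hx with rfl | rfl <;> assumption
    · rw [Finset.card_pair hs.ne]; exact hA
  have hnA : ∀ x ∈ X, x ≠ a → x ≠ s → x ∈ B := by
    intro x hx hxa hxs
    rw [← hU] at hx
    refine (Finset.mem_union.mp hx).resolve_left fun hxA => ?_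
    rw [hAe] at hxA
    simp [hxa, hxs] at hxA
  refine ⟨s, hsX, hs, fun w => ⟨fun hsw => ?_, fun hw => ?_⟩, fun x hx hxs hax => ?_⟩
  · by_contra hcon
    push Not at hcon
    exact hn s hsA w (hnA w hcon.1 hcon.2 hsw.ne') hsw
  · rcases hw with hw | rfl
    · by_contra hsw
      have haw : ¬ H.Adj a w := fun haw =>
        hsw (h.simplicial_left.2 s (Finset.mem_univ _) w (Finset.mem_univ _) hs haw
          (fun e => hw (e ▸ hsX)))
      apply h.not_disconnected_insert_middle hX hw
      refine ⟨A, insert w B, ⟨a, haA⟩, by simp, ?_, ?_, ?_⟩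
      · rw [Finset.disjoint_insert_right]
        exact ⟨fun hwA => hw (hU ▸ Finset.mem_union_left _ hwA), hd⟩
      · rw [Finset.union_insert, hU]
      · intro x hx y hy
        rcases Finset.mem_insert.mp hy with rfl | hy
        · rw [hAe] at hx
          simp only [Finset.mem_insert, Finset.mem_singleton] at hx
          rcases hx with rfl | rfl <;> assumption
        · exact hn x hx y hy
    · exact hs.symm
  · exact hn a haA x (hnA x hx hax.ne' hxs) hax

/-- The complement of a middle set is a clique cut, so the two parts contain `a` and `b`
respectively; of five vertices, one part receives at most two. -/
theorem exists_isPairPart (hH : HasSimplicialVertices H) (h : IsTwoEnded H a b) {X : Finset V}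
    (hX : IsMiddle H a b X) : (∃ s, IsPairPart H a s X) ∨ ∃ s, IsPairPart H b s X := by
  obtain ⟨A, B, hA, hB, hd, hU, hn⟩ := hX.mem.1
  have haX := h.mem_middle_left hX
  wlog haA : a ∈ A generalizing A B
  · obtain ⟨hB', hA', hd', hU', hn'⟩ := InducesDisconnected.symm_parts hA hB hd hU hn
    refine this B A hB' hA' hd' hU' hn' ?_
    rw [← hU] at haX
    exact (Finset.mem_union.mp haX).resolve_left haA
  obtain ⟨hB', hA', hd', hU', hn'⟩ := InducesDisconnected.symm_parts hA hB hd hU hn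
  obtain ⟨y, hyB, hy⟩ := exists_simplicial_in_part hH hB hn'
    (by rw [hU']; exact h.isCliqueOn_compl_middle hH hX)
  have hbB : b ∈ B := by
    rcases h.eq_or_eq y hy with rfl | rfl
    · exact absurd hyB (Finset.disjoint_left.mp hd haA)
    · exact hyB
  have hc : A.card + B.card = 5 := by
    rw [← Finset.card_union_of_disjoint hd, hU, hX.mem.2]
  rcases Nat.lt_or_ge 2 A.card with h2 | h2
  · right
    exact h.symm.isPairPart_of_card_le hX.symm hbB (by omega) hd' hU' hn'
  · left
    exact h.isPairPart_of_card_le hX haA h2 hd hU hn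

/-- The vertex `s` determines `X` as its set of non-neighbours together with `a`. For `s ≠ s'`, the
set `X'` loses `s` and a further vertex `q` of `X` but can gain only `s'`, leaving at most four
elements. -/
theorem isPairPart_unique (hH : HasSimplicialVertices H) (h : IsTwoEnded H a b)
    {X X' : Finset V} {s s' : V} (hX : IsMiddle H a b X) (hX' : IsMiddle H a b X')
    (hs : IsPairPart H a s X) (hs' : IsPairPart H a s' X') : X = X' := by
  have haX := h.mem_middle_left hX
  have haX' := h.mem_middle_left hX'
  by_cases hss : s = s'
  · subst hss
    ext w
    have h1 := hs.adj_iff w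
    rw [hs'.adj_iff w] at h1
    by_cases hw : w = a
    · subst hw; simp [haX, haX']
    · simp only [hw, or_false] at h1; tauto
  · exfalso
    have hadj : H.Adj s s' :=
      h.simplicial_left.2 s (Finset.mem_univ _) s' (Finset.mem_univ _) hs.adj hs'.adj hss
    have hs'X : s' ∉ X := ((hs.adj_iff s').mp hadj).resolve_right hs'.adj.ne'
    have hsX' : s ∉ X' := ((hs'.adj_iff s).mp hadj.symm).resolve_right hs.adj.ne'
    -- Without such a neighbour, `s'` could be added to the part `{a, s}`, contrary to the
    -- maximality of `X`.
    have hq : ∃ q ∈ X, q ≠ a ∧ q ≠ s ∧ H.Adj s' q := by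
      by_contra hno
      push Not at hno
      apply h.not_disconnected_insert_middle hX hs'X
      have hcard : 2 < X.card := by rw [hX.mem.2]; norm_num
      obtain ⟨y, hyX, hy⟩ := Finset.exists_mem_notMem_of_card_lt_card
        (lt_of_le_of_lt (Finset.card_le_two (a := a) (b := s)) hcard)
      refine ⟨{a, s, s'}, X \ {a, s}, by simp, ⟨y, by simp only [Finset.mem_sdiff]; exact ⟨hyX, hy⟩⟩,
        ?_, ?_, ?_⟩
      · rw [Finset.disjoint_left]
        intro x hx hx'
        simp only [Finset.mem_insert, Finset.mem_singleton, Finset.mem_sdiff] at hx hx'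
        rcases hx with rfl | rfl | rfl
        · exact hx'.2 (Or.inl rfl)
        · exact hx'.2 (Or.inr rfl)
        · exact hs'X hx'.1
      · ext x
        simp only [Finset.mem_insert, Finset.mem_singleton, Finset.mem_sdiff, Finset.mem_union]
        have := hs.mem
        by_cases h1 : x = a
        · subst h1; simp [haX]
        · by_cases h2 : x = s
          · subst h2; simp [this]
          · simp [h1, h2]
      · intro x hx y hy
        simp only [Finset.mem_insert, Finset.mem_singleton, Finset.mem_sdiff, not_or] at hx hy
        rcases hx with rfl | rfl | rfl
        · exact hs.not_adj y hy.1 hy.2.2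
        · intro e
          exact ((hs.adj_iff y).mp e).elim (fun e => e hy.1) hy.2.1
        · exact hno y hy.1 hy.2.1 hy.2.2
    obtain ⟨q, hqX, hqa, hqs, hs'q⟩ := hq
    have hqX' : q ∉ X' := ((hs'.adj_iff q).mp hs'q).resolve_right hqa
    have hcl := h.isCliqueOn_compl_middle hH hX
    have hsub : X' ⊆ insert s' ((X.erase s).erase q) := by
      intro x hx
      rw [Finset.mem_insert, Finset.mem_erase, Finset.mem_erase]
      by_cases hxs' : x = s'
      · exact Or.inl hxs'
      · right
        refine ⟨fun e => hqX' (e ▸ hx), fun e => hsX' (e ▸ hx), ?_⟩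
        -- Both `x` and `s'` lie outside `X`, hence are adjacent, whereas the only neighbour of `s'`
        -- in `X'` is `a`.
        by_contra hxX
        have hadj' := hcl s' (by simp [hs'X]) x (by simp [hxX]) (Ne.symm hxs')
        exact ((hs'.adj_iff x).mp hadj').elim (fun e => e hx) (fun e => hxX (e ▸ haX))
    have h1 := Finset.card_le_card hsub
    have h2 := Finset.card_insert_le s' ((X.erase s).erase q)
    rw [Finset.card_erase_of_mem (by simp [hqX, hqs]), Finset.card_erase_of_mem hs.mem,
      hX.mem.2] at h2
    rw [hX'.mem.2] at h1
    omega

theorem isPairPart_notMem (h : IsTwoEnded H a b) {X : Finset V} {s : V} (hX : IsMiddle H a b X)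
    (hs : IsPairPart H a s X) : s ∈ nonNeighbors H b \ nonNeighbors H a := by
  have hbX := h.symm.mem_middle_left hX.symm
  rw [Finset.mem_sdiff, mem_nonNeighbors, mem_nonNeighbors, not_not]
  refine ⟨fun e => ?_, hs.adj⟩
  exact ((hs.adj_iff b).mp e.symm).elim (fun e => e hbX) h.ne.symm

/-- The first step of a linear quotient order from `W_a - x` towards `W_b - y`. -/
theorem exists_step (h : IsTwoEnded H a b)
    (h5 : HasLinearQuotientOrder (disconnectedSets H 5)) {x y : V}
    (hx : x ∈ nonNeighbors H a) (hxa : x ≠ a) (hy : y ∈ nonNeighbors H b) (hyb : y ≠ b)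
    (hxy : x = y ∨ x ∉ nonNeighbors H b ∧ y ∉ nonNeighbors H a ∧
      3 ≤ (nonNeighbors H b \ nonNeighbors H a).card) :
    ∃ C, IsMiddle H a b C ∧ x ∉ C ∧ y ∉ C ∧ (x = y → (C \ nonNeighbors H a).card = 1) := by
  have h1 := nonNeighbors_erase_mem h.mem_left hx hxa
  have h2 := nonNeighbors_erase_mem h.mem_right hy hyb
  have htwo := h.symm.two_le
  have hne : (nonNeighbors H a).erase x ≠ (nonNeighbors H b).erase y := by
    intro e
    obtain ⟨z, hz, hzy⟩ := Finset.exists_mem_ne (s := nonNeighbors H b \ nonNeighbors H a)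
      (by omega) y
    rw [Finset.mem_sdiff] at hz
    have : z ∈ (nonNeighbors H b).erase y := by simp only [Finset.mem_erase]; exact ⟨hzy, hz.1⟩
    rw [← e] at this
    exact hz.2 (Finset.mem_of_mem_erase this)
  obtain ⟨C, hC, u, hu, hCu⟩ := h5.first_step (fun A hA => hA.2) h1 h2 hne
  have huC : u ∈ C \ (nonNeighbors H a).erase x := by simp [hCu]
  rw [Finset.mem_sdiff, Finset.mem_erase] at huC
  rw [Finset.mem_erase] at hu
  have hmem : ∀ z ∈ C, z ∉ (nonNeighbors H a).erase x → z = u := by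
    intro z hz hz'
    have : z ∈ C \ (nonNeighbors H a).erase x := Finset.mem_sdiff.mpr ⟨hz, hz'⟩
    rwa [hCu, Finset.mem_singleton] at this
  have hux : u ≠ x := by
    rcases hxy with rfl | ⟨hxb, -, -⟩
    · exact hu.1
    · exact fun e => hxb (e ▸ hu.2)
  have hua : u ∉ nonNeighbors H a := fun e => huC.2 ⟨hux, e⟩
  have hxC : x ∉ C := fun e => hux (hmem x e (by simp)).symm
  have hyC : y ∉ C := by
    rcases hxy with rfl | ⟨-, hya, -⟩
    · exact hxC
    · exact fun e => hu.1 (hmem y e (fun e' => hya (Finset.mem_of_mem_erase e'))).symm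
  refine ⟨C, ⟨hC, fun e => hua (e huC.1), fun e => ?_⟩, hxC, hyC, fun exy => ?_⟩
  -- If `C` were contained in `W_b`, it would be all of `W_b - y`. Then `W_b \ W_a` without `y`
  -- would have at most one element, against the cardinality bound of either case.
  · have hCe : C = (nonNeighbors H b).erase y := by
      apply Finset.eq_of_subset_of_card_le
      · intro z hz
        rw [Finset.mem_erase]
        exact ⟨fun e' => hyC (e' ▸ hz), e hz⟩
      · rw [h2.2, hC.2]
    have hsub : (nonNeighbors H b \ nonNeighbors H a).erase y ⊆ {u} := by
      intro z hz
      rw [Finset.mem_erase, Finset.mem_sdiff] at hz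
      rw [Finset.mem_singleton]
      refine hmem z ?_ fun e' => hz.2.2 (Finset.mem_of_mem_erase e')
      rw [hCe, Finset.mem_erase]
      exact ⟨hz.1, hz.2.1⟩
    have hcs := Finset.card_le_card hsub
    rw [Finset.card_singleton] at hcs
    rcases hxy with rfl | ⟨-, hya, h3⟩
    · rw [Finset.erase_eq_of_notMem (by simp only [Finset.mem_sdiff, not_and, not_not]; exact fun _ => hx)] at hcs
      omega
    · have := Finset.pred_card_le_card_erase (s := nonNeighbors H b \ nonNeighbors H a) (a := y)
      omega
  · have : C \ nonNeighbors H a = {u} := by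
      ext z
      rw [Finset.mem_sdiff, Finset.mem_singleton]
      constructor
      · rintro ⟨hz, hz'⟩
        exact hmem z hz fun e' => hz' (Finset.mem_of_mem_erase e')
      · rintro rfl; exact ⟨huC.1, hua⟩
    rw [this, Finset.card_singleton]

/-- With three or more elements in the difference, `y` can be chosen in every middle set with a pair
at `a`, and `x` in every one with a pair at `b`, by uniqueness at each end. The step from `W_a - x`
towards `W_b - y` gives a middle set avoiding both, which is impossible. -/
theorem card_sdiff_eq_two (hH : HasSimplicialVertices H) (h : IsTwoEnded H a b)
    (h5 : HasLinearQuotientOrder (disconnectedSets H 5)) :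
    (nonNeighbors H b \ nonNeighbors H a).card = 2 := by
  by_contra hne
  have h2 := h.symm.two_le
  have h3 : 3 ≤ (nonNeighbors H b \ nonNeighbors H a).card := by omega
  have hy : ∃ y ∈ nonNeighbors H b \ nonNeighbors H a,
      ∀ X, IsMiddle H a b X → (∃ s, IsPairPart H a s X) → y ∈ X := by
    by_cases hex : ∃ X, IsMiddle H a b X ∧ ∃ s, IsPairPart H a s X
    · obtain ⟨X, hX, s, hs⟩ := hex
      refine ⟨s, h.isPairPart_notMem hX hs, fun X' hX' ⟨s', hs'⟩ => ?_⟩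
      rw [← h.isPairPart_unique hH hX hX' hs hs']
      exact hs.mem
    · obtain ⟨y, hy⟩ := Finset.card_pos.mp (show 0 < (nonNeighbors H b \ nonNeighbors H a).card by omega)
      exact ⟨y, hy, fun X hX hs => absurd ⟨X, hX, hs⟩ hex⟩
  have hx : ∃ x ∈ nonNeighbors H a \ nonNeighbors H b,
      ∀ X, IsMiddle H a b X → (∃ s, IsPairPart H b s X) → x ∈ X := by
    by_cases hex : ∃ X, IsMiddle H a b X ∧ ∃ s, IsPairPart H b s X
    · obtain ⟨X, hX, s, hs⟩ := hex
      refine ⟨s, h.symm.isPairPart_notMem hX.symm hs, fun X' hX' ⟨s', hs'⟩ => ?_⟩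
      rw [← h.symm.isPairPart_unique hH hX.symm hX'.symm hs hs']
      exact hs.mem
    · have := h.two_le
      obtain ⟨y, hy⟩ := Finset.card_pos.mp (show 0 < (nonNeighbors H a \ nonNeighbors H b).card by omega)
      exact ⟨y, hy, fun X hX hs => absurd ⟨X, hX, hs⟩ hex⟩
  obtain ⟨y, hy, hyX⟩ := hy
  obtain ⟨x, hx, hxX⟩ := hx
  rw [Finset.mem_sdiff] at hx hy
  obtain ⟨C, hC, hxC, hyC, -⟩ := h.exists_step h5 hx.1
    (fun e => hx.2 (e ▸ h.left_mem_right)) hy.1 (fun e => hy.2 (e ▸ h.symm.left_mem_right))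
    (Or.inr ⟨hx.2, hy.2, h3⟩)
  rcases h.exists_isPairPart hH hC with hs | hs
  · exact hyC (hyX C hC hs)
  · exact hxC (hxX C hC hs)

end IsTwoEnded

end Combinatorics

section Combinatorics

set_option linter.unusedSectionVars false

/-! ### Transfer to graphs on eight vertices -/

section Transfer

variable {V W : Type*} [DecidableEq V] [DecidableEq W] {H : SimpleGraph V} {K : SimpleGraph W}

theorem InducesDisconnected.map_iff (φ : W ↪ V) (hφ : ∀ i j, H.Adj (φ i) (φ j) ↔ K.Adj i j)
    (U : Finset W) : InducesDisconnected H (U.map φ) ↔ InducesDisconnected K U := by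
  constructor
  · rintro ⟨A, B, ⟨a, ha⟩, ⟨b, hb⟩, hd, hU, hn⟩
    obtain ⟨A, rfl⟩ : ∃ A' : Finset W, A = A'.map φ := by
      obtain ⟨A', -, h⟩ := Finset.subset_map_iff.mp (hU ▸ Finset.subset_union_left : A ⊆ U.map φ)
      exact ⟨A', h⟩
    obtain ⟨B, rfl⟩ : ∃ B' : Finset W, B = B'.map φ := by
      obtain ⟨B', -, h⟩ := Finset.subset_map_iff.mp (hU ▸ Finset.subset_union_right : B ⊆ U.map φ)
      exact ⟨B', h⟩
    rw [Finset.mem_map] at ha hb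
    obtain ⟨a, ha, rfl⟩ := ha
    obtain ⟨b, hb, rfl⟩ := hb
    refine ⟨A, B, ⟨a, ha⟩, ⟨b, hb⟩, (Finset.disjoint_map φ).mp hd, ?_, fun x hx y hy hxy => ?_⟩
    · rw [← Finset.map_union] at hU
      exact Finset.map_injective φ hU
    · exact hn _ (Finset.mem_map_of_mem φ hx) _ (Finset.mem_map_of_mem φ hy) ((hφ x y).mpr hxy)
  · rintro ⟨A, B, hA, hB, hd, rfl, hn⟩
    refine ⟨A.map φ, B.map φ, hA.map, hB.map, (Finset.disjoint_map φ).mpr hd,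
      (Finset.map_union ..).symm, ?_⟩
    intro x hx y hy
    rw [Finset.mem_map] at hx hy
    obtain ⟨x, hx, rfl⟩ := hx
    obtain ⟨y, hy, rfl⟩ := hy
    rw [hφ]
    exact hn x hx y hy

/-- A vertex adjacent to all others cannot belong to a disconnected set. -/
theorem InducesDisconnected.exists_map (φ : W ↪ V)
    (hu : ∀ w, w ∉ Set.range φ → ∀ v, v ≠ w → H.Adj w v) {X : Finset V}
    (hX : InducesDisconnected H X) : ∃ U : Finset W, X = U.map φ := by
  have hsub : ∀ x ∈ X, x ∈ Set.range φ := by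
    intro x hx
    by_contra hxr
    obtain ⟨A, B, ⟨a, ha⟩, ⟨b, hb⟩, hd, rfl, hn⟩ := hX
    rcases Finset.mem_union.mp hx with h | h
    · exact hn x h b hb (hu x hxr b fun e => Finset.disjoint_left.mp hd h (e ▸ hb))
    · exact hn a ha x h (hu x hxr a fun e => Finset.disjoint_left.mp hd ha (e ▸ h)).symm
  refine ⟨X.preimage φ φ.injective.injOn, ?_⟩
  ext x
  simp only [Finset.mem_map, Finset.mem_preimage]
  constructor
  · intro hx
    obtain ⟨w, rfl⟩ := hsub x hx
    exact ⟨w, hx, rfl⟩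
  · rintro ⟨w, hw, rfl⟩; exact hw

theorem disconnectedSets_eq_image (φ : W ↪ V) (hφ : ∀ i j, H.Adj (φ i) (φ j) ↔ K.Adj i j)
    (hu : ∀ w, w ∉ Set.range φ → ∀ v, v ≠ w → H.Adj w v) (m : ℕ) :
    disconnectedSets H m = (fun U : Finset W => U.map φ) '' disconnectedSets K m := by
  ext X
  constructor
  · rintro ⟨hX, hm⟩
    obtain ⟨U, rfl⟩ := hX.exists_map φ hu
    exact ⟨U, ⟨(InducesDisconnected.map_iff φ hφ U).mp hX, by rw [← hm, Finset.card_map]⟩, rfl⟩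
  · rintro ⟨U, ⟨hU, hm⟩, rfl⟩
    exact ⟨(InducesDisconnected.map_iff φ hφ U).mpr hU, by rw [← hm, Finset.card_map]⟩

theorem map_sdiff_eq_singleton_iff (φ : W ↪ V) (A C : Finset W) (u : W) :
    C.map φ \ A.map φ = {φ u} ↔ C \ A = {u} := by
  rw [← Finset.map_sdiff, ← Finset.map_singleton, Finset.map_inj]

theorem hasLinearQuotientOrder_image_iff (φ : W ↪ V) (F : Set (Finset W)) :
    HasLinearQuotientOrder ((fun U : Finset W => U.map φ) '' F) ↔ HasLinearQuotientOrder F := by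
  constructor
  · rintro ⟨r, hinj, hr⟩
    refine ⟨fun U => r (U.map φ), fun A hA B hB h => ?_, fun A hA B hB hlt => ?_⟩
    · exact Finset.map_injective φ (hinj ⟨A, hA, rfl⟩ ⟨B, hB, rfl⟩ h)
    · obtain ⟨_, ⟨C, hC, rfl⟩, hCA, u, hu, hCu⟩ := hr _ ⟨A, hA, rfl⟩ _ ⟨B, hB, rfl⟩ hlt
      obtain ⟨w, hw, rfl⟩ := Finset.mem_map.mp hu
      exact ⟨C, hC, hCA, w, hw, (map_sdiff_eq_singleton_iff φ A C w).mp hCu⟩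
  · rintro ⟨r, hinj, hr⟩
    have hpre : ∀ U : Finset W, (U.map φ).preimage φ φ.injective.injOn = U := fun U => by
      ext; simp
    refine ⟨fun X => r (X.preimage φ φ.injective.injOn), ?_, ?_⟩
    · rintro _ ⟨A, hA, rfl⟩ _ ⟨B, hB, rfl⟩ h
      simp only [hpre] at h
      simp only [hinj hA hB h]
    · rintro _ ⟨A, hA, rfl⟩ _ ⟨B, hB, rfl⟩ h
      simp only [hpre] at h
      obtain ⟨C, hC, hCA, u, hu, hCu⟩ := hr A hA B hB h
      exact ⟨C.map φ, ⟨C, hC, rfl⟩, by simpa only [hpre] using hCA, φ u,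
        Finset.mem_map_of_mem φ hu, (map_sdiff_eq_singleton_iff φ A C u).mpr hCu⟩

end Transfer

/-! ### Finite verification for the two graphs on eight vertices. -/

theorem inducesDisconnected_iff_exists_subset {V : Type*} [DecidableEq V] {H : SimpleGraph V}
    (U : Finset V) : InducesDisconnected H U ↔
      ∃ A ∈ U.powerset, A.Nonempty ∧ (U \ A).Nonempty ∧ ∀ x ∈ A, ∀ y ∈ U \ A, ¬ H.Adj x y := by
  constructor
  · rintro ⟨A, B, hA, hB, hd, rfl, hn⟩
    have : (A ∪ B) \ A = B := Finset.union_sdiff_cancel_left hd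
    exact ⟨A, Finset.mem_powerset.mpr Finset.subset_union_left, hA, by rwa [this], by rwa [this]⟩
  · rintro ⟨A, hAU, hA, hB, hn⟩
    exact ⟨A, U \ A, hA, hB, Finset.disjoint_sdiff,
      Finset.union_sdiff_of_subset (Finset.mem_powerset.mp hAU), hn⟩

/-- A test for `InducesDisconnected` on the set of entries of a list. -/
def listDisconnected {V : Type*} [DecidableEq V] (H : SimpleGraph V) [DecidableRel H.Adj]
    (U : List V) : Bool :=
  U.sublists.any fun A => !A.isEmpty && (U.any fun y => !A.contains y) &&
    A.all fun x => U.all fun y => A.contains y || !decide (H.Adj x y)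

theorem listDisconnected_iff {V : Type*} [DecidableEq V] (H : SimpleGraph V) [DecidableRel H.Adj]
    (U : List V) : listDisconnected H U = true ↔ InducesDisconnected H U.toFinset := by
  rw [inducesDisconnected_iff_exists_subset]
  simp only [listDisconnected, List.any_eq_true, List.mem_sublists, Bool.and_eq_true,
    Bool.not_eq_true', List.isEmpty_eq_false_iff, List.all_eq_true, Bool.or_eq_true,
    decide_eq_false_iff_not, Finset.mem_powerset, List.contains_eq_mem]
  constructor
  · rintro ⟨A, hA, ⟨hne, y, hy, hyA⟩, h⟩
    refine ⟨A.toFinset, fun x hx => ?_, ?_, ⟨y, ?_⟩, fun x hx z hz => ?_⟩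
    · exact List.mem_toFinset.mpr (hA.subset (List.mem_toFinset.mp hx))
    · obtain ⟨x, hx⟩ := List.exists_mem_of_ne_nil A hne
      exact ⟨x, List.mem_toFinset.mpr hx⟩
    · simp [hy, hyA]
    · simp only [Finset.mem_sdiff, List.mem_toFinset] at hx hz
      exact (h x hx z hz.1).resolve_left (by simpa using hz.2)
  · rintro ⟨A, hA, ⟨a, ha⟩, ⟨y, hy⟩, h⟩
    rw [Finset.mem_sdiff, List.mem_toFinset] at hy
    refine ⟨U.filter (· ∈ A), List.filter_sublist, ⟨?_, y, hy.1, ?_⟩, fun x hx z hz => ?_⟩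
    · refine List.ne_nil_of_mem (a := a) ?_
      simpa [ha] using List.mem_toFinset.mp (hA ha)
    · simp [hy.2]
    · simp only [List.mem_filter, decide_eq_true_eq] at hx
      by_cases hzA : z ∈ A
      · left; simp [hz, hzA]
      · right; exact h x hx.2 z (by simp [hz, hzA])

/-- The graph on `Fin 8` in which `i` and `j` are adjacent if one of them is listed at the
other. -/
def graphOfLists (L : Fin 8 → List (Fin 8)) : SimpleGraph (Fin 8) :=
  SimpleGraph.fromRel fun i j => j ∈ L i

instance (L : Fin 8 → List (Fin 8)) : DecidableRel (graphOfLists L).Adj := fun i j =>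
  inferInstanceAs (Decidable (i ≠ j ∧ (j ∈ L i ∨ i ∈ L j)))

/-- The chain of cliques `{0,2,4}, {2,4,5,7}, {4,5,6,7}, {3,4,5,6}, {1,3,5}`. -/
def chainGraph : SimpleGraph (Fin 8) :=
  graphOfLists ![[2, 4], [3, 5], [4, 5, 7], [4, 5, 6], [5, 6, 7], [6, 7], [7], []]

/-- The chain of cliques `{0,2,4}, {2,4,6,7}, {4,5,6,7}, {3,5,6,7}, {1,3,5}`. -/
def wideChainGraph : SimpleGraph (Fin 8) :=
  graphOfLists ![[2, 4], [3, 5], [4, 6, 7], [5, 6, 7], [5, 6, 7], [6, 7], [7], []]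

instance : DecidableRel chainGraph.Adj := inferInstanceAs (DecidableRel (graphOfLists _).Adj)

instance : DecidableRel wideChainGraph.Adj := inferInstanceAs (DecidableRel (graphOfLists _).Adj)

theorem exists_mem_sublistsLen (m : ℕ) (U : Finset (Fin 8)) (hU : U.card = m) :
    ∃ l ∈ (List.finRange 8).sublistsLen m, U = l.toFinset := by
  have hset : U = ((List.finRange 8).filter (· ∈ U)).toFinset := by ext; simp
  refine ⟨(List.finRange 8).filter (· ∈ U), ?_, hset⟩
  rw [List.mem_sublistsLen]
  refine ⟨List.filter_sublist, ?_⟩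
  rw [← hU]
  conv_rhs => rw [hset]
  exact (List.toFinset_card_of_nodup ((List.nodup_finRange 8).filter _)).symm

theorem disconnectedSets_eq_of_lists (K : SimpleGraph (Fin 8)) [DecidableRel K.Adj] (m : ℕ)
    (L : List (List (Fin 8)))
    (h1 : ∀ l ∈ (List.finRange 8).sublistsLen m, listDisconnected K l = true → l ∈ L)
    (h2 : ∀ l ∈ L, listDisconnected K l = true ∧ l.Nodup ∧ l.length = m) :
    disconnectedSets K m = {U | ∃ l ∈ L, U = l.toFinset} := by
  ext U
  constructor
  · rintro ⟨hU, hm⟩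
    obtain ⟨l, hl, rfl⟩ := exists_mem_sublistsLen m U hm
    exact ⟨l, h1 l hl ((listDisconnected_iff K l).mpr hU), rfl⟩
  · rintro ⟨l, hl, rfl⟩
    obtain ⟨a, b, c⟩ := h2 l hl
    exact ⟨(listDisconnected_iff K l).mp a, by rw [List.toFinset_card_of_nodup b, c]⟩

theorem toFinset_sdiff_eq_singleton {A C : List (Fin 8)} {u : Fin 8}
    (h : C.filter (fun x => !A.contains x) = [u]) : C.toFinset \ A.toFinset = {u} := by
  ext x
  have : x ∈ C.filter (fun x => !A.contains x) ↔ x ∈ [u] := by rw [h]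
  simpa using this

theorem filter_eq_singleton {A C : List (Fin 8)} {u : Fin 8} (hC : C.Nodup)
    (h : C.toFinset \ A.toFinset = {u}) : C.filter (fun x => !A.contains x) = [u] := by
  have hset : (C.filter (fun x => !A.contains x)).toFinset = {u} := by
    rw [← h]; ext x; simp
  have hcard := List.toFinset_card_of_nodup (hC.filter fun x => !A.contains x)
  rw [hset, Finset.card_singleton] at hcard
  obtain ⟨v, hv⟩ := List.length_eq_one_iff.mp hcard.symm
  rw [hv] at hset ⊢
  simpa using hset

/-- A list of sets in which every earlier set can be exchanged gives a linear quotient order. -/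
theorem hasLinearQuotientOrder_of_list (L : List (List (Fin 8)))
    (h : ∀ i j : Fin L.length, j < i → ∃ k : Fin L.length, k < i ∧ ∃ u ∈ L[j],
      L[k].filter (fun x => !L[i].contains x) = [u]) :
    HasLinearQuotientOrder {U | ∃ l ∈ L, U = l.toFinset} := by
  set M := L.map List.toFinset with hM
  have hset : {U | ∃ l ∈ L, U = l.toFinset} = {U | U ∈ M} := by
    ext U; simp [hM, eq_comm]
  rw [hset]
  have hlen : M.length = L.length := by simp [hM]
  have hidx : ∀ U ∈ M, ∃ i : Fin L.length, M.idxOf U = i ∧ U = L[i].toFinset := by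
    intro U hU
    have hlt := List.idxOf_lt_length_of_mem hU
    refine ⟨⟨M.idxOf U, hlen ▸ hlt⟩, rfl, ?_⟩
    have h2 : M[M.idxOf U] = U := List.getElem_idxOf hlt
    exact h2.symm.trans (List.getElem_map ..)
  refine ⟨M.idxOf, fun A hA B hB e => (List.idxOf_inj hA).mp e, fun A hA B hB hlt => ?_⟩
  obtain ⟨i, hi, rfl⟩ := hidx A hA
  obtain ⟨j, hj, rfl⟩ := hidx B hB
  simp only [hi, hj] at hlt
  obtain ⟨k, hk, u, hu, hku⟩ := h i j (by simpa using hlt)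
  refine ⟨L[k].toFinset, List.mem_map_of_mem (List.getElem_mem _), ?_, u, List.mem_toFinset.mpr hu,
    toFinset_sdiff_eq_singleton hku⟩
  simp only [hi]
  have hk' : (k : ℕ) < M.length := by omega
  have : M[(k : ℕ)] = L[k].toFinset := by simp [hM]
  rw [← this]
  -- The ranks are positions of first occurrence; repetitions could only move that position before
  -- `k`.
  refine lt_of_le_of_lt ?_ (show (k : ℕ) < i from hk)
  by_contra hcon
  push Not at hcon
  have hfalse := List.not_of_lt_findIdx hcon
  simp at hfalse

/-- The disconnected 4-sets in lexicographic order, which is already an order with linear quotients.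
-/
def chainList : List (List (Fin 8)) :=
  [[0, 1, 2, 3], [0, 1, 2, 4], [0, 1, 2, 6], [0, 1, 2, 7], [0, 1, 3, 5], [0, 1, 3, 6],
   [0, 1, 3, 7], [0, 1, 4, 6], [0, 1, 4, 7], [0, 1, 5, 6], [0, 1, 5, 7], [0, 1, 6, 7],
   [0, 2, 3, 6], [0, 2, 3, 7], [0, 3, 5, 6], [0, 3, 5, 7], [0, 3, 6, 7], [0, 5, 6, 7],
   [1, 2, 3, 6], [1, 2, 3, 7], [1, 2, 4, 6], [1, 2, 4, 7], [1, 2, 6, 7], [1, 4, 6, 7]]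

theorem disconnectedSets_chain :
    disconnectedSets chainGraph 4 = {U | ∃ l ∈ chainList, U = l.toFinset} :=
  disconnectedSets_eq_of_lists _ _ _ (by decide +kernel) (by decide +kernel)

theorem hasLinearQuotientOrder_chain :
    HasLinearQuotientOrder (disconnectedSets chainGraph 4) := by
  rw [disconnectedSets_chain]
  exact hasLinearQuotientOrder_of_list _ (by decide +kernel)

/-- Positions 0–4 are `W_a` without 3, 5, 6, 7, 1 respectively, where `W_a = {0, 1, 3, 5, 6, 7}`.
Positions 5–9 are `W_b` without 2, 4, 6, 7, 0, where `W_b = {0, 1, 2, 4, 6, 7}`. Positions 10 and 11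
are the middle sets. The later order arguments refer to these positions. -/
def wideChainList : List (List (Fin 8)) :=
  [[0, 1, 5, 6, 7], [0, 1, 3, 6, 7], [0, 1, 3, 5, 7], [0, 1, 3, 5, 6], [0, 3, 5, 6, 7],
   [0, 1, 4, 6, 7], [0, 1, 2, 6, 7], [0, 1, 2, 4, 7], [0, 1, 2, 4, 6], [1, 2, 4, 6, 7],
   [0, 1, 2, 3, 5], [0, 1, 2, 3, 4]]

theorem disconnectedSets_wideChain :
    disconnectedSets wideChainGraph 5 = {U | ∃ l ∈ wideChainList, U = l.toFinset} :=
  disconnectedSets_eq_of_lists _ _ _ (by decide +kernel) (by decide +kernel)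

/-- In an order of the sets of `wideChainList` with linear quotients, if `t` is placed after `m`
and before `d`, the remaining comparisons lead to a contradiction. -/
theorem wide_order_middle {s s' t t' c d m : ℕ}
    (h1 : s < t → d < t) (h2 : c < t → d < t) (h3 : t < s → c < s)
    (h4 : t < c → s < c ∨ d < c) (h5 : m < c → m < s → s < c ∨ s' < c)
    (h6 : s' < d → t' < d ∨ c < d) (h7 : s' < t' → d < t') (h8 : t' < s' → c < s')
    (h9 : d < s' → c < s') (hmt : m < t) (e1 : s ≠ t) (e2 : c ≠ t) (e3 : s' ≠ t') (e4 : d ≠ s')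
    (htd : t < d) : False := by
  have a1 : t < s := by omega
  have a2 : t < c := by omega
  have a3 : d < c := by have := h3 a1; have := h4 a2; omega
  have a4 : s' < c := by have := h5 (by omega) (by omega); have := h3 a1; omega
  rcases lt_or_gt_of_ne e4 with hd | hd
  · have := h9 hd; omega
  · have b1 : t' < d := by have := h6 hd; omega
    rcases lt_or_gt_of_ne e3 with h | h
    · have := h7 h; omega
    · have := h8 h; omega

/-- A middle set cannot precede the first subset of the second `6`-set when that subset is a
neighbour of the first `6`-set; the index `f` stands for that subset. -/
theorem wide_order_cross {f o x1 x7 x8 x9 d : ℕ}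
    (c1 : d < f → x1 < f ∨ o < f ∨ x7 < f ∨ x8 < f ∨ x9 < f)
    (c2 : d < x1 → f < x1 ∨ o < x1) (c3 : x1 < d → x7 < d ∨ x8 < d)
    (c4 : f < d → x7 < d ∨ x8 < d) (ho : f < o) (h7 : f < x7) (h8 : f < x8) (h9 : f < x9)
    (e1 : x1 ≠ d) (e2 : f ≠ d) : x7 < d ∨ x8 < d := by
  rcases lt_or_gt_of_ne e2 with h | h
  · exact c4 h
  · have a1 : x1 < f := by have := c1 h; omega
    rcases lt_or_gt_of_ne e1 with h' | h'
    · exact c3 h'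
    · have := c2 h'; omega

/-- The assumptions force `d` before `x7`, then `x7` before `x0` and `d` before `x1`. Now each of
`x0`, `x1` comes after one of `x5`, `x6`, and each of these comes after one of `x0`, `x1`, so none
of the four can be earliest. -/
theorem wide_order_side {x0 x1 x5 x6 x7 x8 x9 d m : ℕ}
    (cA : x5 < x7 ∨ x6 < x7 ∨ x8 < x7 ∨ x9 < x7 ∨ d < x7)
    (c70 : x0 < x7 → x5 < x7 ∨ x6 < x7 ∨ x8 < x7 ∨ x9 < x7)
    (c1d : d < x1 → x5 < x1 ∨ x6 < x1) (cd1 : x1 < d → x7 < d ∨ x8 < d)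
    (c07 : x7 < x0 → x5 < x0 ∨ x6 < x0) (cB5 : m < x5 → x0 < x5 ∨ x1 < x5)
    (cB6 : m < x6 → x0 < x6 ∨ x1 < x6) (h5 : x7 < x5) (h6 : x7 < x6) (h8 : x7 < x8)
    (h9 : x7 < x9) (hm : m < x7) (e1 : x0 ≠ x7) (e2 : x1 ≠ d) : False := by
  have a1 : d < x7 := by omega
  have a2 : x7 < x0 := by
    by_contra h
    have := c70 (by omega)
    omega
  have a3 : d < x1 := by
    by_contra h
    have := cd1 (by omega)
    omega
  have a4 := c1d a3
  have a5 := c07 a2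
  have a6 := cB5 (by omega)
  have a7 := cB6 (by omega)
  omega

/-- The positions of the sets of `wideChainList` that may serve as exchange partners of the `i`-th
set towards the `j`-th. -/
def wideCandidates (i j : Fin 12) : List (Fin 12) :=
  (List.finRange 12).filter fun k =>
    ∃ u ∈ wideChainList.getD j [],
      (wideChainList.getD k []).filter (fun x => !(wideChainList.getD i []).contains x) = [u]

/-- No subset of the first `6`-set can precede all subsets of the second one. -/
theorem wide_order_first (x : Fin 12 → ℕ) (hinj : Function.Injective x)
    (hx : ∀ i j, x j < x i → ∃ k ∈ wideCandidates i j, x k < x i) (j : Fin 12) (hj : j < 5)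
    (h5 : x j < x 5) (h6 : x j < x 6) (h7 : x j < x 7) (h8 : x j < x 8) (h9 : x j < x 9) :
    False := by
  have ne : ∀ i k : Fin 12, i ≠ k → x i ≠ x k := fun i k h e => h (hinj e)
  -- The kernel computes each list of exchange partners, turning the exchange conditions into
  -- disjunctions of inequalities between ranks.
  have step : ∀ i j : Fin 12, ∀ L : List (Fin 12), wideCandidates i j = L → x j < x i →
      ∃ k ∈ L, x k < x i := fun i j L h => h ▸ hx i j
  have c0_7 := step 0 7 [5, 6] (by decide +kernel)
  have c0_8 := step 0 8 [5, 6] (by decide +kernel)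
  have c1_11 := step 1 11 [5, 6] (by decide +kernel)
  have c11_1 := step 11 1 [7, 8] (by decide +kernel)
  have c7_0 := step 7 0 [5, 6, 8, 9] (by decide +kernel)
  have c8_0 := step 8 0 [5, 6, 7, 9] (by decide +kernel)
  have c5_2 := step 5 2 [0, 1] (by decide +kernel)
  have c5_3 := step 5 3 [0, 1] (by decide +kernel)
  have c5_4 := step 5 4 [0, 1] (by decide +kernel)
  have c6_2 := step 6 2 [0, 1] (by decide +kernel)
  have c6_3 := step 6 3 [0, 1] (by decide +kernel)
  have c6_4 := step 6 4 [0, 1] (by decide +kernel)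
  have c5_11 := step 5 11 [1, 6, 7, 8, 9] (by decide +kernel)
  have c6_11 := step 6 11 [1, 5, 7, 8, 9] (by decide +kernel)
  have c11_5 := step 11 5 [7, 8] (by decide +kernel)
  have c11_6 := step 11 6 [7, 8] (by decide +kernel)
  have c7_2 := step 7 2 [11] (by decide +kernel)
  have c8_3 := step 8 3 [11] (by decide +kernel)
  have c7_10 := step 7 10 [11] (by decide +kernel)
  have c8_10 := step 8 10 [11] (by decide +kernel)
  have c2_7 := step 2 7 [10] (by decide +kernel)
  have c3_8 := step 3 8 [10] (by decide +kernel)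
  have c10_7 := step 10 7 [2, 11] (by decide +kernel)
  have c10_8 := step 10 8 [3, 11] (by decide +kernel)
  have c11_3 := step 11 3 [8, 10] (by decide +kernel)
  have c11_2 := step 11 2 [7, 10] (by decide +kernel)
  have c3_11 := step 3 11 [10] (by decide +kernel)
  have c2_11 := step 2 11 [10] (by decide +kernel)
  have c10_0 := step 10 0 [2, 3] (by decide +kernel)
  have c10_1 := step 10 1 [2, 3] (by decide +kernel)
  have c10_2 := step 10 2 [2] (by decide +kernel)
  have c10_3 := step 10 3 [3] (by decide +kernel)
  have c10_4 := step 10 4 [2, 3] (by decide +kernel)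
  have c9_0 := step 9 0 [5, 6, 7, 8] (by decide +kernel)
  have c9_1 := step 9 1 [5, 6, 7, 8] (by decide +kernel)
  have c9_2 := step 9 2 [5, 6, 7, 8] (by decide +kernel)
  have c9_3 := step 9 3 [5, 6, 7, 8] (by decide +kernel)
  have c9_4 := step 9 4 [5, 6, 7, 8] (by decide +kernel)
  have c7_1 := step 7 1 [5, 6, 8, 9, 11] (by decide +kernel)
  have c7_3 := step 7 3 [5, 6, 8, 9, 11] (by decide +kernel)
  have c7_4 := step 7 4 [5, 6, 8, 9, 11] (by decide +kernel)
  have c8_1 := step 8 1 [5, 6, 7, 9, 11] (by decide +kernel)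
  have c8_2 := step 8 2 [5, 6, 7, 9, 11] (by decide +kernel)
  have c8_4 := step 8 4 [5, 6, 7, 9, 11] (by decide +kernel)
  simp only [List.mem_cons, List.not_mem_nil, or_false, exists_eq_or_imp, exists_eq_left] at c0_7 c0_8 c1_11 c11_1 c7_0 c8_0 c5_2 c5_3 c5_4 c6_2 c6_3 c6_4 c5_11 c6_11 c11_5 c11_6 c7_2 c8_3 c7_10 c8_10 c2_7 c3_8 c10_7 c10_8 c11_3 c11_2 c3_11 c2_11 c10_0 c10_1 c10_2 c10_3 c10_4 c9_0 c9_1 c9_2 c9_3 c9_4 c7_1 c7_3 c7_4 c8_1 c8_2 c8_4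
  have hj' : j = 0 ∨ j = 1 ∨ j = 2 ∨ j = 3 ∨ j = 4 := by omega
  have cD : x j < x 10 → x 2 < x 10 ∨ x 3 < x 10 := by
    intro h
    rcases hj' with rfl | rfl | rfl | rfl | rfl
    · exact c10_0 h
    · exact c10_1 h
    · exact Or.inl h
    · exact Or.inr h
    · exact c10_4 h
  have cA7 : x 5 < x 7 ∨ x 6 < x 7 ∨ x 8 < x 7 ∨ x 9 < x 7 ∨ x 11 < x 7 := by
    rcases hj' with rfl | rfl | rfl | rfl | rfl
    · rcases c7_0 h7 with h | h | h | h <;> simp [h]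
    · rcases c7_1 h7 with h | h | h | h | h <;> simp [h]
    · simp [c7_2 h7]
    · rcases c7_3 h7 with h | h | h | h | h <;> simp [h]
    · rcases c7_4 h7 with h | h | h | h | h <;> simp [h]
  have cA8 : x 5 < x 8 ∨ x 6 < x 8 ∨ x 7 < x 8 ∨ x 9 < x 8 ∨ x 11 < x 8 := by
    rcases hj' with rfl | rfl | rfl | rfl | rfl
    · rcases c8_0 h8 with h | h | h | h <;> simp [h]
    · rcases c8_1 h8 with h | h | h | h | h <;> simp [h]
    · rcases c8_2 h8 with h | h | h | h | h <;> simp [h]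
    · simp [c8_3 h8]
    · rcases c8_4 h8 with h | h | h | h | h <;> simp [h]
  have cA9 : x 5 < x 9 ∨ x 6 < x 9 ∨ x 7 < x 9 ∨ x 8 < x 9 := by
    rcases hj' with rfl | rfl | rfl | rfl | rfl
    · exact c9_0 h9
    · exact c9_1 h9
    · exact c9_2 h9
    · exact c9_3 h9
    · exact c9_4 h9
  have cB5 : x j < x 5 → x 0 < x 5 ∨ x 1 < x 5 := by
    intro h
    rcases hj' with rfl | rfl | rfl | rfl | rfl
    · exact Or.inl h
    · exact Or.inr h
    · exact c5_2 h
    · exact c5_3 h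
    · exact c5_4 h
  have cB6 : x j < x 6 → x 0 < x 6 ∨ x 1 < x 6 := by
    intro h
    rcases hj' with rfl | rfl | rfl | rfl | rfl
    · exact Or.inl h
    · exact Or.inr h
    · exact c6_2 h
    · exact c6_3 h
    · exact c6_4 h
  -- The middle set at position 11 cannot follow position 7 or 8, the subsets of `W_b` omitting the
  -- common vertices 6 and 7.
  have middle : x 7 < x 11 ∨ x 8 < x 11 → False := by
    rintro (h | h)
    · exact wide_order_middle c7_2 c7_10 c2_7 c10_7 (fun a _ => cD a) c11_3 c8_3 c3_8 c3_11
        h7 (ne 2 7 (by decide)) (ne 10 7 (by decide)) (ne 3 8 (by decide)) (ne 11 3 (by decide)) h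
    · exact wide_order_middle c8_3 c8_10 c3_8 c10_8 (fun a _ => (cD a).symm) c11_2 c7_2 c2_7 c2_11
        h8 (ne 3 8 (by decide)) (ne 10 8 (by decide)) (ne 2 7 (by decide)) (ne 11 2 (by decide)) h
  have e1 := ne 1 11 (by decide)
  -- Position 9 cannot be the earliest of positions 5–9, since `cA9` puts one of the others before
  -- it.
  have first : (x 5 < x 6 ∧ x 5 < x 7 ∧ x 5 < x 8 ∧ x 5 < x 9) ∨
      (x 6 < x 5 ∧ x 6 < x 7 ∧ x 6 < x 8 ∧ x 6 < x 9) ∨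
      (x 7 < x 5 ∧ x 7 < x 6 ∧ x 7 < x 8 ∧ x 7 < x 9) ∨
      (x 8 < x 5 ∧ x 8 < x 6 ∧ x 8 < x 7 ∧ x 8 < x 9) := by
    have e := ne 5 6 (by decide)
    have e' := ne 5 7 (by decide)
    have e2 := ne 5 8 (by decide)
    have e3 := ne 6 7 (by decide)
    have e4 := ne 6 8 (by decide)
    have e5 := ne 7 8 (by decide)
    clear * - cA9 e e' e2 e3 e4 e5
    omega
  rcases first with ⟨a, b, c, d⟩ | ⟨a, b, c, d⟩ | ⟨a, b, c, d⟩ | ⟨a, b, c, d⟩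
  · exact middle (wide_order_cross (f := x 5) (o := x 6) c5_11 c1_11 c11_1 c11_5 a b c d e1
      (ne 5 11 (by decide)))
  · exact middle (wide_order_cross (f := x 6) (o := x 5) c6_11 (fun h => (c1_11 h).symm) c11_1
      c11_6 a b c d e1 (ne 6 11 (by decide)))
  · exact wide_order_side cA7 c7_0 c1_11 c11_1 c0_7 cB5 cB6 a b c d h7 (ne 0 7 (by decide)) e1
  · exact wide_order_side cA8 c8_0 c1_11 (fun h => (c11_1 h).symm) c0_8 cB5 cB6 a b c d h8
      (ne 0 8 (by decide)) e1

/-- The symmetry of `wideChainList` that exchanges the two `6`-sets. -/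
def wideSwap : Fin 12 → Fin 12 := ![5, 6, 7, 8, 9, 0, 1, 2, 3, 4, 11, 10]

theorem wideSwap_candidates : ∀ i j : Fin 12, ∀ k ∈ wideCandidates (wideSwap i) (wideSwap j),
    wideSwap k ∈ wideCandidates i j ∧ wideSwap (wideSwap k) = k := by
  decide +kernel

theorem not_hasLinearQuotientOrder_wideChain :
    ¬ HasLinearQuotientOrder (disconnectedSets wideChainGraph 5) := by
  rw [disconnectedSets_wideChain]
  rintro ⟨r, hinj, hr⟩
  set x : Fin 12 → ℕ := fun i => r (wideChainList.getD i []).toFinset with hxdef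
  have hget : ∀ i : Fin 12, wideChainList.getD i [] ∈ wideChainList := by decide
  have hmem : ∀ i : Fin 12, (wideChainList.getD i []).toFinset ∈
      {U | ∃ l ∈ wideChainList, U = l.toFinset} := fun i => ⟨_, hget i, rfl⟩
  have hsurj : ∀ C ∈ wideChainList, ∃ k : Fin 12, C = wideChainList.getD k [] := by
    decide +kernel
  have hnodup : ∀ C ∈ wideChainList, C.Nodup := by decide +kernel
  have hne : ∀ i j : Fin 12, (wideChainList.getD i []).toFinset =
      (wideChainList.getD j []).toFinset → i = j := by
    decide +kernel
  have xinj : Function.Injective x := fun i j h => hne i j (hinj (hmem i) (hmem j) h)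
  have hx : ∀ i j, x j < x i → ∃ k ∈ wideCandidates i j, x k < x i := by
    intro i j h
    obtain ⟨_, ⟨C, hC, rfl⟩, hCA, u, hu, hCu⟩ := hr _ (hmem i) _ (hmem j) h
    obtain ⟨k, rfl⟩ := hsurj C hC
    refine ⟨k, ?_, hCA⟩
    simp only [wideCandidates, List.mem_filter, List.mem_finRange, true_and, decide_eq_true_eq]
    exact ⟨u, List.mem_toFinset.mp hu, filter_eq_singleton (hnodup _ hC) hCu⟩
  have hy : ∀ i j, x (wideSwap j) < x (wideSwap i) →
      ∃ k ∈ wideCandidates i j, x (wideSwap k) < x (wideSwap i) := by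
    intro i j h
    obtain ⟨k, hk, hki⟩ := hx _ _ h
    obtain ⟨h1, h2⟩ := wideSwap_candidates i j k hk
    exact ⟨wideSwap k, h1, by rwa [h2]⟩
  have yinj : Function.Injective fun i => x (wideSwap i) := fun i j h => by
    have : Function.Injective wideSwap := by decide
    exact this (xinj h)
  -- Take the earliest of the ten sets contained in `W_a` or `W_b`; the symmetry `wideSwap` allows
  -- it to be assumed contained in `W_a`.
  obtain ⟨i, hi5, hi⟩ := Finset.exists_min_image (Finset.univ.filter fun i : Fin 12 => i < 10) x
    ⟨0, by decide⟩
  have hlt : ∀ k : Fin 12, k < 10 → k ≠ i → x i < x k := fun k hk hki =>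
    lt_of_le_of_ne (hi k (by simpa using hk)) fun e => hki (xinj e).symm
  have hi10 : i < 10 := by simpa using hi5
  rcases lt_or_ge i 5 with h | h
  · exact wide_order_first x xinj hx i h (hlt 5 (by decide) (by omega)) (hlt 6 (by decide) (by omega))
      (hlt 7 (by decide) (by omega)) (hlt 8 (by decide) (by omega)) (hlt 9 (by decide) (by omega))
  · have hswap : ∀ i : Fin 12, i < 10 → 5 ≤ i → wideSwap (wideSwap i) = i ∧ wideSwap i < 5 := by
      decide
    have hs := hswap i hi10 h
    refine wide_order_first _ yinj hy (wideSwap i) hs.2 ?_ ?_ ?_ ?_ ?_ <;> rw [hs.1] <;>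
      exact hlt _ (by decide) (by simp only [wideSwap]; simp; omega)

end Combinatorics

/-! ### The two possible configurations of ends and middle sets. -/

section Combinatorics

set_option linter.unusedSectionVars false

variable {V : Type*} [DecidableEq V] [Fintype V] {H : SimpleGraph V}

namespace IsTwoEnded

variable {a b : V}

theorem card_inter (hH : HasSimplicialVertices H) (h : IsTwoEnded H a b)
    (h5 : HasLinearQuotientOrder (disconnectedSets H 5)) :
    (nonNeighbors H a ∩ nonNeighbors H b).card = 4 := by
  have h1 := Finset.card_sdiff_add_card_inter (nonNeighbors H b) (nonNeighbors H a)
  rw [h.card_sdiff_eq_two hH h5, Finset.inter_comm, h.mem_right.2] at h1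
  omega

/-- The two remaining common non-neighbours of `a` and `b`. -/
theorem exists_inter_eq (hH : HasSimplicialVertices H) (h : IsTwoEnded H a b)
    (h5 : HasLinearQuotientOrder (disconnectedSets H 5)) :
    ∃ r r', r ≠ r' ∧ r ≠ a ∧ r ≠ b ∧ r' ≠ a ∧ r' ≠ b ∧
      nonNeighbors H a ∩ nonNeighbors H b = {a, b, r, r'} := by
  have h4 := h.card_inter hH h5
  have ha : a ∈ nonNeighbors H a ∩ nonNeighbors H b :=
    Finset.mem_inter.mpr ⟨by simp, h.left_mem_right⟩
  have hb : b ∈ nonNeighbors H a ∩ nonNeighbors H b :=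
    Finset.mem_inter.mpr ⟨h.symm.left_mem_right, by simp⟩
  have h2 : (((nonNeighbors H a ∩ nonNeighbors H b).erase a).erase b).card = 2 := by
    rw [Finset.card_erase_of_mem (Finset.mem_erase.mpr ⟨h.ne.symm, hb⟩),
      Finset.card_erase_of_mem ha, h4]
  obtain ⟨r, r', hrr, he⟩ := Finset.card_eq_two.mp h2
  have hr : r ∈ ((nonNeighbors H a ∩ nonNeighbors H b).erase a).erase b := by simp [he]
  have hr' : r' ∈ ((nonNeighbors H a ∩ nonNeighbors H b).erase a).erase b := by simp [he]
  rw [Finset.mem_erase, Finset.mem_erase] at hr hr'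
  refine ⟨r, r', hrr, hr.2.1, hr.1, hr'.2.1, hr'.1, ?_⟩
  rw [← he, Finset.insert_erase (Finset.mem_erase.mpr ⟨h.ne.symm, hb⟩), Finset.insert_erase ha]

/-- Otherwise every middle set has its pair at `b`, so there is a single middle set `C`. Steps at
`r` and at `r'` make `C` avoid both, and `C` has only one element outside `W_a`. Hence `C` contains
all of `W_a \ W_b`, which has at least two elements, while the step from `W_b` allows only one
element outside `W_b`. -/
theorem exists_pairPart_left (hH : HasSimplicialVertices H) (h : IsTwoEnded H a b)
    (h5 : HasLinearQuotientOrder (disconnectedSets H 5)) :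
    ∃ X s, IsMiddle H a b X ∧ IsPairPart H a s X := by
  by_contra hno
  push Not at hno
  have hall : ∀ X X', IsMiddle H a b X → IsMiddle H a b X' → X = X' := by
    intro X X' hX hX'
    obtain ⟨s, hs⟩ := (h.exists_isPairPart hH hX).resolve_left fun ⟨s, hs⟩ => hno X s hX hs
    obtain ⟨s', hs'⟩ := (h.exists_isPairPart hH hX').resolve_left fun ⟨s, hs⟩ => hno X' s hX' hs
    exact h.symm.isPairPart_unique hH hX.symm hX'.symm hs hs'
  obtain ⟨r, r', hrr, hra, hrb, hr'a, hr'b, hI⟩ := h.exists_inter_eq hH h5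
  have hr : r ∈ nonNeighbors H a ∩ nonNeighbors H b := by simp [hI]
  have hr' : r' ∈ nonNeighbors H a ∩ nonNeighbors H b := by simp [hI]
  rw [Finset.mem_inter] at hr hr'
  obtain ⟨C, hC, hrC, -, hc⟩ := h.exists_step h5 hr.1 hra hr.2 hrb (Or.inl rfl)
  obtain ⟨C', hC', hr'C', -, -⟩ := h.exists_step h5 hr'.1 hr'a hr'.2 hr'b (Or.inl rfl)
  obtain ⟨D, hD, hrD, -, hd⟩ := h.symm.exists_step h5 hr.2 hrb hr.1 hra (Or.inl rfl)
  obtain rfl := hall _ _ hC hC'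
  obtain rfl := hall _ _ hC hD.symm
  have hc := hc rfl
  have hd := hd rfl
  have h1 := Finset.card_sdiff_add_card_inter C (nonNeighbors H a)
  have hsub : C ∩ nonNeighbors H a ⊆ ((nonNeighbors H a).erase r).erase r' := by
    intro x hx
    rw [Finset.mem_inter] at hx
    rw [Finset.mem_erase, Finset.mem_erase]
    exact ⟨fun e => hr'C' (e ▸ hx.1), fun e => hrC (e ▸ hx.1), hx.2⟩
  have hcard : (((nonNeighbors H a).erase r).erase r').card = 4 := by
    rw [Finset.card_erase_of_mem (Finset.mem_erase.mpr ⟨hrr.symm, hr'.1⟩),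
      Finset.card_erase_of_mem hr.1, h.mem_left.2]
  rw [hc, hC.mem.2] at h1
  have heq := Finset.eq_of_subset_of_card_le hsub (by omega)
  have hsub2 : nonNeighbors H a \ nonNeighbors H b ⊆ C \ nonNeighbors H b := by
    intro x hx
    rw [Finset.mem_sdiff] at hx ⊢
    refine ⟨?_, hx.2⟩
    have : x ∈ ((nonNeighbors H a).erase r).erase r' := by
      rw [Finset.mem_erase, Finset.mem_erase]
      exact ⟨fun e => hx.2 (e ▸ hr'.2), fun e => hx.2 (e ▸ hr.2), hx.1⟩
    rw [← heq] at this
    exact (Finset.mem_inter.mp this).1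
  have := Finset.card_le_card hsub2
  have := h.two_le
  omega

/-- The connected pair at one end is contained in the middle set belonging to the other end. -/
theorem pair_mem_other (hH : HasSimplicialVertices H) (h : IsTwoEnded H a b) {X Y : Finset V}
    {s t : V} (hX : IsMiddle H a b X) (hs : IsPairPart H a s X) (hY : IsMiddle H a b Y)
    (ht : IsPairPart H b t Y) : s ∈ Y := by
  by_contra hsY
  obtain ⟨p, hpY, hp⟩ := Finset.not_subset.mp hY.not_subset_left
  rw [mem_nonNeighbors, not_not] at hp
  have hps : p ≠ s := fun e => hsY (e ▸ hpY)
  have hbX := h.symm.mem_middle_left hX.symm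
  have hts : H.Adj t s := (ht.adj_iff s).mpr (Or.inl hsY)
  have hta : t ≠ a := fun e => h.not_adj (e ▸ ht.adj).symm
  have htX : t ∉ X := ((hs.adj_iff t).mp hts.symm).resolve_right hta
  have hpX : p ∉ X := fun e => hs.not_adj p e hps hp
  have hpt : p ≠ t := by
    rintro rfl
    have := h.symm.isPairPart_notMem hY.symm ht
    rw [Finset.mem_sdiff, mem_nonNeighbors] at this
    exact this.1 hp
  -- Both `t` and `p` lie outside `X`, so they are adjacent; but the only neighbour of `t` in `Y` is
  -- `b`, and `p` is adjacent to `a`.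
  have hadj := h.isCliqueOn_compl_middle hH hX t (by simp [htX]) p (by simp [hpX]) hpt.symm
  refine ((ht.adj_iff p).mp hadj).elim (fun e => e hpY) fun e => h.not_adj (e ▸ hp)

theorem exists_fifth (h : IsTwoEnded H a b) {X : Finset V} {s t : V} (hX : IsMiddle H a b X)
    (hs : IsPairPart H a s X) (hbt : H.Adj b t) (hat : ¬ H.Adj a t) (htX : t ∈ X) :
    ∃ w, X = {a, b, s, t, w} ∧ w ≠ a ∧ w ≠ b ∧ w ≠ s ∧ w ≠ t ∧ ¬ H.Adj a w := by
  have haX := h.mem_middle_left hX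
  have hbX := h.symm.mem_middle_left hX.symm
  have hsb : s ≠ b := fun e => h.not_adj (e ▸ hs.adj)
  have hst : t ≠ s := fun e => hat (e ▸ hs.adj)
  have hta : t ≠ a := fun e => h.not_adj (e ▸ hbt).symm
  have h1 : (((((X.erase a).erase b).erase s).erase t)).card = 1 := by
    rw [Finset.card_erase_of_mem, Finset.card_erase_of_mem, Finset.card_erase_of_mem,
      Finset.card_erase_of_mem haX, hX.mem.2]
    · simp [hbX, h.ne.symm]
    · simp [hs.mem, hsb, hs.adj.ne']
    · simp [htX, hst, hta, hbt.ne']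
  obtain ⟨w, hw⟩ := Finset.card_eq_one.mp h1
  have hwm : w ∈ ((((X.erase a).erase b).erase s).erase t) := by simp [hw]
  simp only [Finset.mem_erase] at hwm
  refine ⟨w, ?_, hwm.2.2.2.1, hwm.2.2.1, hwm.2.1, hwm.1, hs.not_adj w hwm.2.2.2.2 hwm.2.1⟩
  rw [← hw, Finset.insert_erase, Finset.insert_erase, Finset.insert_erase, Finset.insert_erase haX]
  · simp [hbX, h.ne.symm]
  · simp [hs.mem, hsb, hs.adj.ne']
  · simp [htX, hst, hta, hbt.ne']

end IsTwoEnded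

/-- The data shared by both configurations: `W_a = {a, b, t, q, r, r'}` and
`W_b = {a, b, s, p, r, r'}`, with a middle set at each end. -/
structure IsConfiguration (H : SimpleGraph V) (a b s t p q r r' : V) (X Y : Finset V) : Prop where
  nodup : [a, b, s, t, p, q, r, r'].Nodup
  left : nonNeighbors H a = {a, b, t, q, r, r'}
  right : nonNeighbors H b = {a, b, s, p, r, r'}
  middle_left : IsMiddle H a b X
  middle_right : IsMiddle H a b Y
  pair_left : IsPairPart H a s X
  pair_right : IsPairPart H b t Y

theorem pair_union_eq (t q a b r r' : V) :
    ({t, q} ∪ {a, b, r, r'} : Finset V) = {a, b, t, q, r, r'} := by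
  ext x
  simp only [Finset.mem_union, Finset.mem_insert, Finset.mem_singleton]
  tauto

theorem nodup_of_adj {a b s t p q r r' : V} (hne : a ≠ b) (hab : ¬ H.Adj a b)
    (hs' : H.Adj a s) (ht : ¬ H.Adj a t) (ht' : H.Adj b t) (hps : p ≠ s)
    (hp' : H.Adj a p) (hqt : q ≠ t) (hq : ¬ H.Adj a q) (hq' : H.Adj b q) (hrr : r ≠ r')
    (hra : r ≠ a) (hrb : r ≠ b) (hra' : r' ≠ a) (hrb' : r' ≠ b) (hr : ¬ H.Adj a r)
    (hr2 : ¬ H.Adj b r) (hr' : ¬ H.Adj a r') (hr2' : ¬ H.Adj b r') :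
    [a, b, s, t, p, q, r, r'].Nodup := by
  have key : ∀ {c x y : V}, H.Adj c x → ¬ H.Adj c y → x ≠ y := fun h h' e => h' (e ▸ h)
  have hba : ¬ H.Adj b a := fun e => hab e.symm
  simp only [List.nodup_cons, List.mem_cons, List.not_mem_nil, or_false, not_or, not_false_eq_true,
    List.nodup_nil, and_true]
  exact ⟨⟨hne, hs'.ne, (key ht' hba).symm, hp'.ne, (key hq' hba).symm, hra.symm, hra'.symm⟩,
    ⟨(key hs' hab).symm, ht'.ne, (key hp' hab).symm, hq'.ne, hrb.symm, hrb'.symm⟩,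
    ⟨key hs' ht, hps.symm, key hs' hq, key hs' hr, key hs' hr'⟩,
    ⟨(key hp' ht).symm, hqt.symm, key ht' hr2, key ht' hr2'⟩,
    ⟨key hp' hq, key hp' hr, key hp' hr'⟩, ⟨key hq' hr2, key hq' hr2'⟩, hrr⟩

/-- Let `w`, `w'` be the fifth elements of `X`, `Y`. For a common non-neighbour `z`, the steps
between `W_a - z` and `W_b - z` in both directions use a middle set avoiding `z` and having one
element outside the starting 6-set. If `w = z` only `Y` is available, which excludes `w' = z` and
`w' = p`; if `w' = z` only `X` is, which excludes `w = q`. The surviving pairs are `(q, p)`, `(r,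
r')` and `(r', r)`. -/
theorem IsTwoEnded.exists_configuration (hH : HasSimplicialVertices H) {a b : V}
    (h : IsTwoEnded H a b) (h5 : HasLinearQuotientOrder (disconnectedSets H 5)) :
    ∃ s t p q r r' X Y, IsConfiguration H a b s t p q r r' X Y ∧
      (X = {a, b, s, t, r} ∧ Y = {a, b, s, t, r'} ∨ X = {a, b, s, t, q} ∧ Y = {a, b, s, t, p}) := by
  obtain ⟨X, s, hX, hs⟩ := h.exists_pairPart_left hH h5
  obtain ⟨Y, t, hY, ht⟩ := h.symm.exists_pairPart_left hH h5
  replace hY := hY.symm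
  have hsY := h.pair_mem_other hH hX hs hY ht
  have htX := h.symm.pair_mem_other hH hY.symm ht hX.symm hs
  have hs' := h.isPairPart_notMem hX hs
  have ht' := h.symm.isPairPart_notMem hY.symm ht
  have two := h.card_sdiff_eq_two hH h5
  have two' := h.symm.card_sdiff_eq_two hH h5
  obtain ⟨p, hp⟩ := Finset.card_eq_one.mp
    (show ((nonNeighbors H b \ nonNeighbors H a).erase s).card = 1 by
      rw [Finset.card_erase_of_mem hs', two])
  obtain ⟨q, hq⟩ := Finset.card_eq_one.mp
    (show ((nonNeighbors H a \ nonNeighbors H b).erase t).card = 1 by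
      rw [Finset.card_erase_of_mem ht', two'])
  have hpm : p ∈ (nonNeighbors H b \ nonNeighbors H a).erase s := by simp [hp]
  have hqm : q ∈ (nonNeighbors H a \ nonNeighbors H b).erase t := by simp [hq]
  rw [Finset.mem_erase] at hpm hqm
  have hba : nonNeighbors H b \ nonNeighbors H a = {s, p} := by
    rw [← hp, Finset.insert_erase hs']
  have hab : nonNeighbors H a \ nonNeighbors H b = {t, q} := by
    rw [← hq, Finset.insert_erase ht']
  obtain ⟨r, r', hrr, hra, hrb, hr'a, hr'b, hI⟩ := h.exists_inter_eq hH h5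
  have hr : r ∈ nonNeighbors H a ∩ nonNeighbors H b := by simp [hI]
  have hr' : r' ∈ nonNeighbors H a ∩ nonNeighbors H b := by simp [hI]
  have hleft : nonNeighbors H a = {a, b, t, q, r, r'} := by
    rw [← Finset.sdiff_union_inter (nonNeighbors H a) (nonNeighbors H b), hab, hI]
    exact pair_union_eq ..
  have hright : nonNeighbors H b = {a, b, s, p, r, r'} := by
    rw [← Finset.sdiff_union_inter (nonNeighbors H b) (nonNeighbors H a), hba, Finset.inter_comm, hI]
    exact pair_union_eq ..
  have hnd : ∀ r r', r ≠ r' → r ≠ a → r ≠ b → r' ≠ a → r' ≠ b →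
      r ∈ nonNeighbors H a ∩ nonNeighbors H b → r' ∈ nonNeighbors H a ∩ nonNeighbors H b →
      [a, b, s, t, p, q, r, r'].Nodup := by
    intro r r' hrr hra hrb hr'a hr'b hr hr'
    simp only [Finset.mem_inter, Finset.mem_sdiff, mem_nonNeighbors, not_not]
      at hr hr' hs' ht' hpm hqm
    exact nodup_of_adj h.ne h.not_adj hs'.2 ht'.1 ht'.2 hpm.1 hpm.2.2 hqm.1 hqm.2.1
      hqm.2.2 hrr hra hrb hr'a hr'b hr.1 hr.2 hr'.1 hr'.2
  obtain ⟨w, hXw, hwa, hwb, hws, hwt, haw⟩ := h.exists_fifth hX hs ht.adj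
    (by simpa using (Finset.mem_sdiff.mp ht').1) htX
  obtain ⟨w', hYw, hw'b, hw'a, hw't, hw's, hbw'⟩ := h.symm.exists_fifth hY.symm ht hs.adj
    (by simpa using (Finset.mem_sdiff.mp hs').1) hsY
  replace hYw : Y = {a, b, s, t, w'} := by
    rw [hYw, Finset.insert_comm b a, Finset.insert_comm t s]
  have hw : w = q ∨ w = r ∨ w = r' := by
    have : w ∈ nonNeighbors H a := by simpa using haw
    rw [hleft] at this
    simpa [hwa, hwb, hwt] using this
  have hw' : w' = p ∨ w' = r ∨ w' = r' := by
    have : w' ∈ nonNeighbors H b := by simpa using hbw'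
    rw [hright] at this
    simpa [hw'a, hw'b, hw's] using this
  have hmid : ∀ C, IsMiddle H a b C → C = X ∨ C = Y := by
    intro C hC
    rcases h.exists_isPairPart hH hC with ⟨u, hu⟩ | ⟨u, hu⟩
    · exact Or.inl (h.isPairPart_unique hH hC hX hu hs)
    · exact Or.inr (h.symm.isPairPart_unique hH hC.symm hY.symm hu ht)
  -- for a common non-neighbour `z`, steps avoiding `z`
  have hstep : ∀ z ∈ nonNeighbors H a ∩ nonNeighbors H b, z ≠ a → z ≠ b →
      (∃ C, (C = X ∨ C = Y) ∧ z ∉ C ∧ (C \ nonNeighbors H a).card = 1) ∧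
      ∃ C, (C = X ∨ C = Y) ∧ z ∉ C ∧ (C \ nonNeighbors H b).card = 1 := by
    intro z hz hza hzb
    rw [Finset.mem_inter] at hz
    obtain ⟨C, hC, hzC, -, hc⟩ := h.exists_step h5 hz.1 hza hz.2 hzb (Or.inl rfl)
    obtain ⟨D, hD, hzD, -, hd⟩ := h.symm.exists_step h5 hz.2 hzb hz.1 hza (Or.inl rfl)
    exact ⟨⟨C, hmid C hC, hzC, hc rfl⟩, ⟨D, hmid D hD.symm, hzD, hd rfl⟩⟩
  have hXq : w = q → (X \ nonNeighbors H b).card ≠ 1 := by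
    rintro rfl hcard
    have hsub : {t, w} ⊆ X \ nonNeighbors H b := by
      rw [← hab]
      intro x hx
      rw [Finset.mem_sdiff]
      refine ⟨?_, (Finset.mem_sdiff.mp hx).2⟩
      rw [hab] at hx
      rw [hXw]
      rw [Finset.mem_insert, Finset.mem_singleton] at hx
      rcases hx with e | e <;> simp [e]
    have := Finset.card_le_card hsub
    rw [Finset.card_pair hwt.symm] at this
    omega
  have hYp : w' = p → (Y \ nonNeighbors H a).card ≠ 1 := by
    rintro rfl hcard
    have hsub : {s, w'} ⊆ Y \ nonNeighbors H a := by
      rw [← hba]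
      intro x hx
      rw [Finset.mem_sdiff]
      refine ⟨?_, (Finset.mem_sdiff.mp hx).2⟩
      rw [hba] at hx
      rw [hYw]
      rw [Finset.mem_insert, Finset.mem_singleton] at hx
      rcases hx with e | e <;> simp [e]
    have := Finset.card_le_card hsub
    rw [Finset.card_pair hw's.symm] at this
    omega
  -- the fifth element of `X` is avoided by `Y` only
  have hdiff : ∀ z ∈ nonNeighbors H a ∩ nonNeighbors H b, z ≠ a → z ≠ b → w = z →
      w' ≠ p ∧ w' ≠ z := by
    rintro z hz hza hzb rfl
    obtain ⟨⟨C, hC, hzC, hc⟩, -⟩ := hstep w hz hza hzb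
    have hCY : C = Y := hC.resolve_left fun e => hzC (by rw [e, hXw]; simp)
    subst hCY
    exact ⟨fun e => hYp e hc, fun e => hzC (by rw [hYw, e]; simp)⟩
  have hdiff' : ∀ z ∈ nonNeighbors H a ∩ nonNeighbors H b, z ≠ a → z ≠ b → w' = z →
      w ≠ q := by
    rintro z hz hza hzb rfl
    obtain ⟨-, ⟨C, hC, hzC, hc⟩⟩ := hstep w' hz hza hzb
    have hCX : C = X := hC.resolve_right fun e => hzC (by rw [e, hYw]; simp)
    subst hCX
    exact fun e => hXq e hc
  rcases hw with hw | hw | hw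
  · refine ⟨s, t, p, q, r, r', X, Y, ⟨hnd r r' hrr hra hrb hr'a hr'b hr hr', hleft, hright, hX, hY,
      hs, ht⟩, Or.inr ⟨hw ▸ hXw, ?_⟩⟩
    rcases hw' with e | e | e
    · exact e ▸ hYw
    · exact absurd hw (hdiff' r hr hra hrb e)
    · exact absurd hw (hdiff' r' hr' hr'a hr'b e)
  · have hd := hdiff r hr hra hrb hw
    have e : w' = r' := (hw'.resolve_left hd.1).resolve_left hd.2
    exact ⟨s, t, p, q, r, r', X, Y, ⟨hnd r r' hrr hra hrb hr'a hr'b hr hr', hleft, hright, hX, hY,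
      hs, ht⟩, Or.inl ⟨hw ▸ hXw, e ▸ hYw⟩⟩
  · have hd := hdiff r' hr' hr'a hr'b hw
    have e : w' = r := (hw'.resolve_left hd.1).resolve_right hd.2
    -- This is the previous case with the names of `r` and `r'` interchanged.
    refine ⟨s, t, p, q, r', r, X, Y, ⟨hnd r' r hrr.symm hr'a hr'b hra hrb hr' hr, ?_, ?_, hX, hY,
      hs, ht⟩, Or.inl ⟨hw ▸ hXw, e ▸ hYw⟩⟩
    · rw [hleft, Finset.pair_comm]
    · rw [hright, Finset.pair_comm]

end Combinatorics

/-! ### Identification of the eight-vertex graphs and the descent to 4-sets. -/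

section Combinatorics

set_option linter.unusedSectionVars false

variable {V : Type*} [DecidableEq V] [Fintype V] {H : SimpleGraph V}

/-- A missing edge between `x` and `y` would make `{a, s, x}` and `{b, t, y}` the parts of a
disconnected 6-set. It contains a neighbour of `a` and one of `b`, so it is neither `W_a` nor `W_b`.
-/
theorem IsTwoEnded.adj_of_parts {a b s t x y : V} (h : IsTwoEnded H a b)
    (hd : Disjoint ({a, s, x} : Finset V) {b, t, y}) (hs : H.Adj a s) (ht : H.Adj b t)
    (hsx : s ≠ x) (hax : a ≠ x) (hty : t ≠ y) (hby : b ≠ y)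
    (hat : ¬ H.Adj a t) (hay : ¬ H.Adj a y) (hsb : ¬ H.Adj s b) (hst : ¬ H.Adj s t)
    (hsy : ¬ H.Adj s y) (hxb : ¬ H.Adj x b) (hxt : ¬ H.Adj x t) : H.Adj x y := by
  by_contra hxy
  have h6 : ({a, s, x} ∪ {b, t, y} : Finset V) ∈ disconnectedSets H 6 := by
    refine ⟨⟨{a, s, x}, {b, t, y}, ⟨a, by simp⟩, ⟨b, by simp⟩, hd, rfl, ?_⟩, ?_⟩
    · have := h.not_adj
      intro u hu v hv
      simp only [Finset.mem_insert, Finset.mem_singleton] at hu hv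
      rcases hu with rfl | rfl | rfl <;> rcases hv with rfl | rfl | rfl <;> assumption
    · rw [Finset.card_union_of_disjoint hd, Finset.card_eq_three.mpr ⟨a, s, x, hs.ne, hax, hsx, rfl⟩,
        Finset.card_eq_three.mpr ⟨b, t, y, ht.ne, hby, hty, rfl⟩]
  rcases h.six _ h6 with e | e
  · have : s ∈ nonNeighbors H a := e ▸ by simp
    exact (mem_nonNeighbors.mp this) hs
  · have : t ∈ nonNeighbors H b := e ▸ by simp
    exact (mem_nonNeighbors.mp this) ht

namespace IsConfiguration

variable {a b s t p q r r' : V} {X Y : Finset V}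

theorem injective (c : IsConfiguration H a b s t p q r r' X Y) :
    Function.Injective ![a, b, s, t, p, q, r, r'] := by
  have h := List.nodup_ofFn (f := ![a, b, s, t, p, q, r, r'])
  exact h.mp (by simpa using c.nodup)

theorem adj_of_notMem (hH : HasSimplicialVertices H) (h : IsTwoEnded H a b)
    (c : IsConfiguration H a b s t p q r r' X Y) {x y : V} (hx : x ∉ X) (hy : y ∉ X)
    (hxy : x ≠ y) : H.Adj x y :=
  h.isCliqueOn_compl_middle hH c.middle_left x (Finset.mem_compl.mpr hx) y
    (Finset.mem_compl.mpr hy) hxy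

theorem adj_of_notMem' (hH : HasSimplicialVertices H) (h : IsTwoEnded H a b)
    (c : IsConfiguration H a b s t p q r r' X Y) {x y : V} (hx : x ∉ Y) (hy : y ∉ Y)
    (hxy : x ≠ y) : H.Adj x y :=
  h.isCliqueOn_compl_middle hH c.middle_right x (Finset.mem_compl.mpr hx) y
    (Finset.mem_compl.mpr hy) hxy

/-- The vertices outside a configuration are adjacent to all other vertices. -/
theorem adj_of_notMem_range (hH : HasSimplicialVertices H) (h : IsTwoEnded H a b)
    (c : IsConfiguration H a b s t p q r r' X Y)
    (hXY : X ∩ Y ⊆ {a, b, s, t}) (hX : ∀ x ∈ X, x ∈ Set.range ![a, b, s, t, p, q, r, r'])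
    (hY : ∀ x ∈ Y, x ∈ Set.range ![a, b, s, t, p, q, r, r']) {w : V}
    (hw : w ∉ Set.range ![a, b, s, t, p, q, r, r']) (v : V) (hvw : v ≠ w) : H.Adj w v := by
  have hwX : w ∉ X := fun e => hw (hX w e)
  have hwY : w ∉ Y := fun e => hw (hY w e)
  by_cases hvX : v ∈ X
  · by_cases hvY : v ∈ Y
    · have hv := hXY (Finset.mem_inter.mpr ⟨hvX, hvY⟩)
      have hw' : w ≠ a ∧ w ≠ b ∧ w ≠ s ∧ w ≠ t ∧ w ≠ p ∧ w ≠ q ∧ w ≠ r ∧ w ≠ r' := by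
        simp only [Matrix.range_cons, Matrix.range_empty, Set.union_empty, Set.mem_union,
          Set.mem_singleton_iff, not_or] at hw
        tauto
      obtain ⟨h1, h2, h3, h4, h5, h6, h7, h8⟩ := hw'
      simp only [Finset.mem_insert, Finset.mem_singleton] at hv
      rcases hv with rfl | rfl | rfl | rfl
      · by_contra hn
        have : w ∈ nonNeighbors H v := mem_nonNeighbors.mpr fun e => hn e.symm
        rw [c.left] at this
        simp_all
      · by_contra hn
        have : w ∈ nonNeighbors H v := mem_nonNeighbors.mpr fun e => hn e.symm
        rw [c.right] at this
        simp_all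
      · exact ((c.pair_left.adj_iff w).mpr (Or.inl hwX)).symm
      · exact ((c.pair_right.adj_iff w).mpr (Or.inl hwY)).symm
    · exact c.adj_of_notMem' hH h hwY hvY hvw.symm
  · exact c.adj_of_notMem hH h hwX hvX hvw.symm

theorem adj_iff_of_lt {K : SimpleGraph (Fin 8)} {φ : Fin 8 → V}
    (h : ∀ i j, i < j → (H.Adj (φ i) (φ j) ↔ K.Adj i j)) (i j : Fin 8) :
    H.Adj (φ i) (φ j) ↔ K.Adj i j := by
  rcases lt_trichotomy i j with hij | rfl | hij
  · exact h i j hij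
  · simp
  · rw [H.adj_comm, K.adj_comm]; exact h j i hij

theorem adj_left_iff (c : IsConfiguration H a b s t p q r r' X Y) (w : V) :
    H.Adj a w ↔ w ∉ ({a, b, t, q, r, r'} : Finset V) := by
  rw [← c.left, mem_nonNeighbors, not_not]

theorem adj_right_iff (c : IsConfiguration H a b s t p q r r' X Y) (w : V) :
    H.Adj b w ↔ w ∉ ({a, b, s, p, r, r'} : Finset V) := by
  rw [← c.right, mem_nonNeighbors, not_not]

/-- The neighbourhoods of `a`, `b`, `s`, `t` are known, and the complements of `X` and `Y` are
cliques. Together these settle every pair except `r`, `r'`, which `adj_of_parts` handles. -/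
theorem adj_chain (hH : HasSimplicialVertices H) (h : IsTwoEnded H a b)
    (c : IsConfiguration H a b s t p q r r' X Y) (hX : X = {a, b, s, t, r})
    (hY : Y = {a, b, s, t, r'}) (i j : Fin 8) :
    H.Adj (![a, b, s, t, p, q, r, r'] i) (![a, b, s, t, p, q, r, r'] j) ↔ chainGraph.Adj i j := by
  have hnd := c.nodup
  simp only [List.nodup_cons, List.mem_cons, List.not_mem_nil, or_false, not_or, not_false_eq_true,
    List.nodup_nil, and_true] at hnd
  obtain ⟨⟨a1, a2, a3, a4, a5, a6, a7⟩, ⟨b2, b3, b4, b5, b6, b7⟩, ⟨c3, c4, c5, c6, c7⟩,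
    ⟨d4, d5, d6, d7⟩, ⟨e5, e6, e7⟩, ⟨f6, f7⟩, g7⟩ := hnd
  have ha := c.adj_left_iff
  have hb := c.adj_right_iff
  have hs := c.pair_left.adj_iff
  have ht := c.pair_right.adj_iff
  have hcX : ∀ x y, x ∉ X → y ∉ X → x ≠ y → H.Adj x y := fun _ _ => c.adj_of_notMem hH h
  have hcY : ∀ x y, x ∉ Y → y ∉ Y → x ≠ y → H.Adj x y := fun _ _ => c.adj_of_notMem' hH h
  simp only [hX, hY, Finset.mem_insert, Finset.mem_singleton, not_or] at ha hb hs ht hcX hcY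
  have hrr : H.Adj r' r := by
    apply h.adj_of_parts (a := a) (b := b) (s := s) (t := t)
    · simp only [Finset.disjoint_left, Finset.mem_insert, Finset.mem_singleton]
      grind
    all_goals grind [SimpleGraph.adj_comm]
  refine adj_iff_of_lt ?_ i j
  intro i j hij
  fin_cases i <;> fin_cases j <;> first | exact absurd hij (by decide) | skip
  all_goals first
    | refine iff_of_true ?_ (by decide)
    | refine iff_of_false ?_ (by decide)
  all_goals dsimp
  all_goals grind [SimpleGraph.adj_comm]

theorem adj_wideChain (hH : HasSimplicialVertices H) (h : IsTwoEnded H a b)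
    (c : IsConfiguration H a b s t p q r r' X Y) (hX : X = {a, b, s, t, q})
    (hY : Y = {a, b, s, t, p}) (i j : Fin 8) :
    H.Adj (![a, b, s, t, p, q, r, r'] i) (![a, b, s, t, p, q, r, r'] j) ↔
      wideChainGraph.Adj i j := by
  have hnd := c.nodup
  simp only [List.nodup_cons, List.mem_cons, List.not_mem_nil, or_false, not_or, not_false_eq_true,
    List.nodup_nil, and_true] at hnd
  obtain ⟨⟨a1, a2, a3, a4, a5, a6, a7⟩, ⟨b2, b3, b4, b5, b6, b7⟩, ⟨c3, c4, c5, c6, c7⟩,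
    ⟨d4, d5, d6, d7⟩, ⟨e5, e6, e7⟩, ⟨f6, f7⟩, g7⟩ := hnd
  have ha := c.adj_left_iff
  have hb := c.adj_right_iff
  have hs := c.pair_left.adj_iff
  have ht := c.pair_right.adj_iff
  have hcX : ∀ x y, x ∉ X → y ∉ X → x ≠ y → H.Adj x y := fun _ _ => c.adj_of_notMem hH h
  have hcY : ∀ x y, x ∉ Y → y ∉ Y → x ≠ y → H.Adj x y := fun _ _ => c.adj_of_notMem' hH h
  simp only [hX, hY, Finset.mem_insert, Finset.mem_singleton, not_or] at ha hb hs ht hcX hcY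
  -- The only pair not settled by the four known neighbourhoods and the two clique complements.
  have hpq : H.Adj p q := by
    apply h.adj_of_parts (a := a) (b := b) (s := s) (t := t)
    · simp only [Finset.disjoint_left, Finset.mem_insert, Finset.mem_singleton]
      grind
    all_goals grind [SimpleGraph.adj_comm]
  refine adj_iff_of_lt ?_ i j
  intro i j hij
  fin_cases i <;> fin_cases j <;> first | exact absurd hij (by decide) | skip
  all_goals first
    | refine iff_of_true ?_ (by decide)
    | refine iff_of_false ?_ (by decide)
  all_goals dsimp
  all_goals grind [SimpleGraph.adj_comm]

end IsConfiguration

/-- If all disconnected sets have at most six elements, those with five elements have linear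
quotients and those with six do not, then those with four elements have linear quotients. -/
theorem hasLinearQuotientOrder_four (hH : HasSimplicialVertices H)
    (h7 : ∀ W, InducesDisconnected H W → W.card ≤ 6)
    (h5 : HasLinearQuotientOrder (disconnectedSets H 5))
    (h6 : ¬ HasLinearQuotientOrder (disconnectedSets H 6)) :
    HasLinearQuotientOrder (disconnectedSets H 4) := by
  obtain ⟨a, b, h⟩ := exists_isTwoEnded hH h7 h5 h6
  obtain ⟨s, t, p, q, r, r', X, Y, c, ⟨hX, hY⟩ | ⟨hX, hY⟩⟩ := h.exists_configuration hH h5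
  · have hu : ∀ w, w ∉ Set.range ![a, b, s, t, p, q, r, r'] → ∀ v, v ≠ w → H.Adj w v := by
      intro w hw
      refine c.adj_of_notMem_range hH h ?_ ?_ ?_ hw
      · have hnd := c.nodup
        rw [hX, hY]
        intro x
        simp only [Finset.mem_inter, Finset.mem_insert, Finset.mem_singleton]
        simp only [List.nodup_cons, List.mem_cons, List.not_mem_nil] at hnd
        grind
      · simp [hX, Matrix.range_cons, Matrix.range_empty]
      · simp [hY, Matrix.range_cons, Matrix.range_empty]
    rw [disconnectedSets_eq_image (φ := ⟨_, c.injective⟩) (c.adj_chain hH h hX hY) hu,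
      hasLinearQuotientOrder_image_iff]
    exact hasLinearQuotientOrder_chain
  · have hu : ∀ w, w ∉ Set.range ![a, b, s, t, p, q, r, r'] → ∀ v, v ≠ w → H.Adj w v := by
      intro w hw
      refine c.adj_of_notMem_range hH h ?_ ?_ ?_ hw
      · have hnd := c.nodup
        rw [hX, hY]
        intro x
        simp only [Finset.mem_inter, Finset.mem_insert, Finset.mem_singleton]
        simp only [List.nodup_cons, List.mem_cons, List.not_mem_nil] at hnd
        grind
      · simp [hX, Matrix.range_cons, Matrix.range_empty]
      · simp [hY, Matrix.range_cons, Matrix.range_empty]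
    rw [disconnectedSets_eq_image (φ := ⟨_, c.injective⟩) (c.adj_wideChain hH h hX hY) hu,
      hasLinearQuotientOrder_image_iff] at h5
    exact absurd h5 not_hasLinearQuotientOrder_wideChain

end Combinatorics

/-! ### From a minimal multigraded resolution to complexes of vector spaces. -/

section Scalars

variable {σ K : Type*} [Field K]

/-- The matrices of scalars of an augmented minimal multigraded free resolution of `S / I`, where
`In` is the set of exponents of the monomials in `I`; every strand `{deg ≤ a}` is exact in
positive homological degrees, and in degree `0` if `a ∈ In`. -/
structure ScalarComplex (K : Type*) [Field K] {σ : Type*} (In : Set (σ →₀ ℕ)) where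
  rk : ℕ → ℕ
  deg : (k : ℕ) → Fin (rk k) → (σ →₀ ℕ)
  bd : (k : ℕ) → (Fin (rk (k + 1)) → K) →ₗ[K] (Fin (rk k) → K)
  rk_zero : rk 0 = 1
  deg_zero : ∀ j, deg 0 j = 0
  deg_lt : ∀ k j i, bd k (Pi.single j 1) i ≠ 0 → deg k i < deg (k + 1) j
  mem_of_bd : ∀ j i, bd 0 (Pi.single j 1) i ≠ 0 → deg 1 j ∈ In
  bd_bd : ∀ k x, bd k (bd (k + 1) x) = 0
  exact : ∀ k a x, (∀ j, x j ≠ 0 → deg (k + 1) j ≤ a) → bd k x = 0 →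
    ∃ y, (∀ j, y j ≠ 0 → deg (k + 2) j ≤ a) ∧ bd (k + 1) y = x
  exact_zero : ∀ a ∈ In, ∀ x, ∃ y, (∀ j, y j ≠ 0 → deg 1 j ≤ a) ∧ bd 0 y = x

/-- Homogeneous matrices of polynomials, in terms of their scalars. -/
theorem exists_scalar_of_graded {m n : ℕ} {s : Fin m → (σ →₀ ℕ)} {t : Fin n → (σ →₀ ℕ)}
    {D : (Fin n → MvPolynomial σ K) →ₗ[MvPolynomial σ K] (Fin m → MvPolynomial σ K)}
    (hD : ∀ j i, ∃ c : K, monomial (s i) (1 : K) * D (Pi.single j 1) i = monomial (t j) c)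
    (hne : ∀ j i, s i = t j → coeff 0 (D (Pi.single j 1) i) = 0) (j : Fin n) (i : Fin m) :
    ∃ c : K, D (Pi.single j 1) i = monomial (t j - s i) c ∧ (c ≠ 0 → s i < t j) := by
  classical
  obtain ⟨c, hc⟩ := hD j i
  have hinj : ∀ p q : MvPolynomial σ K, monomial (s i) (1 : K) * p = monomial (s i) 1 * q → p = q :=
    fun p q h => mul_left_cancel₀ (by simp) h
  by_cases h0 : c = 0
  · refine ⟨0, hinj _ _ ?_, fun h => absurd rfl h⟩
    rw [hc, h0]; simp
  · have hle : s i ≤ t j := by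
      by_contra hle
      have := congrArg (coeff (t j)) hc
      rw [coeff_monomial_mul', if_neg hle, coeff_monomial, if_pos rfl] at this
      exact h0 this.symm
    have hD : D (Pi.single j 1) i = monomial (t j - s i) c := by
      apply hinj
      rw [hc, monomial_mul, add_tsub_cancel_of_le hle, one_mul]
    refine ⟨c, hD, fun _ => lt_of_le_of_ne hle fun e => h0 ?_⟩
    have := hne j i e
    rwa [hD, e, tsub_self, coeff_monomial, if_pos rfl] at this

/-- The homogeneous element of degree `a` with the given coefficients. -/
noncomputable def homogeneousLift {n : ℕ} (t : Fin n → (σ →₀ ℕ)) (a : σ →₀ ℕ) (x : Fin n → K) :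
    Fin n → MvPolynomial σ K :=
  fun j => monomial (a - t j) (x j)

/-- The coefficients of the component of degree `a`. -/
noncomputable def homogeneousPart {n : ℕ} (t : Fin n → (σ →₀ ℕ)) (a : σ →₀ ℕ) (y : Fin n → MvPolynomial σ K) :
    Fin n → K :=
  open Classical in fun j => if t j ≤ a then coeff (a - t j) (y j) else 0

theorem homogeneousPart_lift {n : ℕ} (t : Fin n → (σ →₀ ℕ)) (a : σ →₀ ℕ) (x : Fin n → K)
    (hx : ∀ j, x j ≠ 0 → t j ≤ a) : homogeneousPart t a (homogeneousLift t a x) = x := by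
  classical
  funext j
  by_cases h : t j ≤ a
  · simp [homogeneousPart, homogeneousLift, h]
  · have : x j = 0 := by
      by_contra h0
      exact h (hx j h0)
    simp [homogeneousPart, h, this]

theorem le_of_homogeneousPart_ne_zero {n : ℕ} {t : Fin n → (σ →₀ ℕ)} {a : σ →₀ ℕ}
    {y : Fin n → MvPolynomial σ K} (j : Fin n) (h : homogeneousPart t a y j ≠ 0) : t j ≤ a := by
  by_contra hle
  exact h (by simp [homogeneousPart, hle])

section Matrix

variable {m n : ℕ} {s : Fin m → (σ →₀ ℕ)} {t : Fin n → (σ →₀ ℕ)}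
  {D : (Fin n → MvPolynomial σ K) →ₗ[MvPolynomial σ K] (Fin m → MvPolynomial σ K)}
  {c : Matrix (Fin m) (Fin n) K}

theorem map_apply_eq_sum (D : (Fin n → MvPolynomial σ K) →ₗ[MvPolynomial σ K]
    (Fin m → MvPolynomial σ K)) (y : Fin n → MvPolynomial σ K) (i : Fin m) :
    D y i = ∑ j, y j * D (Pi.single j 1) i := by
  conv_lhs => rw [LinearMap.pi_apply_eq_sum_univ D y]
  rw [Finset.sum_apply]
  refine Finset.sum_congr rfl fun j _ => ?_
  rw [Pi.smul_apply, smul_eq_mul]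
  have : (fun k => if j = k then (1 : MvPolynomial σ K) else 0) = Pi.single j 1 := by
    funext k
    simp [Pi.single_apply, eq_comm]
  rw [this]

/-- Together with `homogeneousPart_map`, this identifies the degree `a` component of a graded map
with its scalar matrix on basis elements of degree at most `a`; exactness passes through it in both
directions. -/
theorem map_homogeneousLift (hc : ∀ j i, D (Pi.single j 1) i = monomial (t j - s i) (c i j))
    (hlt : ∀ j i, c i j ≠ 0 → s i < t j) (a : σ →₀ ℕ) (x : Fin n → K)
    (hx : ∀ j, x j ≠ 0 → t j ≤ a) :
    D (homogeneousLift t a x) = homogeneousLift s a (c.mulVec x) := by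
  funext i
  rw [map_apply_eq_sum, homogeneousLift, Matrix.mulVec, dotProduct, map_sum]
  refine Finset.sum_congr rfl fun j _ => ?_
  rw [hc, homogeneousLift, monomial_mul]
  by_cases h1 : c i j = 0
  · simp [h1]
  by_cases h2 : x j = 0
  · simp [h2]
  rw [tsub_add_tsub_cancel (hx j h2) (hlt j i h1).le, mul_comm]

theorem homogeneousPart_map (hc : ∀ j i, D (Pi.single j 1) i = monomial (t j - s i) (c i j))
    (hlt : ∀ j i, c i j ≠ 0 → s i < t j) (a : σ →₀ ℕ) (y : Fin n → MvPolynomial σ K) :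
    homogeneousPart s a (D y) = c.mulVec (homogeneousPart t a y) := by
  classical
  funext i
  rw [Matrix.mulVec, dotProduct]
  by_cases hi : s i ≤ a
  · rw [homogeneousPart, if_pos hi, map_apply_eq_sum, coeff_sum]
    refine Finset.sum_congr rfl fun j _ => ?_
    rw [hc, coeff_mul_monomial']
    by_cases h1 : c i j = 0
    · simp [h1]
    have hij := (hlt j i h1).le
    have hiff : t j - s i ≤ a - s i ↔ t j ≤ a := by
      rw [tsub_le_tsub_iff_right hi]
    by_cases hj : t j ≤ a
    · rw [if_pos (hiff.mpr hj), homogeneousPart, if_pos hj, mul_comm,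
        tsub_tsub_tsub_cancel_right hij]
    · rw [if_neg fun h => hj (hiff.mp h), homogeneousPart, if_neg hj, mul_zero]
  · rw [homogeneousPart, if_neg hi, eq_comm]
    refine Finset.sum_eq_zero fun j _ => ?_
    by_cases h1 : c i j = 0
    · simp [h1]
    · rw [homogeneousPart, if_neg fun h => hi ((hlt j i h1).le.trans h), mul_zero]

theorem homogeneousLift_injective {a : σ →₀ ℕ} {x : Fin n → K}
    (h : homogeneousLift t a x = 0) : x = 0 := by
  funext j
  have := congrFun h j
  simpa [homogeneousLift] using this

end Matrix

namespace MinimalFreeResolution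

variable {I : Ideal (MvPolynomial σ K)} (F : MinimalFreeResolution I)

/-- The ranks in the augmented resolution of `S / I`. -/
def augRank : ℕ → ℕ
  | 0 => 1
  | k + 1 => F.rank k

/-- The degrees in the augmented resolution of `S / I`. -/
noncomputable def augShift : (k : ℕ) → Fin (F.augRank k) → (σ →₀ ℕ)
  | 0 => fun _ => 0
  | k + 1 => F.shift k

/-- The differentials of the augmented resolution of `S / I`. -/
noncomputable def augD : (k : ℕ) → (Fin (F.augRank (k + 1)) → MvPolynomial σ K) →ₗ[MvPolynomial σ K]
    (Fin (F.augRank k) → MvPolynomial σ K)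
  | 0 => LinearMap.pi fun _ => F.aug
  | k + 1 => F.d k

theorem aug_mem (y : Fin (F.rank 0) → MvPolynomial σ K) : F.aug y ∈ I := by
  have h : F.aug y ∈ LinearMap.range F.aug := ⟨y, rfl⟩
  rwa [F.range_aug] at h

theorem augD_graded (k : ℕ) (j : Fin (F.augRank (k + 1))) (i : Fin (F.augRank k)) : ∃ c : K,
    monomial (F.augShift k i) (1 : K) * F.augD k (Pi.single j 1) i =
      monomial (F.augShift (k + 1) j) c := by
  match k with
  | 0 =>
    obtain ⟨c, hc⟩ := F.aug_graded j
    exact ⟨c, (one_mul _).trans hc⟩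
  | k + 1 => exact F.d_graded k j i

theorem augD_exact (k : ℕ) : Function.Exact (F.augD (k + 1)) (F.augD k) := by
  match k with
  | 0 =>
    intro x
    refine Iff.trans ?_ (F.exact_zero x)
    exact ⟨fun h => congrFun h (0 : Fin 1), fun h => funext fun _ => h⟩
  | k + 1 => exact F.exact_succ k

/-- For the differentials of `F` this is minimality; for the augmentation, a nonzero constant entry
would place 1 in `I`. -/
theorem augD_minimal (hI : monomial 0 (1 : K) ∉ I) (k : ℕ) (j : Fin (F.augRank (k + 1)))
    (i : Fin (F.augRank k)) (h : F.augShift k i = F.augShift (k + 1) j) :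
    coeff 0 (F.augD k (Pi.single j 1) i) = 0 := by
  classical
  match k with
  | 0 =>
    obtain ⟨c, hc⟩ := F.aug_graded j
    change coeff 0 (F.aug (Pi.single j 1)) = 0
    replace h : 0 = F.shift 0 j := h
    rw [hc, ← h, coeff_monomial, if_pos rfl]
    by_contra h0
    apply hI
    have hmem := F.aug_mem (Pi.single j 1)
    have := I.mul_mem_left (C c⁻¹) hmem
    rwa [hc, ← h, C_mul_monomial, inv_mul_cancel₀ h0] at this
  | k + 1 =>
    have := F.minimal k (Pi.single j 1) i
    rw [← MvPolynomial.constantCoeff_eq]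
    change F.d k (Pi.single j 1) i ∈ _ at this
    suffices h : Ideal.span (Set.range (X : σ → MvPolynomial σ K)) ≤
        RingHom.ker (constantCoeff : MvPolynomial σ K →+* K) from h this
    rw [Ideal.span_le]
    rintro _ ⟨v, rfl⟩
    simp

theorem exists_scalarComplex (hI : monomial 0 (1 : K) ∉ I) :
    ∃ C : ScalarComplex K {a | monomial a (1 : K) ∈ I},
      ∀ k a, (∃ j, C.deg (k + 1) j = a) ↔ ∃ j, F.shift k j = a := by
  choose c hc hlt using fun k => exists_scalar_of_graded (F.augD_graded k) (F.augD_minimal hI k)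
  let M : (k : ℕ) → Matrix (Fin (F.augRank k)) (Fin (F.augRank (k + 1))) K := fun k i j => c k j i
  have hM : ∀ k j i, F.augD k (Pi.single j 1) i =
    monomial (F.augShift (k + 1) j - F.augShift k i) (M k i j) := hc
  have hM' : ∀ k j i, M k i j ≠ 0 → F.augShift k i < F.augShift (k + 1) j := hlt
  have hsupp : ∀ k a x, (∀ j, x j ≠ 0 → F.augShift (k + 1) j ≤ a) →
      ∀ i, (M k).mulVec x i ≠ 0 → F.augShift k i ≤ a := by
    intro k a x hx i hi
    obtain ⟨j, -, hj⟩ := Finset.exists_ne_zero_of_sum_ne_zero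
      (show ∑ j, M k i j * x j ≠ 0 from hi)
    exact (hM' k j i (left_ne_zero_of_mul hj)).le.trans (hx j (right_ne_zero_of_mul hj))
  refine ⟨
    { rk := F.augRank
      deg := F.augShift
      bd := fun k => (M k).mulVecLin
      rk_zero := rfl
      deg_zero := fun _ => rfl
      deg_lt := ?_
      mem_of_bd := ?_
      bd_bd := ?_
      exact := ?_
      exact_zero := ?_ }, fun k a => Iff.rfl⟩
  · intro k j i h
    rw [Matrix.mulVecLin_apply, Matrix.mulVec_single_one] at h
    exact hM' k j i h
  · intro j i h
    rw [Matrix.mulVecLin_apply, Matrix.mulVec_single_one] at h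
    replace h : M 0 i j ≠ 0 := h
    have h1 : F.aug (Pi.single j 1) = monomial (F.shift 0 j - 0) (M 0 i j) := hM 0 j i
    have hmem := F.aug_mem (Pi.single j 1)
    have := I.mul_mem_left (C (M 0 i j)⁻¹) hmem
    rwa [h1, C_mul_monomial, inv_mul_cancel₀ h, tsub_zero] at this
  · intro k x
    simp only [Matrix.mulVecLin_apply]
    -- The sum of all the degrees bounds each of them, so every chain lives in one common strand.
    have hx : ∀ j, x j ≠ 0 → F.augShift (k + 2) j ≤ ∑ j, F.augShift (k + 2) j := fun j _ =>
      Finset.single_le_sum (f := F.augShift (k + 2)) (fun _ _ => zero_le) (Finset.mem_univ j)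
    apply homogeneousLift_injective (t := F.augShift k) (a := ∑ j, F.augShift (k + 2) j)
    rw [← map_homogeneousLift (hM k) (hM' k) _ _ (hsupp _ _ _ hx),
      ← map_homogeneousLift (hM (k + 1)) (hM' (k + 1)) _ _ hx]
    exact (F.augD_exact k).apply_apply_eq_zero _
  · intro k a x hx h0
    have h1 : F.augD k (homogeneousLift (F.augShift (k + 1)) a x) = 0 := by
      rw [map_homogeneousLift (hM k) (hM' k) _ _ hx]
      rw [Matrix.mulVecLin_apply] at h0
      rw [h0]
      funext i
      simp [homogeneousLift]
    obtain ⟨y, hy⟩ := (F.augD_exact k _).mp h1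
    refine ⟨homogeneousPart (F.augShift (k + 2)) a y,
      fun j => le_of_homogeneousPart_ne_zero j, ?_⟩
    rw [Matrix.mulVecLin_apply, ← homogeneousPart_map (hM (k + 1)) (hM' (k + 1)), hy,
      homogeneousPart_lift _ _ _ hx]
  · intro a ha x
    have ha' : monomial a (1 : K) ∈ LinearMap.range F.aug := F.range_aug.symm ▸ ha
    obtain ⟨y, hy⟩ := ha'
    let z : Fin (F.augRank 1) → MvPolynomial σ K := (C (x (0 : Fin 1)) : MvPolynomial σ K) • y
    have h1 : F.augD 0 z = homogeneousLift (F.augShift 0) a x := by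
      funext i
      change F.aug ((C (x (0 : Fin 1)) : MvPolynomial σ K) • y) = _
      rw [map_smul, hy, smul_eq_mul, C_mul_monomial, mul_one, homogeneousLift]
      obtain rfl : i = (0 : Fin 1) := Subsingleton.elim (α := Fin 1) _ _
      rw [show F.augShift 0 (0 : Fin 1) = 0 from rfl, tsub_zero]
    refine ⟨homogeneousPart (F.augShift 1) a z,
      fun j => le_of_homogeneousPart_ne_zero j, ?_⟩
    rw [Matrix.mulVecLin_apply, ← homogeneousPart_map (hM 0) (hM' 0), h1,
      homogeneousPart_lift]
    exact fun j _ => zero_le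

end MinimalFreeResolution

end Scalars

/-! ### Acyclicity of strands and Mayer–Vietoris. -/

section Strands

variable {σ K : Type*} [Field K]

theorem degree_lt_degree {a b : σ →₀ ℕ} (h : a < b) : a.degree < b.degree := by
  have hd : b = a + (b - a) := (add_tsub_cancel_of_le h.le).symm
  have hne : b - a ≠ 0 := fun h0 => by
    rw [h0, add_zero] at hd
    exact h.ne hd.symm
  have := (Finsupp.degree_eq_zero_iff _).not.mpr hne
  rw [hd, map_add]
  omega

namespace ScalarComplex

variable {In : Set (σ →₀ ℕ)} (C : ScalarComplex K In)

/-- The chain `x` only involves basis elements with degree in `D`. -/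
def IsSupp (D : Set (σ →₀ ℕ)) (k : ℕ) (x : Fin (C.rk k) → K) : Prop :=
  ∀ j, x j ≠ 0 → C.deg k j ∈ D

/-- Cycles; all chains of degree `0` count as cycles. -/
def IsCycle : (k : ℕ) → (Fin (C.rk k) → K) → Prop
  | 0, _ => True
  | k + 1, x => C.bd k x = 0

/-- Every `k`-cycle supported in `D` is a boundary of a chain supported in `D`. -/
def Acyclic (D : Set (σ →₀ ℕ)) (k : ℕ) : Prop :=
  ∀ x, C.IsSupp D k x → C.IsCycle k x → ∃ y, C.IsSupp D (k + 1) y ∧ C.bd k y = x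

variable {C}

theorem bd_apply (k : ℕ) (x : Fin (C.rk (k + 1)) → K) (i : Fin (C.rk k)) :
    C.bd k x i = ∑ j, x j * C.bd k (Pi.single j 1) i := by
  conv_lhs => rw [LinearMap.pi_apply_eq_sum_univ (C.bd k) x]
  rw [Finset.sum_apply]
  refine Finset.sum_congr rfl fun j _ => ?_
  rw [Pi.smul_apply, smul_eq_mul]
  have : (fun k => if j = k then (1 : K) else 0) = Pi.single j 1 := by
    funext k
    simp [Pi.single_apply, eq_comm]
  rw [this]

theorem exists_deg_lt {k : ℕ} {x : Fin (C.rk (k + 1)) → K} {i : Fin (C.rk k)}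
    (h : C.bd k x i ≠ 0) : ∃ j, x j ≠ 0 ∧ C.deg k i < C.deg (k + 1) j := by
  rw [bd_apply] at h
  obtain ⟨j, -, hj⟩ := Finset.exists_ne_zero_of_sum_ne_zero h
  exact ⟨j, left_ne_zero_of_mul hj, C.deg_lt k j i (right_ne_zero_of_mul hj)⟩

theorem IsSupp.bd {D : Set (σ →₀ ℕ)} (hD : IsLowerSet D) {k : ℕ} {x : Fin (C.rk (k + 1)) → K}
    (hx : C.IsSupp D (k + 1) x) : C.IsSupp D k (C.bd k x) := by
  intro i hi
  obtain ⟨j, hj, hlt⟩ := exists_deg_lt hi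
  exact hD hlt.le (hx j hj)

theorem IsSupp.add {D : Set (σ →₀ ℕ)} {k : ℕ} {x y : Fin (C.rk k) → K}
    (hx : C.IsSupp D k x) (hy : C.IsSupp D k y) : C.IsSupp D k (x + y) := by
  intro j hj
  by_cases h : x j = 0
  · exact hy j fun h' => hj (by simp [h, h'])
  · exact hx j h

theorem IsSupp.neg {D : Set (σ →₀ ℕ)} {k : ℕ} {x : Fin (C.rk k) → K}
    (hx : C.IsSupp D k x) : C.IsSupp D k (-x) := fun j hj => hx j fun h => hj (by simp [h])

theorem IsSupp.mono {D E : Set (σ →₀ ℕ)} (h : D ⊆ E) {k : ℕ} {x : Fin (C.rk k) → K}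
    (hx : C.IsSupp D k x) : C.IsSupp E k x := fun j hj => h (hx j hj)

theorem isCycle_bd (k : ℕ) (x : Fin (C.rk (k + 1)) → K) : C.IsCycle k (C.bd k x) := by
  cases k with
  | zero => trivial
  | succ k => exact C.bd_bd k x

theorem IsSupp.exists_split {D E : Set (σ →₀ ℕ)} {k : ℕ} {x : Fin (C.rk k) → K}
    (hx : C.IsSupp (D ∪ E) k x) :
    ∃ y z, C.IsSupp D k y ∧ C.IsSupp E k z ∧ y + z = x := by
  classical
  refine ⟨fun j => if C.deg k j ∈ D then x j else 0, fun j => if C.deg k j ∈ D then 0 else x j,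
    fun j hj => ?_, fun j hj => ?_, ?_⟩
  · by_contra h; simp [h] at hj
  · have h : C.deg k j ∉ D := fun h => by simp [h] at hj
    exact (hx j (by simpa [h] using hj)).resolve_left h
  · funext j
    by_cases h : C.deg k j ∈ D <;> simp [h]

theorem acyclic_Iic (a : σ →₀ ℕ) (k : ℕ) (h : k = 0 → a ∈ In) : C.Acyclic (Set.Iic a) k := by
  intro x hx hc
  cases k with
  | zero => exact C.exact_zero a (h rfl) x
  | succ k => exact C.exact k a x hx hc

theorem acyclic_zero {D : Set (σ →₀ ℕ)} {a : σ →₀ ℕ} (ha : a ∈ In) (hD : Set.Iic a ⊆ D) :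
    C.Acyclic D 0 := by
  intro x _ _
  obtain ⟨y, hy, hb⟩ := C.exact_zero a ha x
  exact ⟨y, fun j hj => hD (hy j hj), hb⟩

/-- The Mayer–Vietoris argument. -/
theorem Acyclic.union {D E : Set (σ →₀ ℕ)} (hD : IsLowerSet D) (hE : IsLowerSet E) {k : ℕ}
    (h1 : C.Acyclic D k) (h2 : C.Acyclic E k) (h : ∀ m, k = m + 1 → C.Acyclic (D ∩ E) m) :
    C.Acyclic (D ∪ E) k := by
  intro x hx hc
  obtain ⟨y, z, hy, hz, rfl⟩ := hx.exists_split
  obtain ⟨y', z', hy', hz', hcy, hcz, hsum⟩ : ∃ y' z', C.IsSupp D k y' ∧ C.IsSupp E k z' ∧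
      C.IsCycle k y' ∧ C.IsCycle k z' ∧ y' + z' = y + z := by
    cases k with
    | zero => exact ⟨y, z, hy, hz, trivial, trivial, rfl⟩
    | succ m =>
      have hc' : C.bd m y + C.bd m z = 0 := by rw [← map_add]; exact hc
      have hs : C.IsSupp (D ∩ E) m (C.bd m y) := fun j hj =>
        ⟨hy.bd hD j hj, (hz.bd hE).neg j (by rwa [← eq_neg_of_add_eq_zero_left hc'])⟩
      -- The boundary of `y` is minus that of `z`, so it is supported in both sets. Filling it by
      -- `w` in the intersection corrects `y` and `z` to cycles with the same sum.
      obtain ⟨w, hw, hbw⟩ := h m rfl _ hs (isCycle_bd m y)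
      refine ⟨y + -w, z + w, hy.add (hw.mono Set.inter_subset_left).neg,
        hz.add (hw.mono Set.inter_subset_right), ?_, ?_, by abel⟩
      · change C.bd m (y + -w) = 0
        rw [map_add, map_neg, hbw, add_neg_cancel]
      · change C.bd m (z + w) = 0
        rw [map_add, hbw, add_comm, hc']
  obtain ⟨u, hu, hbu⟩ := h1 y' hy' hcy
  obtain ⟨v, hv, hbv⟩ := h2 z' hz' hcz
  exact ⟨u + v, (hu.mono Set.subset_union_left).add (hv.mono Set.subset_union_right),
    by rw [map_add, hbu, hbv, hsum]⟩

/-- A basis element that is a cycle would be a boundary within the strand of its own degree, but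
differentials strictly lower degrees. -/
theorem bd_single_ne_zero (k : ℕ) (j : Fin (C.rk (k + 1))) : C.bd k (Pi.single j 1) ≠ 0 := by
  intro h
  obtain ⟨y, hy, hb⟩ := C.exact k (C.deg (k + 1) j) (Pi.single j 1) (by
    intro i hi
    rw [Pi.single_apply] at hi
    obtain rfl : i = j := by
      by_contra hne
      simp [hne] at hi
    exact le_rfl) h
  obtain ⟨i, hi, hlt⟩ := exists_deg_lt (C := C) (k := k + 1) (x := y) (i := j) (by simp [hb])
  exact (hlt.trans_le (hy i hi)).false

theorem exists_deg_lt_succ (k : ℕ) (j : Fin (C.rk (k + 1))) :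
    ∃ i, C.bd k (Pi.single j 1) i ≠ 0 := by
  by_contra! h
  exact bd_single_ne_zero k j (funext h)

theorem deg_mem (hIn : IsUpperSet In) (k : ℕ) (j : Fin (C.rk (k + 1))) : C.deg (k + 1) j ∈ In := by
  induction k with
  | zero =>
    obtain ⟨i, hi⟩ := exists_deg_lt_succ 0 j
    exact C.mem_of_bd j i hi
  | succ k ih =>
    obtain ⟨i, hi⟩ := exists_deg_lt_succ (k + 1) j
    exact hIn (C.deg_lt _ j i hi).le (ih i)

/-- Basis elements in positive homological degree have degrees in `In`, so `E` contributes none. -/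
theorem Acyclic.union_of_disjoint (hIn : IsUpperSet In) {D E : Set (σ →₀ ℕ)} {k : ℕ}
    (h : C.Acyclic D (k + 1)) (hE : Disjoint E In) : C.Acyclic (D ∪ E) (k + 1) := by
  intro x hx hc
  have hx' : C.IsSupp D (k + 1) x := fun j hj =>
    (hx j hj).resolve_right fun h' => Set.disjoint_left.mp hE h' (deg_mem hIn k j)
  obtain ⟨y, hy, hb⟩ := h x hx' hc
  exact ⟨y, hy.mono Set.subset_union_left, hb⟩

/-- If the boundary of a basis element of degree `a` were filled strictly below `a`, subtracting the
filling would give a cycle with coefficient 1 at that element. Such a cycle is not a boundary in the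
strand at `a`, where nothing has degree larger than `a`. -/
theorem Acyclic.deg_ne {a : σ →₀ ℕ} {k : ℕ} (h : C.Acyclic (Set.Iio a) k)
    (j : Fin (C.rk (k + 1))) : C.deg (k + 1) j ≠ a := by
  rintro rfl
  obtain ⟨y, hy, hb⟩ := h (C.bd k (Pi.single j 1)) (fun i hi => C.deg_lt k j i hi) (isCycle_bd _ _)
  have hyj : y j = 0 := by
    by_contra h0
    exact lt_irrefl _ (Set.mem_Iio.mp (hy j h0))
  obtain ⟨w, hw, hbw⟩ := C.exact k (C.deg (k + 1) j) (Pi.single j 1 - y) (by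
    intro i hi
    by_cases hij : i = j
    · rw [hij]
    · have : y i ≠ 0 := by simpa [Pi.single_apply, hij] using hi
      exact (hy i this).le) (by rw [map_sub, hb, sub_self])
  obtain ⟨i, hi, hlt⟩ := exists_deg_lt (C := C) (k := k + 1) (x := w) (i := j)
    (by simp [hbw, hyj])
  exact (hlt.trans_le (hw i hi)).false

theorem le_degree (hIn : ∀ a ∈ In, 2 ≤ a.degree) (k : ℕ) (j : Fin (C.rk (k + 1))) :
    k + 2 ≤ (C.deg (k + 1) j).degree := by
  induction k with
  | zero =>
    obtain ⟨i, hi⟩ := exists_deg_lt_succ 0 j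
    exact hIn _ (C.mem_of_bd j i hi)
  | succ k ih =>
    obtain ⟨i, hi⟩ := exists_deg_lt_succ (k + 1) j
    have hlt := C.deg_lt _ j i hi
    exact (Nat.succ_le_succ (ih i)).trans (degree_lt_degree hlt)

end ScalarComplex

end Strands

/-! ### Linearity of the resolution of the edge ideal, along simplicial vertices. -/

section Linearity

set_option linter.unusedSectionVars false

variable {V : Type*} [DecidableEq V]

/-- The exponent of a squarefree monomial. -/
noncomputable def ind (W : Finset V) : V →₀ ℕ := Finsupp.indicator W fun _ _ => 1

theorem ind_apply (W : Finset V) (v : V) : ind W v = if v ∈ W then 1 else 0 := by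
  by_cases h : v ∈ W <;> simp [ind, h]

theorem ind_le_ind {W X : Finset V} : ind W ≤ ind X ↔ W ⊆ X := by
  refine ⟨fun h v hv => ?_, fun h v => ?_⟩
  · have := h v
    simp only [ind_apply, hv, if_true] at this
    by_contra hX
    simp [hX] at this
  · simp only [ind_apply]
    by_cases hv : v ∈ W
    · simp [hv, h hv]
    · simp [hv]

theorem ind_injective : Function.Injective (ind : Finset V → V →₀ ℕ) := fun _ _ h =>
  (ind_le_ind.mp h.le).antisymm (ind_le_ind.mp h.ge)

theorem ind_lt_ind {W X : Finset V} : ind W < ind X ↔ W ⊂ X := by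
  rw [lt_iff_le_not_ge, ind_le_ind, ind_le_ind]; rfl

theorem le_ind_inter {a : V →₀ ℕ} {W X : Finset V} :
    a ≤ ind (W ∩ X) ↔ a ≤ ind W ∧ a ≤ ind X := by
  constructor
  · exact fun h => ⟨h.trans (ind_le_ind.mpr Finset.inter_subset_left),
      h.trans (ind_le_ind.mpr Finset.inter_subset_right)⟩
  · rintro ⟨h1, h2⟩ v
    have h1 := h1 v
    have h2 := h2 v
    simp only [ind_apply, Finset.mem_inter] at *
    split_ifs at * <;> simp_all

theorem support_ind (W : Finset V) : (ind W).support = W := by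
  ext v; simp [ind_apply]

theorem degree_ind (W : Finset V) : (ind W).degree = W.card := by
  rw [Finsupp.degree_apply, support_ind, Finset.sum_congr rfl fun v hv => by rw [ind_apply, if_pos hv],
    Finset.sum_const, smul_eq_mul, mul_one]

theorem exists_eq_ind {a : V →₀ ℕ} (h : ∀ v, a v ≤ 1) : ∃ W, a = ind W := by
  refine ⟨a.support, Finsupp.ext fun v => ?_⟩
  rw [ind_apply]
  have := h v
  by_cases h0 : a v = 0
  · simp [h0]
  · simp [h0]; omega

variable (H : SimpleGraph V)

/-- The exponents of the monomials divisible by `x_u x_v` for distinct vertices `u` and `v` that are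
not adjacent. -/
def nonadjacentExponents : Set (V →₀ ℕ) :=
  {a | ∃ u v, u ≠ v ∧ ¬ H.Adj u v ∧ a u ≠ 0 ∧ a v ≠ 0}

variable {H}

theorem isUpperSet_nonadjacentExponents : IsUpperSet (nonadjacentExponents H) := by
  rintro a b hab ⟨u, v, hne, hadj, hu, hv⟩
  have := hab u
  have := hab v
  exact ⟨u, v, hne, hadj, by omega, by omega⟩

theorem ind_mem_nonadjacentExponents {W : Finset V} :
    ind W ∈ nonadjacentExponents H ↔ ¬ IsCliqueOn H W := by
  simp only [nonadjacentExponents, Set.mem_ofPred_eq, ind_apply, IsCliqueOn]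
  push Not
  constructor
  · rintro ⟨u, v, hne, hadj, hu, hv⟩
    exact ⟨u, by simpa using hu, v, by simpa using hv, hne, hadj⟩
  · rintro ⟨u, hu, v, hv, hne, hadj⟩
    exact ⟨u, v, hne, hadj, by simpa using hu, by simpa using hv⟩

theorem two_le_degree {a : V →₀ ℕ} (ha : a ∈ nonadjacentExponents H) : 2 ≤ a.degree := by
  obtain ⟨u, v, hne, -, hu, hv⟩ := ha
  have h : ind {u, v} ≤ a := by
    intro w
    rw [ind_apply]
    split_ifs with hw
    · rw [Finset.mem_insert, Finset.mem_singleton] at hw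
      rcases hw with rfl | rfl <;> omega
    · exact Nat.zero_le _
  have := Finsupp.degree_mono h
  rwa [degree_ind, Finset.card_pair hne] at this

/-- The union of the facets `X \ {v}`, `v ∈ R`, of the simplex on `X`. -/
def facets (X R : Finset V) : Set (V →₀ ℕ) := {a | ∃ v ∈ R, a ≤ ind (X.erase v)}

theorem isLowerSet_facets (X R : Finset V) : IsLowerSet (facets X R) :=
  fun _ _ hba ⟨v, hv, h⟩ => ⟨v, hv, hba.trans h⟩

theorem facets_singleton (X : Finset V) (v : V) : facets X {v} = Set.Iic (ind (X.erase v)) := by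
  ext a; simp [facets]

theorem facets_insert (X R : Finset V) (v : V) :
    facets X (insert v R) = facets X R ∪ Set.Iic (ind (X.erase v)) := by
  ext a; simp [facets, or_comm]

theorem facets_inter (X R : Finset V) (v : V) :
    facets X R ∩ Set.Iic (ind (X.erase v)) = facets (X.erase v) R := by
  ext a
  have h : ∀ u, (X.erase v).erase u = X.erase u ∩ X.erase v := fun u => by
    ext w; simp only [Finset.mem_erase, Finset.mem_inter]; tauto
  simp only [facets, Set.mem_inter_iff, Set.mem_ofPred_eq, Set.mem_Iic, h, le_ind_inter]
  tauto

theorem disjoint_Iic_nonadjacentExponents {X : Finset V} (h : IsCliqueOn H X) :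
    Disjoint (Set.Iic (ind X)) (nonadjacentExponents H) := by
  rw [Set.disjoint_left]
  exact fun a ha haI =>
    (ind_mem_nonadjacentExponents.mp (isUpperSet_nonadjacentExponents ha haI)) h

variable {K : Type*} [Field K] {C : ScalarComplex K (nonadjacentExponents H)}

theorem IsCliqueOn.subset {X Y : Finset V} (h : IsCliqueOn H Y) (hXY : X ⊆ Y) : IsCliqueOn H X :=
  fun x hx y hy => h x (hXY hx) y (hXY hy)

theorem acyclic_facets_insert {X R : Finset V} {v : V} {k : ℕ}
    (h : C.Acyclic (facets X R) k) (hv : k = 0 → ¬ IsCliqueOn H (X.erase v))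
    (hi : ∀ m, k = m + 1 → C.Acyclic (facets (X.erase v) R) m) :
    C.Acyclic (facets X (insert v R)) k := by
  rw [facets_insert]
  refine h.union (isLowerSet_facets X R) (isLowerSet_Iic _)
    (ScalarComplex.acyclic_Iic _ k fun e => ind_mem_nonadjacentExponents.mpr (hv e)) ?_
  rw [facets_inter]
  exact hi

/-- Every intersection of these facets still contains the non-clique `X \ R`, so each piece of the
Mayer–Vietoris induction is an exact strand. -/
theorem acyclic_facets_of_not_isCliqueOn {R : Finset V} (hR : R.Nonempty) {X : Finset V} {k : ℕ}
    (h : ¬ IsCliqueOn H (X \ R)) : C.Acyclic (facets X R) k := by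
  induction hR using Finset.Nonempty.cons_induction generalizing X k with
  | singleton v =>
    rw [facets_singleton]
    refine ScalarComplex.acyclic_Iic _ _ fun _ => ind_mem_nonadjacentExponents.mpr ?_
    rwa [Finset.sdiff_singleton_eq_erase] at h
  | cons v R hv hR ih =>
    rw [Finset.cons_eq_insert] at h ⊢
    have h1 : X \ insert v R ⊆ X \ R := Finset.sdiff_subset_sdiff le_rfl (Finset.subset_insert _ _)
    have h2 : X.erase v \ R = X \ insert v R := by
      ext w; simp only [Finset.mem_sdiff, Finset.mem_erase, Finset.mem_insert]; tauto
    refine acyclic_facets_insert (ih fun hc => h (hc.subset h1))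
      (fun _ hc => h (hc.subset ?_)) fun m _ => ih (h2 ▸ h)
    rw [← h2]; exact Finset.sdiff_subset

/-- Before `v` is added to `R`, both `z` and its non-neighbour `v` survive in `X \ R`, so the
earlier facets have an acyclic union in every degree. Intersecting with the new facet lowers both
the homological degree and the number of removed vertices by one, which explains the bound. -/
theorem acyclic_facets_of_not_adj {R X : Finset V} {z : V} {k : ℕ} (hRX : R ⊆ X) (hz : z ∈ X)
    (hzR : z ∉ R) (h : ∀ u ∈ R, ¬ H.Adj z u) (hk : k + 1 < R.card) :
    C.Acyclic (facets X R) k := by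
  induction R using Finset.induction_on generalizing X k with
  | empty => simp at hk
  | insert v R hv ih =>
    rw [Finset.card_insert_of_notMem hv] at hk
    have hvz : z ≠ v := fun e => hzR (by simp [e])
    have hzR' : z ∉ R := fun e => hzR (Finset.mem_insert_of_mem e)
    have hvX := hRX (Finset.mem_insert_self v R)
    have hRX' : R ⊆ X := fun u hu => hRX (Finset.mem_insert_of_mem hu)
    have h' : ∀ u ∈ R, ¬ H.Adj z u := fun u hu => h u (Finset.mem_insert_of_mem hu)
    have hRne : R.Nonempty := Finset.card_pos.mp (by omega)
    refine acyclic_facets_insert ?_ ?_ ?_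
    · refine acyclic_facets_of_not_isCliqueOn hRne fun hc => ?_
      exact h v (Finset.mem_insert_self v R)
        (hc z (by simp [hz, hzR']) v (by simp [hvX, hv]) hvz)
    · rintro - hc
      obtain ⟨u, hu⟩ := hRne
      refine h' u hu (hc z (by simp [hz, hvz]) u ?_ fun e => hzR' (e ▸ hu))
      exact Finset.mem_erase.mpr ⟨fun e => hv (e ▸ hu), hRX' hu⟩
    · rintro m rfl
      refine ih ?_ (by simp [hz, hvz]) hzR' h' (by omega)
      exact fun u hu => Finset.mem_erase.mpr ⟨fun e => hv (e ▸ hu), hRX' hu⟩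

theorem IsSimplicialIn.subset {X Y : Finset V} {z : V} (h : IsSimplicialIn H Y z) (hXY : X ⊆ Y)
    (hz : z ∈ X) : IsSimplicialIn H X z :=
  ⟨hz, fun x hx y hy => h.2 x (hXY hx) y (hXY hy)⟩

/-- Start with the facet omitting `u` and add the others one at a time. A facet on a clique carries
no basis elements in positive homological degree; for any other, the intersection is handled by
induction. -/
theorem acyclic_facets_of_adj {R X : Finset V} {z u : V} {k : ℕ} (hRX : R ⊆ X)
    (hz : IsSimplicialIn H X z) (hzR : z ∉ R) (huR : u ∈ R) (h : H.Adj z u) :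
    C.Acyclic (facets X R) (k + 1) := by
  obtain ⟨T, hT, rfl⟩ : ∃ T, u ∉ T ∧ R = insert u T :=
    ⟨R.erase u, by simp, (Finset.insert_erase huR).symm⟩
  induction T using Finset.induction_on generalizing X k with
  | empty =>
    rw [LawfulSingleton.insert_empty_eq, facets_singleton]
    exact ScalarComplex.acyclic_Iic _ _ (by simp)
  | insert v T hv ih =>
    rw [Finset.insert_comm] at *
    have huv : u ≠ v := fun e => hT (by simp [e])
    have hvR : v ∉ insert u T := by simp [hv, huv.symm]
    have hvz : z ≠ v := fun e => hzR (by simp [e])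
    have hzR' : z ∉ insert u T := fun e => hzR (Finset.mem_insert_of_mem e)
    have huT : u ∉ T := fun e => hT (Finset.mem_insert_of_mem e)
    have hRX' : insert u T ⊆ X := fun w hw => hRX (Finset.mem_insert_of_mem hw)
    have hRX'' : insert u T ⊆ X.erase v := fun w hw =>
      Finset.mem_erase.mpr ⟨fun e => hvR (e ▸ hw), hRX' hw⟩
    have hz' : IsSimplicialIn H (X.erase v) z :=
      hz.subset (Finset.erase_subset _ _) (by simp [hz.1, hvz])
    have huX : u ∈ X.erase v := hRX'' (by simp)
    have main : C.Acyclic (facets X (insert u T)) (k + 1) := ih hz huT hRX' hzR' (by simp)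
    by_cases hc : IsCliqueOn H (X.erase v)
    · rw [facets_insert]
      exact main.union_of_disjoint isUpperSet_nonadjacentExponents
        (disjoint_Iic_nonadjacentExponents hc)
    refine acyclic_facets_insert main (by simp) ?_
    intro m hm
    obtain rfl : k = m := by omega
    cases k with
    | succ k => exact ih hz' huT hRX'' hzR' (by simp)
    | zero =>
      -- If removing `u` left a clique, then `u`, being adjacent to the simplicial vertex `z`, would
      -- be adjacent to every other vertex of `X.erase v`, making that set a clique.
      have hc' : ¬ IsCliqueOn H ((X.erase v).erase u) := by
        intro hcl
        apply hc
        have key : ∀ y ∈ X.erase v, y ≠ u → H.Adj u y := by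
          intro y hy hyu
          by_cases hyz : y = z
          · rw [hyz]; exact h.symm
          · exact hz'.2 u huX y hy h (hcl z (by simp [hz.1, hvz, h.ne]) y
              (Finset.mem_erase.mpr ⟨hyu, hy⟩) (Ne.symm hyz)) hyu.symm
        intro x hx y hy hxy
        by_cases hxu : x = u
        · rw [hxu]; exact key y hy fun e => hxy (hxu.trans e.symm)
        by_cases hyu : y = u
        · rw [hyu]; exact (key x hx hxu).symm
        · exact hcl x (Finset.mem_erase.mpr ⟨hxu, hx⟩) y (Finset.mem_erase.mpr ⟨hyu, hy⟩) hxy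
      exact ScalarComplex.acyclic_zero (ind_mem_nonadjacentExponents.mpr hc')
        fun a ha => ⟨u, by simp, ha⟩

/-- This is the vanishing behind linearity. For a simplicial `z`, the facets containing `z` have an
acyclic union, whether or not `z` has a neighbour in `W`. The facet omitting `z` is added last, its
intersection with the rest being the boundary of a smaller simplex. -/
theorem acyclic_facets_self (hH : HasSimplicialVertices H) {W : Finset V} {k : ℕ}
    (hW : ¬ IsCliqueOn H W) (hk : k + 2 < W.card) : C.Acyclic (facets W W) k := by
  induction k generalizing W with
  | zero =>
    have : ∃ v ∈ W, ¬ IsCliqueOn H (W.erase v) := by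
      unfold IsCliqueOn at hW
      push Not at hW
      obtain ⟨x, hx, y, hy, hxy, hadj⟩ := hW
      obtain ⟨v, hv⟩ : ((W.erase x).erase y).Nonempty := by
        apply Finset.card_pos.mp
        rw [Finset.card_erase_of_mem (by simp [hy, hxy.symm]), Finset.card_erase_of_mem hx]
        omega
      simp only [Finset.mem_erase] at hv
      exact ⟨v, hv.2.2, fun hc => hadj (hc x (by simp [hx, hv.2.1.symm]) y
        (by simp [hy, hv.1.symm]) hxy)⟩
    obtain ⟨v, hv, hc⟩ := this
    exact ScalarComplex.acyclic_zero (ind_mem_nonadjacentExponents.mpr hc) fun a ha => ⟨v, hv, ha⟩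
  | succ k ih =>
    obtain ⟨z, hz⟩ := hH W (Finset.card_pos.mp (by omega))
    have hcard := Finset.card_erase_of_mem hz.1
    have main : C.Acyclic (facets W (W.erase z)) (k + 1) := by
      by_cases h : ∃ u ∈ W, H.Adj z u
      · obtain ⟨u, hu, hzu⟩ := h
        exact acyclic_facets_of_adj (Finset.erase_subset _ _) hz (by simp)
          (Finset.mem_erase.mpr ⟨hzu.ne', hu⟩) hzu
      · push Not at h
        exact acyclic_facets_of_not_adj (Finset.erase_subset _ _) hz.1 (by simp)
          (fun u hu => h u (Finset.mem_of_mem_erase hu)) (by omega)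
    nth_rewrite 2 [← Finset.insert_erase hz.1]
    by_cases hc : IsCliqueOn H (W.erase z)
    · rw [facets_insert]
      exact main.union_of_disjoint isUpperSet_nonadjacentExponents
        (disjoint_Iic_nonadjacentExponents hc)
    · refine acyclic_facets_insert main (by simp) fun m hm => ?_
      obtain rfl : k = m := by omega
      exact ih hc (by omega)

theorem Iio_ind (W : Finset V) : Set.Iio (ind W) = facets W W := by
  ext a
  constructor
  · intro ha
    have ha' : a < ind W := ha
    obtain ⟨X, rfl⟩ := exists_eq_ind (a := a) fun v => (ha'.le v).trans (by
      rw [ind_apply]; split_ifs <;> simp)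
    obtain ⟨v, hv, hvX⟩ := Finset.exists_of_ssubset (ind_lt_ind.mp ha')
    exact ⟨v, hv, ind_le_ind.mpr fun x hx =>
      Finset.mem_erase.mpr ⟨fun e => hvX (e ▸ hx), ind_le_ind.mp ha'.le hx⟩⟩
  · rintro ⟨v, hv, h⟩
    exact lt_of_le_of_lt h (ind_lt_ind.mpr (Finset.erase_ssubset hv))

/-- The shifts of the resolution of the edge ideal are squarefree. -/
theorem exists_deg_eq_ind (k : ℕ) (j : Fin (C.rk k)) : ∃ W, C.deg k j = ind W := by
  suffices h : ∀ n k j, (C.deg k j).degree = n → ∃ W, C.deg k j = ind W from h _ k j rfl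
  intro n
  induction n using Nat.strong_induction_on with
  | _ n ih =>
    rintro (_ | k) j rfl
    · exact ⟨∅, by rw [C.deg_zero]; ext v; simp [ind_apply]⟩
    by_contra hno
    obtain ⟨v, hv⟩ : ∃ v, 2 ≤ C.deg (k + 1) j v := by
      by_contra! h
      exact hno (exists_eq_ind fun v => Nat.le_of_lt_succ (h v))
    set a := C.deg (k + 1) j with ha
    set b := a - Finsupp.single v 1 with hb
    have hba : b < a := by
      refine lt_of_le_of_ne tsub_le_self fun e => ?_
      have := DFunLike.congr_fun e v
      simp only [hb, Finsupp.tsub_apply, Finsupp.single_eq_same] at this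
      omega
    -- By induction all smaller degrees that occur are squarefree, and `a v ≥ 2`, so lowering `a` by
    -- one at `v` does not exclude any of them. The strand strictly below `a` thus coincides with
    -- the exact strand at `b`.
    have hlow : ∀ m (i : Fin (C.rk m)), C.deg m i < a → C.deg m i ≤ b := by
      intro m i hi
      obtain ⟨W, hW⟩ := ih _ (degree_lt_degree hi) m i rfl
      intro w
      have h1 := hi.le w
      rw [hb, Finsupp.tsub_apply]
      by_cases hwv : w = v
      · subst hwv
        rw [hW, ind_apply, Finsupp.single_eq_same]
        split_ifs <;> omega
      · simpa [Finsupp.single_apply, Ne.symm hwv] using h1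
    have hac : C.Acyclic (Set.Iio a) k := by
      intro x hx hc
      have hbmem : b ∈ nonadjacentExponents H := by
        obtain ⟨u, w, hne, hadj, hu, hw⟩ :=
          ScalarComplex.deg_mem isUpperSet_nonadjacentExponents k j
        refine ⟨u, w, hne, hadj, ?_, ?_⟩
        · rw [hb, Finsupp.tsub_apply, Finsupp.single_apply]
          split_ifs with e
          · subst e; omega
          · simpa using hu
        · rw [hb, Finsupp.tsub_apply, Finsupp.single_apply]
          split_ifs with e
          · subst e; omega
          · simpa using hw
      obtain ⟨y, hy, hbd⟩ := ScalarComplex.acyclic_Iic b k (fun _ => hbmem) x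
        (fun i hi => hlow k i (hx i hi)) hc
      exact ⟨y, fun i hi => lt_of_le_of_lt (hy i hi) hba, hbd⟩
    exact hac.deg_ne j rfl

/-- The resolution of the edge ideal is linear. -/
theorem card_of_deg_eq_ind (hH : HasSimplicialVertices H) {k : ℕ} {j : Fin (C.rk (k + 1))}
    {W : Finset V} (h : C.deg (k + 1) j = ind W) : W.card = k + 2 := by
  have h1 := ScalarComplex.le_degree (C := C) (fun _ => two_le_degree) k j
  rw [h, degree_ind] at h1
  by_contra hne
  have hmem := ScalarComplex.deg_mem isUpperSet_nonadjacentExponents k j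
  rw [h, ind_mem_nonadjacentExponents] at hmem
  have hac : C.Acyclic (facets W W) k := acyclic_facets_self hH hmem (by omega)
  rw [← Iio_ind] at hac
  exact hac.deg_ne j h

end Linearity

/-! ### Detecting disconnectedness through an elimination ordering. -/

section Roots

set_option linter.unusedSectionVars false

variable {V : Type*} [DecidableEq V] {H : SimpleGraph V} {pos : V → ℕ}

/-- `pos` numbers the vertices along a perfect elimination ordering. -/
structure IsElimination (H : SimpleGraph V) (pos : V → ℕ) : Prop where
  injective : Function.Injective pos
  adj : ∀ z x y, H.Adj z x → H.Adj z y → pos z < pos x → pos z < pos y → x ≠ y → H.Adj x y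

theorem IsElimination.isSimplicialIn (h : IsElimination H pos) {X : Finset V} {z : V} (hz : z ∈ X)
    (hmin : ∀ x ∈ X, pos z ≤ pos x) : IsSimplicialIn H X z :=
  ⟨hz, fun x hx y hy hzx hzy => h.adj z x y hzx hzy
    ((hmin x hx).lt_of_ne fun e => hzx.ne (h.injective e))
    ((hmin y hy).lt_of_ne fun e => hzy.ne (h.injective e))⟩

theorem IsElimination.hasSimplicialVertices (h : IsElimination H pos) :
    HasSimplicialVertices H := fun X hX => by
  obtain ⟨z, hz, hmin⟩ := X.exists_min_image pos hX
  exact ⟨z, h.isSimplicialIn hz hmin⟩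

variable (H pos) in
/-- The vertices of `T` without a later neighbour in `T`. -/
noncomputable def roots (T : Finset V) : Finset V :=
  open Classical in T.filter fun v => ∀ w ∈ T, H.Adj v w → pos w < pos v

theorem mem_roots {T : Finset V} {v : V} :
    v ∈ roots H pos T ↔ v ∈ T ∧ ∀ w ∈ T, H.Adj v w → pos w < pos v := by
  simp [roots]

theorem roots_nonempty (h : IsElimination H pos) {T : Finset V} (hT : T.Nonempty) :
    (roots H pos T).Nonempty := by
  obtain ⟨z, hz, hmax⟩ := T.exists_max_image pos hT
  exact ⟨z, mem_roots.mpr ⟨hz, fun w hw hzw =>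
    (hmax w hw).lt_of_ne fun e => hzw.ne (h.injective e).symm⟩⟩

theorem InducesDisconnected.two_le_card_roots (h : IsElimination H pos) {T : Finset V}
    (hT : InducesDisconnected H T) : 2 ≤ (roots H pos T).card := by
  obtain ⟨A, B, hA, hB, hd, rfl, hn⟩ := hT
  obtain ⟨x, hx⟩ := roots_nonempty h hA
  obtain ⟨y, hy⟩ := roots_nonempty h hB
  rw [mem_roots] at hx hy
  have hxy : x ≠ y := fun e => Finset.disjoint_left.mp hd hx.1 (e ▸ hy.1)
  rw [← Finset.card_pair hxy]
  refine Finset.card_le_card fun z hz => ?_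
  rw [Finset.mem_insert, Finset.mem_singleton] at hz
  rcases hz with rfl | rfl
  · refine mem_roots.mpr ⟨Finset.mem_union_left _ hx.1, fun w hw hzw => ?_⟩
    exact (Finset.mem_union.mp hw).elim (fun hw => hx.2 w hw hzw) fun hw => absurd hzw (hn z hx.1 w hw)
  · refine mem_roots.mpr ⟨Finset.mem_union_right _ hy.1, fun w hw hzw => ?_⟩
    exact (Finset.mem_union.mp hw).elim (fun hw => absurd hzw.symm (hn w hw z hy.1))
      fun hw => hy.2 w hw hzw

/-- The first vertex of `T` is simplicial. If it is a root it has no neighbour in `T`; otherwise all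
roots survive its removal, and induction applies. -/
theorem inducesDisconnected_of_roots (h : IsElimination H pos) {T : Finset V}
    (hT : 2 ≤ (roots H pos T).card) : InducesDisconnected H T := by
  induction T using Finset.strongInduction with
  | H T ih =>
    obtain ⟨x, hx, y, hy, hxy⟩ := Finset.one_lt_card.mp hT
    have hxT := (mem_roots.mp hx).1
    have hyT := (mem_roots.mp hy).1
    obtain ⟨z, hz, hmin⟩ := T.exists_min_image pos ⟨x, hxT⟩
    have hs := h.isSimplicialIn hz hmin
    by_cases hr : z ∈ roots H pos T
    · have hiso : ∀ w ∈ T, ¬ H.Adj z w := fun w hw hzw =>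
        (hmin w hw).not_gt ((mem_roots.mp hr).2 w hw hzw)
      by_cases hxz : x = z
      · exact inducesDisconnected_of_isolated hz hyT (fun e => hxy (hxz.trans e.symm)) hiso
      · exact inducesDisconnected_of_isolated hz hxT hxz hiso
    · refine InducesDisconnected.of_erase hs (ih _ (Finset.erase_ssubset hz) ?_)
      refine hT.trans (Finset.card_le_card fun v hv => ?_)
      have hvz : v ≠ z := fun e => hr (e ▸ hv)
      rw [mem_roots] at hv ⊢
      exact ⟨Finset.mem_erase.mpr ⟨hvz, hv.1⟩, fun w hw => hv.2 w (Finset.mem_of_mem_erase hw)⟩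

/-- The sets with root `v` are `v` together with an arbitrary subset of `S`; the alternating sum
cancels unless `S` is empty. -/
theorem sum_neg_one_pow_mem_roots (U : Finset V) {v : V} (hv : v ∈ U)
    [Decidable (∀ w ∈ U, w ≠ v → H.Adj v w ∧ pos v ≤ pos w)] :
    ∑ T ∈ U.powerset, (-1 : ℤ) ^ T.card * (if v ∈ roots H pos T then 1 else 0) =
      if ∀ w ∈ U, w ≠ v → H.Adj v w ∧ pos v ≤ pos w then -1 else 0 := by
  classical
  set S := U.filter fun w => w ≠ v ∧ (H.Adj v w → pos w < pos v) with hS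
  have hvS : ∀ T ∈ S.powerset, v ∉ T := fun T hT h => by
    have := Finset.mem_powerset.mp hT h
    simp [hS] at this
  have himg : U.powerset.filter (fun T => v ∈ roots H pos T) = S.powerset.image (insert v) := by
    ext T
    simp only [Finset.mem_filter, Finset.mem_powerset, Finset.mem_image, mem_roots]
    constructor
    · rintro ⟨hTU, hvT, hr⟩
      refine ⟨T.erase v, fun w hw => ?_, Finset.insert_erase hvT⟩
      rw [Finset.mem_erase] at hw
      exact Finset.mem_filter.mpr ⟨hTU hw.2, hw.1, hr w hw.2⟩
    · rintro ⟨T', hT', rfl⟩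
      refine ⟨Finset.insert_subset hv fun w hw => (Finset.mem_filter.mp (hT' hw)).1,
        Finset.mem_insert_self _ _, fun w hw hvw => ?_⟩
      rcases Finset.mem_insert.mp hw with rfl | hw
      · exact absurd hvw (H.loopless.irrefl w)
      · exact (Finset.mem_filter.mp (hT' hw)).2.2 hvw
  have hinj : Set.InjOn (insert v) (S.powerset : Set (Finset V)) := by
    intro T hT T' hT' h
    rw [← Finset.erase_insert (hvS T hT), ← Finset.erase_insert (hvS T' hT'), h]
  simp only [mul_ite, mul_one, mul_zero]
  rw [← Finset.sum_filter, himg, Finset.sum_image hinj]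
  have : ∀ T ∈ S.powerset, (-1 : ℤ) ^ (insert v T).card = -(-1) ^ T.card := fun T hT => by
    rw [Finset.card_insert_of_notMem (hvS T hT), pow_succ]; ring
  rw [Finset.sum_congr rfl this, Finset.sum_neg_distrib, Finset.sum_powerset_neg_one_pow_card]
  have hiff : S = ∅ ↔ ∀ w ∈ U, w ≠ v → H.Adj v w ∧ pos v ≤ pos w := by
    rw [hS, Finset.filter_eq_empty_iff]
    refine forall₂_congr fun w _ => ?_
    rw [not_and, Classical.not_imp, not_lt]
  simp only [hiff]
  split_ifs <;> simp

/-- Such a vertex must be the first of `U`; its later neighbours are pairwise adjacent by the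
elimination property, so one exists exactly when `U` is a nonempty clique. -/
theorem card_filter_first (h : IsElimination H pos) (U : Finset V) [DecidablePred fun v =>
    ∀ w ∈ U, w ≠ v → H.Adj v w ∧ pos v ≤ pos w] [Decidable (IsCliqueOn H U)] :
    (U.filter fun v => ∀ w ∈ U, w ≠ v → H.Adj v w ∧ pos v ≤ pos w).card =
      if IsCliqueOn H U ∧ U ≠ ∅ then 1 else 0 := by
  split_ifs with hc
  · obtain ⟨z, hz, hmin⟩ := U.exists_min_image pos (Finset.nonempty_iff_ne_empty.mpr hc.2)
    rw [Finset.card_eq_one]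
    refine ⟨z, Finset.ext fun v => ?_⟩
    rw [Finset.mem_filter, Finset.mem_singleton]
    constructor
    · rintro ⟨hv, hvU⟩
      by_contra hvz
      exact hvz (h.injective ((hvU z hz (Ne.symm hvz)).2.antisymm (hmin v hv)))
    · rintro rfl
      exact ⟨hz, fun w hw hwv => ⟨hc.1 v hz w hw hwv.symm, hmin w hw⟩⟩
  · rw [Finset.card_eq_zero, Finset.filter_eq_empty_iff]
    intro v hv hvU
    refine hc ⟨?_, Finset.ne_empty_of_mem hv⟩
    have hlt : ∀ w ∈ U, w ≠ v → pos v < pos w := fun w hw hwv =>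
      (hvU w hw hwv).2.lt_of_ne fun e => hwv (h.injective e).symm
    intro x hx y hy hxy
    by_cases hxv : x = v
    · subst hxv; exact (hvU y hy hxy.symm).1
    by_cases hyv : y = v
    · subst hyv; exact (hvU x hx hxy).1.symm
    exact h.adj v x y (hvU x hx hxv).1 (hvU y hy hyv).1 (hlt x hx hxv) (hlt y hy hyv) hxy

theorem sum_neg_one_pow_card_roots (h : IsElimination H pos) (U : Finset V)
    [Decidable (IsCliqueOn H U)] :
    ∑ T ∈ U.powerset, (-1 : ℤ) ^ T.card * ((roots H pos T).card - 1) =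
      if IsCliqueOn H U then -1 else 0 := by
  classical
  have hcard : ∀ T ∈ U.powerset, (-1 : ℤ) ^ T.card * ((roots H pos T).card - 1) =
      (∑ v ∈ U, (-1 : ℤ) ^ T.card * if v ∈ roots H pos T then 1 else 0) - (-1) ^ T.card := by
    intro T hT
    rw [← Finset.mul_sum, Finset.sum_boole, mul_sub, mul_one]
    congr 4
    ext v
    rw [Finset.mem_filter, and_iff_right_of_imp]
    exact fun hv => Finset.mem_powerset.mp hT (mem_roots.mp hv).1
  rw [Finset.sum_congr rfl hcard, Finset.sum_sub_distrib, Finset.sum_comm,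
    Finset.sum_congr rfl fun v hv => sum_neg_one_pow_mem_roots U hv, Finset.sum_powerset_neg_one_pow_card]
  rw [← Finset.sum_filter, Finset.sum_const, card_filter_first h]
  by_cases hU : U = ∅
  · subst hU
    simp [IsCliqueOn]
  · by_cases hc : IsCliqueOn H U <;> simp [hU, hc]

/-- Inversion over subsets: the top term is isolated by induction. -/
theorem eq_of_sum_powerset_eq {f g : Finset V → ℤ}
    (h : ∀ U : Finset V, ∑ T ∈ U.powerset, (-1 : ℤ) ^ T.card * f T =
      ∑ T ∈ U.powerset, (-1 : ℤ) ^ T.card * g T) (U : Finset V) : f U = g U := by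
  induction U using Finset.strongInduction with
  | H U ih =>
    have hU := h U
    rw [← Finset.add_sum_erase _ _ (Finset.mem_powerset_self U),
      ← Finset.add_sum_erase _ _ (Finset.mem_powerset_self U)] at hU
    have hrest : ∑ T ∈ U.powerset.erase U, (-1 : ℤ) ^ T.card * f T =
        ∑ T ∈ U.powerset.erase U, (-1 : ℤ) ^ T.card * g T := by
      refine Finset.sum_congr rfl fun T hT => ?_
      rw [Finset.mem_erase, Finset.mem_powerset] at hT
      rw [ih T (hT.2.ssubset_of_ne hT.1)]
    rw [hrest] at hU
    have := add_right_cancel hU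
    exact mul_left_cancel₀ (pow_ne_zero _ (by norm_num)) this

end Roots

/-! ### Euler characteristics of strands and the Betti numbers. -/

section Euler

set_option linter.unusedSectionVars false

namespace ScalarComplex

variable {σ K : Type*} [Field K] {In : Set (σ →₀ ℕ)} (C : ScalarComplex K In)

/-- The chains supported in `D`. -/
def chains (D : Set (σ →₀ ℕ)) (k : ℕ) : Submodule K (Fin (C.rk k) → K) where
  carrier := {x | C.IsSupp D k x}
  add_mem' := IsSupp.add
  zero_mem' := fun j hj => absurd rfl hj
  smul_mem' := fun c x hx j hj => hx j fun h => hj (by simp [h])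

variable {C}

theorem finrank_chains (D : Set (σ →₀ ℕ)) (k : ℕ) :
    Module.finrank K (C.chains D k) = Nat.card {j // C.deg k j ∈ D} := by
  classical
  let e : C.chains D k ≃ₗ[K] ({j // C.deg k j ∈ D} → K) :=
    { toFun := fun x j => x.1 j.1
      map_add' := fun _ _ => rfl
      map_smul' := fun _ _ => rfl
      invFun := fun y => ⟨fun j => if h : C.deg k j ∈ D then y ⟨j, h⟩ else 0, fun j hj => by
        by_contra h; simp [h] at hj⟩
      left_inv := fun x => by
        ext j
        by_cases h : C.deg k j ∈ D
        · simp [h]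
        · have : x.1 j = 0 := by
            by_contra h0
            exact h (x.2 j h0)
          simp [h, this]
      right_inv := fun y => by
        funext j
        simp [j.2] }
  rw [e.finrank_eq, Module.finrank_fintype_fun_eq_card, Nat.card_eq_fintype_card]

theorem Acyclic.chains_zero {D : Set (σ →₀ ℕ)} (hD : IsLowerSet D) (h : C.Acyclic D 0) :
    C.chains D 0 = (C.chains D 1).map (C.bd 0) := by
  ext x
  constructor
  · exact fun hx => h x hx trivial
  · rintro ⟨y, hy, rfl⟩
    exact IsSupp.bd hD hy

theorem Acyclic.finrank_chains_succ {D : Set (σ →₀ ℕ)} (hD : IsLowerSet D) {k : ℕ}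
    (h : C.Acyclic D (k + 1)) :
    Module.finrank K (C.chains D (k + 1)) =
      Module.finrank K ((C.chains D (k + 1)).map (C.bd k)) +
        Module.finrank K ((C.chains D (k + 2)).map (C.bd (k + 1))) := by
  have h1 := LinearMap.finrank_range_add_finrank_ker ((C.bd k).domRestrict (C.chains D (k + 1)))
  rw [LinearMap.range_domRestrict] at h1
  have h2 : (LinearMap.ker ((C.bd k).domRestrict (C.chains D (k + 1)))).map
      (C.chains D (k + 1)).subtype = (C.chains D (k + 2)).map (C.bd (k + 1)) := by
    ext x
    constructor
    · rintro ⟨⟨x, hx⟩, hker, rfl⟩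
      exact h x hx hker
    · rintro ⟨y, hy, rfl⟩
      exact ⟨⟨_, IsSupp.bd hD hy⟩, C.bd_bd k y, rfl⟩
  rw [← h1, ← h2, Submodule.finrank_map_subtype_eq]

theorem sum_neg_one_pow_finrank {D : Set (σ →₀ ℕ)} (hD : IsLowerSet D)
    (h : ∀ k, C.Acyclic D k) (M : ℕ) :
    ∑ k ∈ Finset.range (M + 1), (-1 : ℤ) ^ k * Module.finrank K (C.chains D k) =
      (-1) ^ M * Module.finrank K ((C.chains D (M + 1)).map (C.bd M)) := by
  induction M with
  | zero =>
    rw [Finset.sum_range_succ, (h 0).chains_zero hD, Finset.sum_range_zero, zero_add]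
  | succ M ih =>
    rw [Finset.sum_range_succ, ih, (h (M + 1)).finrank_chains_succ hD]
    push_cast
    ring

end ScalarComplex

variable {V : Type*} [DecidableEq V] {H : SimpleGraph V} {K : Type*} [Field K]
  {C : ScalarComplex K (nonadjacentExponents H)}

variable (C) in
/-- The number of basis elements of homological degree `k` and degree `ind T`. -/
noncomputable def bettiNumber (k : ℕ) (T : Finset V) : ℕ := Nat.card {j // C.deg k j = ind T}

theorem bettiNumber_zero {T : Finset V} (hT : T.Nonempty) : bettiNumber C 0 T = 0 := by
  rw [bettiNumber, Nat.card_eq_zero]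
  left
  rw [isEmpty_subtype]
  intro j hj
  rw [C.deg_zero] at hj
  have := congrArg Finsupp.degree hj
  rw [degree_ind, map_zero] at this
  exact hT.card_pos.ne this

theorem finrank_chains_eq_sum (hH : HasSimplicialVertices H) (k : ℕ) (U : Finset V) :
    Module.finrank K (C.chains (Set.Iic (ind U)) (k + 1)) =
      ∑ T ∈ U.powersetCard (k + 2), bettiNumber C (k + 1) T := by
  classical
  rw [ScalarComplex.finrank_chains, Nat.card_eq_fintype_card, Fintype.card_subtype]
  rw [Finset.card_eq_sum_card_fiberwise (f := fun j => (C.deg (k + 1) j).support)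
    (t := U.powersetCard (k + 2))]
  · refine Finset.sum_congr rfl fun T hT => ?_
    rw [Finset.mem_powersetCard] at hT
    rw [bettiNumber, Nat.card_eq_fintype_card, Fintype.card_subtype, Finset.filter_filter]
    congr 1
    ext j
    simp only [Finset.mem_filter, Finset.mem_univ, true_and, Set.mem_Iic]
    obtain ⟨W, hW⟩ := exists_deg_eq_ind (k + 1) j
    rw [hW, ind_le_ind, support_ind]
    constructor
    · rintro ⟨-, rfl⟩; rfl
    · intro e
      obtain rfl := ind_injective e
      exact ⟨hT.1, rfl⟩
  · intro j hj
    obtain ⟨W, hW⟩ := exists_deg_eq_ind (k + 1) j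
    simp only [Finset.coe_filter, Finset.mem_univ, true_and, Set.mem_Iic, Set.mem_ofPred_eq] at hj
    rw [hW, ind_le_ind] at hj
    simp only [Finset.mem_coe, hW, support_ind, Finset.mem_powersetCard]
    exact ⟨hj, card_of_deg_eq_ind hH hW⟩

/-- The Euler characteristic of the strand of degree at most `ind U`. -/
theorem sum_neg_one_pow_bettiNumber (hH : HasSimplicialVertices H) (U : Finset V)
    [Decidable (IsCliqueOn H U)] :
    ∑ T ∈ U.powerset, (-1 : ℤ) ^ T.card *
        (if T = ∅ then -1 else (bettiNumber C (T.card - 1) T : ℤ)) =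
      if IsCliqueOn H U then -1 else 0 := by
  rcases U.eq_empty_or_nonempty with rfl | hU
  · simp [IsCliqueOn]
  obtain ⟨M, hM⟩ := Nat.exists_eq_succ_of_ne_zero hU.card_pos.ne'
  have hn0 : Module.finrank K (C.chains (Set.Iic (ind U)) 0) = 1 := by
    rw [ScalarComplex.finrank_chains, ← C.rk_zero]
    simp only [C.deg_zero, Set.mem_Iic, zero_le]
    simp
  -- By linearity the sets of size `k + 1` account for homological degree `k`, except when `k = 0`:
  -- the basis element there has degree zero, whence the correction by 1. The empty set carries the
  -- value -1 to match the roots count at `∅`.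
  have hterm : ∀ k, ∑ T ∈ U.powersetCard (k + 1), (-1 : ℤ) ^ T.card *
      (if T = ∅ then -1 else (bettiNumber C (T.card - 1) T : ℤ)) =
      (if k = 0 then 1 else 0) -
        (-1) ^ k * Module.finrank K (C.chains (Set.Iic (ind U)) k) := by
    intro k
    have h1 : ∀ T ∈ U.powersetCard (k + 1), (-1 : ℤ) ^ T.card *
        (if T = ∅ then -1 else (bettiNumber C (T.card - 1) T : ℤ)) =
        (-1) ^ (k + 1) * bettiNumber C k T := by
      intro T hT
      rw [Finset.mem_powersetCard] at hT
      have hne : T ≠ ∅ := fun e => by simp [e] at hT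
      rw [if_neg hne, hT.2, Nat.add_sub_cancel]
    rw [Finset.sum_congr rfl h1]
    cases k with
    | zero =>
      rw [Finset.sum_eq_zero, hn0]
      · simp
      · intro T hT
        rw [Finset.mem_powersetCard] at hT
        rw [bettiNumber_zero (Finset.card_pos.mp (by omega))]
        simp
    | succ k =>
      rw [finrank_chains_eq_sum hH, ← Finset.mul_sum]
      push_cast
      ring
  rw [Finset.sum_powerset, hM, Finset.sum_range_succ', Finset.sum_congr rfl fun k _ => hterm k,
    Finset.sum_sub_distrib]
  have h0 : ∑ k ∈ Finset.range (M + 1), (if k = 0 then (1 : ℤ) else 0) = 1 := by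
    rw [Finset.sum_ite_eq' (Finset.range (M + 1)) 0]; simp
  rw [h0]
  simp only [Finset.powersetCard_zero, Finset.sum_singleton, Finset.card_empty, pow_zero, if_true]
  split_ifs with hc
  · have hzero : ∀ k, Module.finrank K (C.chains (Set.Iic (ind U)) (k + 1)) = 0 := by
      intro k
      rw [ScalarComplex.finrank_chains, Nat.card_eq_zero]
      left
      rw [isEmpty_subtype]
      exact fun j hj => Set.disjoint_left.mp (disjoint_Iic_nonadjacentExponents hc) hj
        (ScalarComplex.deg_mem isUpperSet_nonadjacentExponents k j)
    rw [Finset.sum_range_succ', Finset.sum_eq_zero fun k _ => by rw [hzero]; simp, hn0]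
    simp
  · rw [ScalarComplex.sum_neg_one_pow_finrank (isLowerSet_Iic _) fun k =>
      ScalarComplex.acyclic_Iic _ k fun _ => ind_mem_nonadjacentExponents.mpr hc]
    -- In homological degree `M + 1` every degree has size at least `M + 2`, exceeding the `M + 1`
    -- elements of `U`; hence the telescoped remainder vanishes.
    have hbot : C.chains (Set.Iic (ind U)) (M + 1) = ⊥ := by
      rw [eq_bot_iff]
      intro x hx
      rw [Submodule.mem_bot]
      funext j
      by_contra h0
      have h1 := Finsupp.degree_mono (Set.mem_Iic.mp (hx j h0))
      have h2 := ScalarComplex.le_degree (C := C) (fun _ => two_le_degree) M j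
      rw [degree_ind] at h1
      have : M + 2 ≤ U.card := h2.trans h1
      omega
    rw [hbot, Submodule.map_bot, finrank_bot]
    simp

/-- Both sides have the same alternating sum over the subsets of every set, so inversion makes them
equal. -/
theorem bettiNumber_eq {pos : V → ℕ} (h : IsElimination H pos) {k : ℕ} {W : Finset V}
    (hW : W.card = k + 2) : (bettiNumber C (k + 1) W : ℤ) = (roots H pos W).card - 1 := by
  classical
  have := eq_of_sum_powerset_eq
    (f := fun T => if T = ∅ then -1 else (bettiNumber C (T.card - 1) T : ℤ))
    (g := fun T => ((roots H pos T).card : ℤ) - 1)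
    (fun U => (sum_neg_one_pow_bettiNumber h.hasSimplicialVertices U).trans
      (sum_neg_one_pow_card_roots h U).symm) W
  have hne : W ≠ ∅ := fun e => by simp [e] at hW
  simp only [if_neg hne, hW] at this
  exact this

/-- The degrees of the basis elements in the linear resolution. -/
theorem exists_deg_eq_iff {pos : V → ℕ} (h : IsElimination H pos) (k : ℕ) (a : V →₀ ℕ) :
    (∃ j, C.deg (k + 1) j = a) ↔ ∃ W ∈ disconnectedSets H (k + 2), a = ind W := by
  have key : ∀ W : Finset V, W.card = k + 2 →
      ((∃ j, C.deg (k + 1) j = ind W) ↔ InducesDisconnected H W) := by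
    intro W hW
    have h1 := bettiNumber_eq (C := C) h hW
    have h2 : (∃ j, C.deg (k + 1) j = ind W) ↔ bettiNumber C (k + 1) W ≠ 0 := by
      rw [bettiNumber, Ne, Nat.card_eq_zero, not_or, not_isEmpty_iff, nonempty_subtype,
        not_infinite_iff_finite]
      exact ⟨fun hj => ⟨hj, inferInstance⟩, fun hj => hj.1⟩
    have h3 := (roots_nonempty h (Finset.card_pos.mp (by omega : 0 < W.card))).card_pos
    rw [h2]
    constructor
    · exact fun hne => inducesDisconnected_of_roots h (by omega)
    · intro hd
      have := hd.two_le_card_roots h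
      omega
  constructor
  · rintro ⟨j, rfl⟩
    obtain ⟨W, hW⟩ := exists_deg_eq_ind (k + 1) j
    have hcard := card_of_deg_eq_ind h.hasSimplicialVertices hW
    exact ⟨W, ⟨(key W hcard).mp ⟨j, hW⟩, hcard⟩, hW⟩
  · rintro ⟨W, ⟨hW, hcard⟩, rfl⟩
    exact (key W hcard).mpr hW

end Euler

/-! ### Linear quotients of squarefree ideals generated in one degree. -/

section LinearQuotients

set_option linter.unusedSectionVars false

variable {V : Type*} [DecidableEq V] {K : Type*} [Field K]

theorem mem_span_monomial_iff {E : Set (V →₀ ℕ)} {x : MvPolynomial V K} :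
    x ∈ Ideal.span {f : MvPolynomial V K | ∃ a, a ∈ E ∧ f = monomial a 1} ↔
      ∀ c ∈ x.support, ∃ a ∈ E, a ≤ c := by
  have h : {f : MvPolynomial V K | ∃ a, a ∈ E ∧ f = monomial a 1} =
      (fun a => monomial a (1 : K)) '' E := by
    ext f
    simp only [Set.mem_ofPred_eq, Set.mem_image, eq_comm]
  rw [h, mem_ideal_span_monomial_image]

theorem monomial_mem_span_monomial_iff {E : Set (V →₀ ℕ)} {b : V →₀ ℕ} :
    monomial b (1 : K) ∈ Ideal.span {f : MvPolynomial V K | ∃ a, a ∈ E ∧ f = monomial a 1} ↔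
      ∃ a ∈ E, a ≤ b := by
  classical
  rw [mem_span_monomial_iff, support_monomial, if_neg one_ne_zero]
  simp

theorem mem_span_X_iff {T : Set V} {x : MvPolynomial V K} :
    x ∈ Ideal.span {f : MvPolynomial V K | ∃ v ∈ T, f = X v} ↔
      ∀ c ∈ x.support, ∃ v ∈ T, c v ≠ 0 := by
  have h : {f : MvPolynomial V K | ∃ v ∈ T, f = X v} = X '' T := by
    ext f
    simp only [Set.mem_ofPred_eq, Set.mem_image, eq_comm]
  rw [h, mem_ideal_span_X_image]

theorem mem_colon_monomial_iff {E : Set (V →₀ ℕ)} {b : V →₀ ℕ} {x : MvPolynomial V K} :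
    x ∈ (Ideal.span {f : MvPolynomial V K | ∃ a, a ∈ E ∧ f = monomial a 1}).colon
        {monomial b (1 : K)} ↔
      ∀ c ∈ x.support, ∃ a ∈ E, a ≤ c + b := by
  classical
  rw [Submodule.mem_colon_singleton, smul_eq_mul, mem_span_monomial_iff]
  constructor
  · intro h c hc
    refine h (c + b) ?_
    rw [mem_support_iff] at hc ⊢
    rwa [coeff_mul_monomial, mul_one]
  · intro h c hc
    rw [mem_support_iff, coeff_mul_monomial'] at hc
    split_ifs at hc with hbc
    · obtain ⟨a, ha, hle⟩ := h (c - b) (by rw [mem_support_iff]; simpa using hc)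
      exact ⟨a, ha, by rwa [tsub_add_cancel_of_le hbc] at hle⟩
    · exact absurd rfl hc

variable (K) in
/-- The ideal generated by the squarefree monomials with supports in `F`. -/
noncomputable def squarefreeIdeal (F : Set (Finset V)) : Ideal (MvPolynomial V K) :=
  Ideal.span {f | ∃ a, a ∈ ind '' F ∧ f = monomial a 1}

theorem minGens_squarefreeIdeal {F : Set (Finset V)} {m : ℕ} (hF : ∀ W ∈ F, W.card = m) :
    minGens (squarefreeIdeal K F) = ind '' F := by
  ext a
  simp only [minGens, squarefreeIdeal, Set.mem_ofPred_eq, monomial_mem_span_monomial_iff]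
  constructor
  · rintro ⟨⟨b, hb, hba⟩, hmin⟩
    rcases hba.eq_or_lt with rfl | hlt
    · exact hb
    · exact absurd ⟨b, hb, le_rfl⟩ (hmin b hlt)
  · rintro ⟨W, hW, rfl⟩
    refine ⟨⟨_, ⟨W, hW, rfl⟩, le_rfl⟩, ?_⟩
    rintro b hb ⟨_, ⟨W', hW', rfl⟩, hle⟩
    have := Finset.card_lt_card (ind_lt_ind.mp (hle.trans_lt hb))
    rw [hF W hW, hF W' hW'] at this
    exact this.false

theorem sdiff_eq_singleton_of_ind_le {A C : Finset V} {u : V} (hcard : C.card = A.card)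
    (hne : C ≠ A) (h : ind C ≤ Finsupp.single u 1 + ind A) : C \ A = {u} := by
  have hsub : C \ A ⊆ {u} := by
    intro w hw
    rw [Finset.mem_sdiff] at hw
    have := h w
    rw [Finsupp.add_apply, ind_apply, ind_apply, if_pos hw.1, if_neg hw.2,
      Finsupp.single_apply] at this
    rw [Finset.mem_singleton]
    by_contra hwu
    rw [if_neg (Ne.symm hwu)] at this
    omega
  refine (Finset.subset_singleton_iff.mp hsub).resolve_left fun he => hne ?_
  exact Finset.eq_of_subset_of_card_le (Finset.sdiff_eq_empty_iff_subset.mp he) hcard.ge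

theorem HasLinearQuotients.hasLinearQuotientOrder {F : Set (Finset V)} {m : ℕ}
    (hF : ∀ W ∈ F, W.card = m) (h : HasLinearQuotients (squarefreeIdeal K F)) :
    HasLinearQuotientOrder F := by
  classical
  obtain ⟨q, e, hinj, hrange, hq⟩ := h
  rw [minGens_squarefreeIdeal hF] at hrange
  have hidx : ∀ W ∈ F, ∃ i, e i = ind W := fun W hW => by
    have : ind W ∈ Set.range e := hrange ▸ ⟨W, hW, rfl⟩
    exact this
  obtain rfl | ⟨W₀, hW₀⟩ := F.eq_empty_or_nonempty
  · exact ⟨fun _ => 0, by simp, by simp⟩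
  have : Nonempty (Fin q) := (hidx W₀ hW₀).nonempty
  choose! idx hidx using hidx
  refine ⟨fun W => idx W, ?_, ?_⟩
  · intro A hA B hB hAB
    apply ind_injective
    rw [← hidx A hA, ← hidx B hB, Fin.val_injective hAB]
  · intro A hA B hB hlt
    have hlt' : idx B < idx A := hlt
    obtain ⟨T, hT⟩ := hq (idx A) (lt_of_le_of_lt (Nat.zero_le _) hlt)
    have hset : {f : MvPolynomial V K | ∃ j, j < idx A ∧ f = monomial (e j) 1} =
        {f | ∃ a, a ∈ {a | ∃ j, j < idx A ∧ a = e j} ∧ f = monomial a 1} := by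
      ext f
      constructor
      · rintro ⟨j, hj, rfl⟩; exact ⟨_, ⟨j, hj, rfl⟩, rfl⟩
      · rintro ⟨_, ⟨j, hj, rfl⟩, rfl⟩; exact ⟨j, hj, rfl⟩
    rw [hset, hidx A hA] at hT
    -- The monomial on `B \ A` lies in the colon ideal, so one of its variables `u` does. An earlier
    -- generator then divides `x_u x^A`, and equal cardinality leaves `u` as its only vertex outside
    -- `A`.
    have hmon : monomial (ind (B \ A)) (1 : K) ∈ Ideal.span {f : MvPolynomial V K | ∃ v ∈ T, f = X v} := by
      rw [← hT, mem_colon_monomial_iff, support_monomial, if_neg one_ne_zero]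
      intro c hc
      obtain rfl := Finset.mem_singleton.mp hc
      refine ⟨_, ⟨idx B, hlt', rfl⟩, ?_⟩
      rw [hidx B hB]
      intro v
      simp only [Finsupp.add_apply, ind_apply, Finset.mem_sdiff]
      by_cases hvA : v ∈ A <;> by_cases hvB : v ∈ B <;> simp [hvA, hvB]
    rw [mem_span_X_iff, support_monomial, if_neg one_ne_zero] at hmon
    obtain ⟨u, huT, hu⟩ := hmon _ (Finset.mem_singleton_self _)
    have huBA : u ∈ B \ A := by
      by_contra h0
      exact hu (by rw [ind_apply, if_neg h0])
    have hX : (X u : MvPolynomial V K) ∈ Ideal.span {f : MvPolynomial V K | ∃ v ∈ T, f = X v} :=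
      Ideal.subset_span ⟨u, huT, rfl⟩
    rw [← hT, mem_colon_monomial_iff, support_X] at hX
    obtain ⟨_, ⟨j, hj, rfl⟩, hle⟩ := hX _ (Finset.mem_singleton_self _)
    obtain ⟨C, hC, hCj⟩ : e j ∈ ind '' F := hrange ▸ ⟨j, rfl⟩
    have hCidx : idx C = j := hinj (by rw [hidx C hC, hCj])
    subst hCidx
    refine ⟨C, hC, hj, u, (Finset.mem_sdiff.mp huBA).1, ?_⟩
    rw [← hCj] at hle
    refine sdiff_eq_singleton_of_ind_le (by rw [hF C hC, hF A hA]) ?_ hle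
    rintro rfl
    exact hj.false

theorem HasLinearQuotientOrder.hasLinearQuotients [Finite V] {F : Set (Finset V)} {m : ℕ}
    (hF : ∀ W ∈ F, W.card = m) (h : HasLinearQuotientOrder F) :
    HasLinearQuotients (squarefreeIdeal K F) := by
  classical
  obtain ⟨r, hinj, hr⟩ := h
  -- The ranks may have gaps; listing the finite set of attained values in increasing order gives
  -- the enumeration of generators.
  obtain ⟨R, hR⟩ : ∃ R : Finset ℕ, ∀ x, x ∈ R ↔ x ∈ r '' F :=
    ⟨((Set.toFinite F).image r).toFinset, fun x => Set.Finite.mem_toFinset _⟩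
  have hex : ∀ i : Fin R.card, ∃ W ∈ F, r W = R.orderEmbOfFin rfl i := fun i => by
    have := R.orderEmbOfFin_mem rfl i
    rwa [hR] at this
  choose w hwF hw using hex
  have hlt : ∀ i j, i < j ↔ r (w i) < r (w j) := fun i j => by
    rw [hw, hw, OrderEmbedding.lt_iff_lt]
  have hsurj : ∀ W ∈ F, ∃ i, w i = W := by
    intro W hW
    have : r W ∈ Set.range (R.orderEmbOfFin rfl) := by
      rw [Finset.range_orderEmbOfFin, Finset.mem_coe, hR]
      exact ⟨W, hW, rfl⟩
    obtain ⟨i, hi⟩ := this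
    exact ⟨i, hinj (hwF i) hW (by rw [hw, hi])⟩
  refine ⟨R.card, fun i => ind (w i), ?_, ?_, ?_⟩
  · intro i j hij
    have := ind_injective hij
    exact (R.orderEmbOfFin rfl).injective (by rw [← hw, ← hw, this])
  · rw [minGens_squarefreeIdeal hF]
    ext a
    constructor
    · rintro ⟨i, rfl⟩; exact ⟨w i, hwF i, rfl⟩
    · rintro ⟨W, hW, rfl⟩
      obtain ⟨i, rfl⟩ := hsurj W hW
      exact ⟨i, rfl⟩
  · intro i _
    refine ⟨{u | ∃ C ∈ F, r C < r (w i) ∧ C \ w i = {u}}, ?_⟩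
    have hset : {f : MvPolynomial V K | ∃ j, j < i ∧ f = monomial (ind (w j)) 1} =
        {f | ∃ a, a ∈ {a | ∃ C ∈ F, r C < r (w i) ∧ a = ind C} ∧ f = monomial a 1} := by
      ext f
      constructor
      · rintro ⟨j, hj, rfl⟩; exact ⟨_, ⟨w j, hwF j, (hlt j i).mp hj, rfl⟩, rfl⟩
      · rintro ⟨_, ⟨C, hC, hlt', rfl⟩, rfl⟩
        obtain ⟨j, rfl⟩ := hsurj C hC
        exact ⟨j, (hlt j i).mpr hlt', rfl⟩
    rw [hset]
    ext x
    rw [mem_colon_monomial_iff, mem_span_X_iff]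
    refine forall₂_congr fun c _ => ?_
    constructor
    · rintro ⟨_, ⟨B, hB, hBlt, rfl⟩, hle⟩
      obtain ⟨C, hC, hClt, u, huB, hCu⟩ := hr _ (hwF i) B hB hBlt
      refine ⟨u, ⟨C, hC, hClt, hCu⟩, ?_⟩
      have huA : u ∉ w i := (Finset.mem_sdiff.mp (hCu ▸ Finset.mem_singleton_self u)).2
      have := hle u
      rw [Finsupp.add_apply, ind_apply, ind_apply, if_pos huB, if_neg huA] at this
      omega
    · rintro ⟨u, ⟨C, hC, hClt, hCu⟩, hu⟩
      refine ⟨_, ⟨C, hC, hClt, rfl⟩, fun v => ?_⟩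
      rw [Finsupp.add_apply, ind_apply, ind_apply]
      by_cases hvC : v ∈ C
      · by_cases hvA : v ∈ w i
        · simp [hvA, hvC]
        · have : v ∈ C \ w i := Finset.mem_sdiff.mpr ⟨hvC, hvA⟩
          rw [hCu, Finset.mem_singleton] at this
          subst this
          simp only [hvA, hvC, if_true, if_false]
          omega
      · simp [hvC]

theorem hasLinearQuotients_squarefreeIdeal_iff [Finite V] {F : Set (Finset V)} {m : ℕ}
    (hF : ∀ W ∈ F, W.card = m) :
    HasLinearQuotients (squarefreeIdeal K F) ↔ HasLinearQuotientOrder F :=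
  ⟨fun h => h.hasLinearQuotientOrder hF, fun h => h.hasLinearQuotients hF⟩

end LinearQuotients

/-! ### Shifts of the edge ideal, and the conclusion. -/

section EdgeIdeal

set_option linter.unusedSectionVars false

variable {V : Type*} {K : Type*} [Field K] {G : SimpleGraph V}

theorem monomial_mem_edgeIdeal_iff {a : V →₀ ℕ} :
    monomial a (1 : K) ∈ edgeIdeal K G ↔ a ∈ nonadjacentExponents Gᶜ := by
  classical
  have h : {f : MvPolynomial V K | ∃ u v, G.Adj u v ∧ f = X u * X v} =
      {f | ∃ a, a ∈ {a | ∃ u v, G.Adj u v ∧ a = Finsupp.single u 1 + Finsupp.single v 1} ∧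
        f = monomial a 1} := by
    ext f
    constructor
    · rintro ⟨u, v, huv, rfl⟩
      exact ⟨_, ⟨u, v, huv, rfl⟩, by rw [X, X, monomial_mul, one_mul]⟩
    · rintro ⟨_, ⟨u, v, huv, rfl⟩, rfl⟩
      exact ⟨u, v, huv, by rw [X, X, monomial_mul, one_mul]⟩
  rw [edgeIdeal, h, monomial_mem_span_monomial_iff]
  constructor
  · rintro ⟨_, ⟨u, v, huv, rfl⟩, hle⟩
    refine ⟨u, v, huv.ne, by simp [huv], ?_, ?_⟩
    · have := hle u
      simp only [Finsupp.add_apply, Finsupp.single_eq_same] at this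
      omega
    · have := hle v
      simp only [Finsupp.add_apply, Finsupp.single_eq_same] at this
      omega
  · rintro ⟨u, v, hne, hadj, hu, hv⟩
    rw [SimpleGraph.compl_adj, not_and, not_not] at hadj
    refine ⟨_, ⟨u, v, hadj hne, rfl⟩, fun w => ?_⟩
    rw [Finsupp.add_apply, Finsupp.single_apply, Finsupp.single_apply]
    split_ifs with h1 h2 h2
    · exact absurd (h1.trans h2.symm) hne
    · subst h1; omega
    · subst h2; omega
    · omega

theorem IsCoChordal.exists_isElimination (hG : IsCoChordal G) :
    ∃ pos, IsElimination Gᶜ pos := by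
  obtain ⟨n, z, hz⟩ := hG
  refine ⟨fun v => z.symm v, fun v w h => z.symm.injective (Fin.val_injective h), ?_⟩
  intro w x y hx hy hwx hwy hxy
  have := hz (z.symm w)
  rw [z.apply_symm_apply] at this
  exact this ⟨hx, z.symm x, le_of_lt hwx, z.apply_symm_apply x⟩
    ⟨hy, z.symm y, le_of_lt hwy, z.apply_symm_apply y⟩ hxy

variable [DecidableEq V]

theorem MinimalFreeResolution.exists_shift_eq_iff (hG : IsCoChordal G)
    (F : MinimalFreeResolution (edgeIdeal K G)) (k : ℕ) (a : V →₀ ℕ) :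
    (∃ j, F.shift k j = a) ↔ ∃ W ∈ disconnectedSets Gᶜ (k + 2), a = ind W := by
  obtain ⟨pos, hpos⟩ := hG.exists_isElimination
  have h0 : monomial 0 (1 : K) ∉ edgeIdeal K G := by
    rw [monomial_mem_edgeIdeal_iff]
    rintro ⟨u, v, -, -, hu, -⟩
    exact hu rfl
  obtain ⟨C, hC⟩ := F.exists_scalarComplex h0
  have hIn : {a | monomial a (1 : K) ∈ edgeIdeal K G} = nonadjacentExponents Gᶜ :=
    Set.ext fun a => monomial_mem_edgeIdeal_iff
  rw [← hC]
  clear hC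
  revert C
  rw [hIn]
  exact fun C => exists_deg_eq_iff hpos k a

/-- The shifts of the edge ideal of a co-chordal graph. -/
theorem isShift_edgeIdeal_iff (hG : IsCoChordal G)
    (hF : Nonempty (MinimalFreeResolution (edgeIdeal K G))) (k : ℕ) (a : V →₀ ℕ) :
    IsShift (edgeIdeal K G) k a ↔ ∃ W ∈ disconnectedSets Gᶜ (k + 2), a = ind W := by
  constructor
  · rintro ⟨F, hj⟩
    exact (F.exists_shift_eq_iff hG k a).mp hj
  · obtain ⟨F⟩ := hF
    exact fun h => ⟨F, (F.exists_shift_eq_iff hG k a).mpr h⟩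

theorem homologicalShiftIdeal_edgeIdeal (hG : IsCoChordal G)
    (hF : Nonempty (MinimalFreeResolution (edgeIdeal K G))) (k : ℕ) :
    homologicalShiftIdeal k (edgeIdeal K G) =
      squarefreeIdeal K (disconnectedSets Gᶜ (k + 2)) := by
  rw [homologicalShiftIdeal, squarefreeIdeal]
  congr 1
  ext f
  simp only [isShift_edgeIdeal_iff hG hF, Set.mem_ofPred_eq, Set.mem_image, eq_comm]

/-- `IsShift` quantifies over resolutions, so without one the shift ideal would be generated by the
empty set; nonvanishing thus supplies a resolution. -/
theorem nonempty_of_homologicalShiftIdeal_ne_bot {I : Ideal (MvPolynomial V K)} {k : ℕ}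
    (h : homologicalShiftIdeal k I ≠ ⊥) : Nonempty (MinimalFreeResolution I) := by
  by_contra hF
  apply h
  rw [homologicalShiftIdeal, Ideal.span_eq_bot]
  rintro _ ⟨a, ⟨F, -⟩, -⟩
  exact absurd ⟨F⟩ hF

theorem InducesDisconnected.two_le_card {H : SimpleGraph V} {W : Finset V}
    (h : InducesDisconnected H W) : 2 ≤ W.card := by
  obtain ⟨A, B, hA, hB, hd, rfl, -⟩ := h
  rw [Finset.card_union_of_disjoint hd]
  have := hA.card_pos
  have := hB.card_pos
  omega

theorem card_le_of_pd_eq (hG : IsCoChordal G)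
    (hF : Nonempty (MinimalFreeResolution (edgeIdeal K G))) {n : ℕ}
    (hpd : pd (edgeIdeal K G) = (n : WithBot ℕ∞)) {W : Finset V}
    (hW : InducesDisconnected Gᶜ W) : W.card ≤ n + 2 := by
  obtain ⟨k, hk⟩ := Nat.exists_eq_add_of_le' hW.two_le_card
  have hshift : ∃ a, IsShift (edgeIdeal K G) k a :=
    ⟨ind W, (isShift_edgeIdeal_iff hG hF k _).mpr ⟨W, ⟨hW, hk⟩, rfl⟩⟩
  have hle : (k : WithBot ℕ∞) ≤ n := by
    rw [← hpd, pd]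
    exact le_iSup₂ (f := fun (k : ℕ) (_ : ∃ a, IsShift (edgeIdeal K G) k a) =>
      (k : WithBot ℕ∞)) k hshift
  have : k ≤ n := by exact_mod_cast hle
  omega

end EdgeIdeal

theorem theorem5p3 (K : Type*) [Field K] {V : Type*} [Finite V] (G : SimpleGraph V)
    (hG : IsCoChordal G) : ¬ LQSequenceEq K G [true, false, true, false] := by
  classical
  cases nonempty_fintype V
  rintro ⟨hpd, h⟩
  have hF := nonempty_of_homologicalShiftIdeal_ne_bot (h 0).1
  have hLQ : ∀ k, HasLinearQuotients (homologicalShiftIdeal k (edgeIdeal K G)) ↔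
      HasLinearQuotientOrder (disconnectedSets Gᶜ (k + 2)) := fun k => by
    rw [homologicalShiftIdeal_edgeIdeal hG hF]
    exact hasLinearQuotients_squarefreeIdeal_iff fun W hW => hW.2
  obtain ⟨pos, hpos⟩ := hG.exists_isElimination
  -- Position `i` of the word concerns homological degree `i + 1`, hence disconnected sets of size
  -- `i + 3`.
  have h2 := (h 1).2.trans (hLQ 2)
  have h3 := (h 2).2.trans (hLQ 3)
  have h4 := (h 3).2.trans (hLQ 4)
  have h7 : ∀ W, InducesDisconnected Gᶜ W → W.card ≤ 6 := fun W hW =>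
    card_le_of_pd_eq (n := 4) hG hF hpd hW
  exact Bool.false_ne_true (h2.mpr (hasLinearQuotientOrder_four hpos.hasSimplicialVertices h7
    (h3.mp rfl) fun h6 => Bool.false_ne_true (h4.mpr h6)))
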